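/- Let $\Omega\subset\mathbb C$ be a bounded simply connected domain with smooth boundary, and let $\Omega_0$ be a measurable set with $\overline{\Omega_0}\subset\Omega$. For $\mu\in L^\infty(\Omega_0)$, extended by zero, $k\in\mathbb C$ and a sign $\pm$, let $\omega^\pm_\mu(\cdot,k)$ be the solution of $$\bar\partial f_\pm=\pm\mu\,\overline{\partial f_\pm},\qquad f_\pm(z)=e^{ikz}\bigl(1+\omega^\pm_\mu(z,k)\bigr),\qquad \omega^\pm_\mu(z,k)=O(1/|z|)\ \ (|z|\to\infty),$$ with $f_\pm\in W^{1,2}_{loc}(\mathbb C)$. For every $k$ this solution exists and is unique for all $\mu$ in a neighbourhood of $0$ in $L^\infty(\Omega_0)$, and the map $W^\pm(\cdot\,;k):\mu\mapsto\bigl(\omega^\pm_\mu|_{\Omega},\,\omega^\pm_\mu|_{\partial\Omega}\bigr)\in L^2(\Omega)\times C(\partial\Omega)$ is real Fréchet differentiable at $\mu=0$. Let $\omega_1^\pm(z,k)$, $z\in\partial\Omega$, be the boundary values of its derivative at $0$ in the direction $\mu$, and put, in the sense of tempered distributions in $t$, $$\widehat\omega_1^\pm(z,t,e^{i\varphi})=\int_{\mathbb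 R}e^{-it\tau}\,\omega_1^\pm(z,\tau e^{i\varphi})\,d\tau,\qquad T_1^{a,\pm}\mu(t,e^{i\varphi})=\frac1{2\pi i}\int_{\partial\Omega}\widehat\omega_1^\pm(z,t,e^{i\varphi})\,d\mathbf z ,$$ the second integral being a positively oriented complex contour integral. For a test function $\psi\in C_c^\infty(\mathbb C)$ let $T_1^{a,\pm}\psi$ be defined in the same way, with any bounded simply connected domain with smooth boundary that contains $\operatorname{supp}\psi$ in place of $\Omega$; the result is a function of $(t,e^{i\varphi})$, rapidly decreasing in $t$, that does not depend on the domain. Let $(T_1^{a,\pm})^*$ be the adjoint, $\langle (T_1^{a,\pm})^*G,\psi\rangle=\langle G,T_1^{a,\pm}\psi\rangle$ for all $\psi\in C_c^\infty(\mathbb C)$, where both pairings are sesquilinear, $\mathbb C$ carries Lebesgue measure, and $\mathbb R\times\mathbb S^1$ carries the measure $dt\,\frac{d\varphi}{2\pi}$. Let $(-\Delta)^{-1/2}$ be the Fourier multiplier $|\xi|^{-1}$ on the plane. Then for every $\mu\in L^\infty(\Omega_0)$ and either sign, $T_1^{a,\pm}\mu$ is a well-defined distribution (tempered in $t$ for each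 $e^{i\varphi}$), $(T_1^{a,\pm})^*T_1^{a,\pm}\mu$ is a well-defined tempered distribution on the plane whose Fourier transform is a function, and $$(-\Delta)^{-1/2}\,(T_1^{a,\pm})^{*}\,T_1^{a,\pm}\mu=\mu .$$ -/

import Mathlib

open MeasureTheory Filter Topology Set
open scoped SchwartzMap ComplexConjugate

noncomputable section

/-! ### Smooth bounded simply connected plane domains and their boundary contours -/

/-- A bounded simply connected domain of the plane with smooth boundary, together with a positively
oriented parametrization of its boundary: a bounded connected open set whose frontier is a single
smooth regular simple closed curve `γ` (of period one), which has the domain on its left.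
(By the Jordan curve theorem such a domain is the interior of the curve, and simply connected.) -/
structure SmoothJordanDomain where
  carrier : Set ℂ
  γ : ℝ → ℂ
  isOpen : IsOpen carrier
  isConnected : IsConnected carrier
  isBounded : Bornology.IsBounded carrier
  smooth : ContDiff ℝ (⊤ : ℕ∞) γ
  periodic : Function.Periodic γ 1
  injOn : InjOn γ (Ico 0 1)
  deriv_ne_zero : ∀ x, deriv γ x ≠ 0
  range_eq : range γ = frontier carrier
  left_mem : ∀ x, ∀ᶠ r : ℝ in 𝓝[>] 0, γ x + (r : ℂ) * (Complex.I * deriv γ x) ∈ carrier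

namespace SmoothJordanDomain

/-- The point `γ x` as a point of the boundary. -/
def bdryPt (D : SmoothJordanDomain) (x : ℝ) : frontier D.carrier :=
  ⟨D.γ x, D.range_eq ▸ mem_range_self x⟩

/-- The function whose integral over `[0, 1]` is the complex contour integral `∫_{∂Ω} F(z) dz`. -/
def contourIntegrand (D : SmoothJordanDomain) (F : frontier D.carrier → ℂ) (x : ℝ) : ℂ :=
  F (D.bdryPt x) * deriv D.γ x

/-- The complex contour integral `∫_{∂Ω} F(z) dz`. -/
def contourIntegral (D : SmoothJordanDomain) (F : frontier D.carrier → ℂ) : ℂ :=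
  ∫ x in (0 : ℝ)..1, D.contourIntegrand F x

end SmoothJordanDomain

/-! ### Weak Wirtinger derivatives and the Beltrami equation -/

/-- `∂φ = (φ_x - i φ_y) / 2`. -/
def dz (φ : ℂ → ℂ) (z : ℂ) : ℂ :=
  (1 / 2) * (fderiv ℝ φ z 1 - Complex.I * fderiv ℝ φ z Complex.I)

/-- `∂̄φ = (φ_x + i φ_y) / 2`. -/
def dzbar (φ : ℂ → ℂ) (z : ℂ) : ℂ :=
  (1 / 2) * (fderiv ℝ φ z 1 + Complex.I * fderiv ℝ φ z Complex.I)

/-- `f ∈ L²_loc(ℂ)`. -/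
def MemL2Loc (f : ℂ → ℂ) : Prop :=
  ∀ K : Set ℂ, IsCompact K → MemLp f 2 (volume.restrict K)

/-- `p` is the weak derivative `∂f`. -/
def IsWeakDz (f p : ℂ → ℂ) : Prop :=
  ∀ φ : ℂ → ℂ, ContDiff ℝ (⊤ : ℕ∞) φ → HasCompactSupport φ →
    ∫ z, f z * dz φ z = - ∫ z, p z * φ z

/-- `q` is the weak derivative `∂̄f`. -/
def IsWeakDzbar (f q : ℂ → ℂ) : Prop :=
  ∀ φ : ℂ → ℂ, ContDiff ℝ (⊤ : ℕ∞) φ → HasCompactSupport φ →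
    ∫ z, f z * dzbar φ z = - ∫ z, q z * φ z

/-- `f ∈ W^{1,2}_loc(ℂ)` is a weak solution of `∂̄f = m · conj (∂f)`. -/
def IsBeltramiSolution (m f : ℂ → ℂ) : Prop :=
  ∃ p q : ℂ → ℂ, MemL2Loc f ∧ MemL2Loc p ∧ MemL2Loc q ∧ IsWeakDz f p ∧ IsWeakDzbar f q ∧
    ∀ᵐ z, q z = m z * conj (p z)

/-- `ω(·, k)` belongs to the CGO solution `f = e^{ikz}(1 + ω)` of the Beltrami equation with
coefficient `m`, where `m = 0` off `Ω₀`: it satisfies `ω = O(1/|z|)` at infinity. Since `ω` is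
holomorphic off the closure of `Ω₀`, its representative is taken to be continuous there; this makes
the values of `ω` on curves outside `Ω₀` meaningful. -/
def IsCGO (Ω₀ : Set ℂ) (m : ℂ → ℂ) (k : ℂ) (ω : ℂ → ℂ) : Prop :=
  IsBeltramiSolution m (fun z => Complex.exp (Complex.I * k * z) * (1 + ω z)) ∧
    ω =O[Bornology.cobounded ℂ] (fun z => z⁻¹) ∧
    ContinuousOn ω (closure Ω₀)ᶜ

/-! ### The scattering map `μ ↦ ω_μ^±(·, k)` and its derivative at `μ = 0` -/

/-- `L^∞(Ω₀)`: the Banach space of the coefficients `μ`, extended by zero to the plane. -/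
abbrev CoeffSpace (Ω₀ : Set ℂ) : Type := Lp ℂ ⊤ (volume.restrict Ω₀)

/-- The space `L²(Ω) × C(∂Ω)`, whose elements are the pairs of a function on `Ω` and its trace on
`∂Ω`. -/
abbrev TraceSpace (D : SmoothJordanDomain) : Type :=
  Lp ℂ 2 (volume.restrict D.carrier) × BoundedContinuousFunction (frontier D.carrier) ℂ

/-- The coefficient `±μ`, extended by zero to the plane. -/
def signedCoeff (Ω₀ : Set ℂ) (s : ℤˣ) (μ : CoeffSpace Ω₀) : ℂ → ℂ :=
  Ω₀.indicator (fun z => ((s : ℤ) : ℂ) * μ z)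

/-- `y` is the pair `(ω|_Ω, ω|_∂Ω)` for the CGO function `ω = ω_μ^±(·, k)`. -/
def IsCGOTrace (D : SmoothJordanDomain) (Ω₀ : Set ℂ) (s : ℤˣ) (k : ℂ) (μ : CoeffSpace Ω₀)
    (y : TraceSpace D) : Prop :=
  ∃ ω : ℂ → ℂ, IsCGO Ω₀ (signedCoeff Ω₀ s μ) k ω ∧
    (∀ᵐ z ∂(volume.restrict D.carrier), y.1 z = ω z) ∧
    ∀ z : frontier D.carrier, y.2 z = ω z

open Classical in
/-- The nonlinear map `W^±(·; k) : μ ↦ ω_μ^±(·, k)`. -/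
def cgoMap (D : SmoothJordanDomain) (Ω₀ : Set ℂ) (s : ℤˣ) (k : ℂ) (μ : CoeffSpace Ω₀) :
    TraceSpace D :=
  if h : ∃ y, IsCGOTrace D Ω₀ s k μ y then h.choose else 0

/-- The first-order scattering term `ω_1^±(z, k)`, `z ∈ ∂Ω`: the boundary values of the Fréchet
derivative of `W^±(·; k)` at `0`, in the direction `μ`. -/
def firstTerm (D : SmoothJordanDomain) (Ω₀ : Set ℂ) (s : ℤˣ) (μ : CoeffSpace Ω₀) (k : ℂ)
    (z : frontier D.carrier) : ℂ :=
  (fderiv ℝ (cgoMap D Ω₀ s k) 0 μ).2 z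

/-! ### Partial Fourier transform and boundary average -/

/-- The Fourier transform `∫ e^{-itτ} g(t) dt`. -/
def fourierLine (g : ℝ → ℂ) (τ : ℝ) : ℂ :=
  ∫ t : ℝ, Complex.exp (-(Complex.I * t * τ)) * g t

/-- The function of `τ` whose integral is the pairing of `g` with the distribution
`ω̂_1^±(z, ·, e) = ∫ e^{-itτ} ω_1^±(z, τe) dτ`. -/
def pairingIntegrand (D : SmoothJordanDomain) (Ω₀ : Set ℂ) (s : ℤˣ) (μ : CoeffSpace Ω₀)
    (e : Circle) (g : 𝓢(ℝ, ℂ)) (z : frontier D.carrier) (τ : ℝ) : ℂ :=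
  firstTerm D Ω₀ s μ ((τ : ℂ) * (e : ℂ)) z * fourierLine g τ

/-- The pairing of the tempered distribution `ω̂_1^±(z, ·, e)` with `g`. -/
def firstTermHat (D : SmoothJordanDomain) (Ω₀ : Set ℂ) (s : ℤˣ) (μ : CoeffSpace Ω₀)
    (e : Circle) (g : 𝓢(ℝ, ℂ)) (z : frontier D.carrier) : ℂ :=
  ∫ τ : ℝ, pairingIntegrand D Ω₀ s μ e g z τ

/-- `G` is `T_1^{a,±} μ`: for each direction `e ∈ S¹`, the tempered distribution `G e` of the
variable `t` is `(2πi)⁻¹ ∫_{∂Ω} ω̂_1^±(z, ·, e) dz`, all the integrals being convergent. -/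
def IsAveragedFirstTerm (D : SmoothJordanDomain) (Ω₀ : Set ℂ) (s : ℤˣ) (μ : CoeffSpace Ω₀)
    (G : Circle → 𝓢'(ℝ, ℂ)) : Prop :=
  ∀ (e : Circle) (g : 𝓢(ℝ, ℂ)),
    (∀ z, Integrable (pairingIntegrand D Ω₀ s μ e g z)) ∧
    IntervalIntegrable (D.contourIntegrand (firstTermHat D Ω₀ s μ e g)) volume 0 1 ∧
    G e g = (2 * Real.pi * Complex.I)⁻¹ * D.contourIntegral (firstTermHat D Ω₀ s μ e g)

/-! ### The adjoint and the inverse square root of the Laplacian -/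

/-- The complex conjugate of a Schwartz function. -/
def conjSchwartz {E : Type*} [NormedAddCommGroup E] [NormedSpace ℝ E] (g : 𝓢(E, ℂ)) : 𝓢(E, ℂ) :=
  SchwartzMap.postcompCLM (Complex.conjCLE : ℂ →L[ℝ] ℂ) g

/-- The distribution on the line given by the function `h`. -/
def ofSchwartz (h : 𝓢(ℝ, ℂ)) : 𝓢'(ℝ, ℂ) :=
  SchwartzMap.toTemperedDistributionCLM ℝ ℂ volume h

/-- `T_1^{a,±} ψ` is the function `h` on `ℝ × S¹`, rapidly decreasing in `t`, for the test function
`ψ` with compact support in the plane. It may be formed with any domain `D` that contains the support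
of `ψ`, and `h` does not depend on `D`. -/
def IsAveragedTest (s : ℤˣ) (ψ : 𝓢(ℂ, ℂ)) (h : Circle → 𝓢(ℝ, ℂ)) : Prop :=
  ∀ (D : SmoothJordanDomain) (Ω₀ : Set ℂ), MeasurableSet Ω₀ → closure Ω₀ ⊆ D.carrier →
    tsupport ψ ⊆ Ω₀ →
      ∀ ν : CoeffSpace Ω₀, (∀ᵐ z ∂(volume.restrict Ω₀), ν z = ψ z) →
        IsAveragedFirstTerm D Ω₀ s ν (fun e => ofSchwartz (h e))

/-- `w = (T_1^{a,±})^* G`, for a distribution `G` on `ℝ × S¹` (given by its slices `G e`): for every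
test function `ψ` with compact support in the plane, `⟨w, ψ⟩ = ⟨G, T_1^{a,±} ψ⟩`. Both pairings are
sesquilinear, and `ℝ × S¹` carries the measure `dt dφ / (2π)`. -/
def IsAdjointImage (s : ℤˣ) (G : Circle → 𝓢'(ℝ, ℂ)) (w : 𝓢'(ℂ, ℂ)) : Prop :=
  ∀ ψ : 𝓢(ℂ, ℂ), HasCompactSupport ψ →
    ∃ h : Circle → 𝓢(ℝ, ℂ), IsAveragedTest s ψ h ∧
      IntervalIntegrable
        (fun φ : ℝ => G (Circle.exp φ) (conjSchwartz (h (Circle.exp φ)))) volume 0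
        (2 * Real.pi) ∧
      w (conjSchwartz ψ) = (2 * Real.pi : ℂ)⁻¹ *
        ∫ φ in (0 : ℝ)..(2 * Real.pi), G (Circle.exp φ) (conjSchwartz (h (Circle.exp φ)))

/-- The tempered distribution `w` on the plane is (integration against) the function `m`. -/
def IsGivenBy (w : 𝓢'(ℂ, ℂ)) (m : ℂ → ℂ) : Prop :=
  ∀ g : 𝓢(ℂ, ℂ), Integrable (fun z => m z * g z) ∧ w g = ∫ z, m z * g z

open scoped FourierTransform in
/-- `v = (-Δ)^{-1/2} w`: the Fourier transform of `w` is a function, and dividing it by the symbol of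
`(-Δ)^{1/2}` gives the Fourier transform of `v`. With the kernel `e^{-2πi x·ξ}` of `𝓕`, this symbol
is `2π|ξ|`. -/
def IsInvSqrtNegLaplacian (w v : 𝓢'(ℂ, ℂ)) : Prop :=
  ∃ m : ℂ → ℂ, IsGivenBy (𝓕 w) m ∧ IsGivenBy (𝓕 v) (fun ξ => m ξ / ((2 * Real.pi * ‖ξ‖ : ℝ) : ℂ))

end

/-! The derivative of the scattering map at zero is explicit, and its boundary average is a filtered
Radon-type transform whose normal operator is a Fourier multiplier.

Seek `ω = C h` with `C` the Cauchy transform, so that `∂̄ω = h` and `∂ω = B h` with `B` the Beurling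
transform. Dividing the Beltrami equation by `e^{ikz}` gives `h = ±μ p_k conj(ik(1 + C h) + B h)` on
`Ω₀`, where `p_k(w) = e^{-2i Re(kw)}` is `phase`. This is equivalent to the CGO problem: a decaying
weak solution of `∂̄u = 0` vanishes (`ae_eq_zero_of_isWeakDzbar_zero`), and `B` is bounded on `L²`
because it is an isometry on test functions (`integral_cauchyTransform_dz_mul_conj`). For small `μ`
the equation has exactly one solution by a Neumann series. That solution is `O(‖μ‖)`, so the terms
on the right containing `h` are quadratic, and the derivative at zero is `C(±μ p_k conj(ik))`
(`hasFDerivAt_of_fixedPoint`, `firstTerm_eq`).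

The boundary winds once around every point of the domain (`windingIntegral_eq`), so `(2πi)⁻¹ ∮ C f
dz = π⁻¹ ∫ f` (`contourIntegral_cauchyTransform`). Hence the averaged term is the Fourier transform
in `τ` of `±π⁻¹ conj(ik) (𝓕 μ)(conj k / π)` at `k = τe`; this function of `k` is `symbol`.

Pair two such terms. Plancherel in `τ` gives a factor `2π`, which cancels the `1/(2π)` of the
angular measure. The signs cancel, and the product of symbols carries `|k|²/π²`. The oriented lines
through the origin cover the plane twice, with density `|k|⁻¹` (`intervalIntegral_integral_line`).
After `k = π conj ξ` the pairing is `∫ 2π|ξ| 𝓕μ conj(𝓕ψ)`, and `2π|ξ|` is the symbol of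
`(-Δ)^{1/2}`. -/

noncomputable section

/-! ### The winding number of the boundary of a smooth Jordan domain -/

/-- The curve crosses zero vertically: `ζ x ≈ icx`, so `ζ² ≈ -c²x²` and subtracting `ε²` cannot
cancel it. Away from zero `‖ζ‖` is bounded below and dominates `ε`. The bound supplies the
integrable majorant in `tendsto_integral_jump`. -/
lemma exists_lower_bound_sq_sub_sq {ζ : ℝ → ℂ} (hζ : Continuous ζ) (h0 : ζ 0 = 0) {c : ℝ}
    (hc : 0 < c) (hd : HasDerivAt ζ (c * Complex.I) 0)
    (hne : ∀ x ∈ Icc (-1 / 2 : ℝ) (1 / 2), x ≠ 0 → ζ x ≠ 0) :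
    ∃ m > 0, ∃ ε₀ > 0, ∀ ε : ℝ, 0 < ε → ε < ε₀ → ∀ x ∈ Icc (-1 / 2 : ℝ) (1 / 2),
      m * (x ^ 2 + ε ^ 2) ≤ ‖ζ x ^ 2 - (ε : ℂ) ^ 2‖ := by
  -- An error of at most `(c/8)|x|` in `ζ` gives an error of at most `(c/8)(2c + c/8)x² =
  -- (17/64)c²x²` in `ζ²`, so at least half of `c²x²` survives.
  have hlo := (hasDerivAt_iff_isLittleO.1 hd).def (c := c / 8) (by positivity)
  obtain ⟨δ, hδ, hnear⟩ := Metric.eventually_nhds_iff.1 hlo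
  have hK : IsCompact (Icc (-1 / 2 : ℝ) (1 / 2) ∩ {x | δ ≤ |x|}) :=
    isCompact_Icc.inter_right (isClosed_le continuous_const continuous_abs)
  obtain ⟨η, hη, hfar⟩ : ∃ η > 0, ∀ x ∈ Icc (-1 / 2 : ℝ) (1 / 2) ∩ {x | δ ≤ |x|}, η ≤ ‖ζ x‖ := by
    rcases (Icc (-1 / 2 : ℝ) (1 / 2) ∩ {x | δ ≤ |x|}).eq_empty_or_nonempty with he | hne'
    · exact ⟨1, one_pos, by rw [he]; simp⟩
    · obtain ⟨x, hx, hmin⟩ := hK.exists_isMinOn hne' hζ.norm.continuousOn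
      refine ⟨‖ζ x‖, norm_pos_iff.2 (hne x hx.1 ?_), fun y hy => hmin hy⟩
      rintro rfl
      have := hx.2
      simp at this
      linarith
  -- The entries `c²/2` and `1` serve `|x| < δ`. The entry `η²/2` serves the rest, where `x² + ε² ≤
  -- 1/2` while `ε < η/2` leaves `‖ζ² - ε²‖ ≥ 3η²/4`.
  refine ⟨min (min (c ^ 2 / 2) 1) (η ^ 2 / 2), by positivity, min (η / 2) (1 / 2), by positivity,
    fun ε hε hε' x hx => ?_⟩
  by_cases hxδ : |x| < δ
  · have h1 := hnear (y := x) (by simpa using hxδ)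
    simp only [h0, sub_zero, Complex.real_smul, Real.norm_eq_abs] at h1
    have h2 : ‖ζ x + x * (c * Complex.I)‖ ≤ (2 * c + c / 8) * |x| := by
      have : ζ x + x * (c * Complex.I) = (ζ x - x * (c * Complex.I)) + 2 * (x * (c * Complex.I)) := by
        ring
      rw [this]
      refine (norm_add_le _ _).trans ?_
      simp only [norm_mul, Complex.norm_real, Complex.norm_I, Real.norm_eq_abs, abs_of_pos hc,
        RCLike.norm_ofNat]
      linarith
    have h3 : ‖(ζ x - x * (c * Complex.I)) * (ζ x + x * (c * Complex.I))‖ ≤ c ^ 2 / 2 * x ^ 2 := by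
      rw [norm_mul]
      refine (mul_le_mul h1 h2 (norm_nonneg _) (by positivity)).trans ?_
      rw [show c / 8 * |x| * ((2 * c + c / 8) * |x|) = (17 / 64 * c ^ 2) * |x| ^ 2 by ring, sq_abs]
      have := mul_nonneg (sq_nonneg c) (sq_nonneg x)
      nlinarith
    have h4 : ζ x ^ 2 - (ε : ℂ) ^ 2 = (ζ x - x * (c * Complex.I)) * (ζ x + x * (c * Complex.I)) -
        ((c ^ 2 * x ^ 2 + ε ^ 2 : ℝ) : ℂ) := by
      push_cast
      linear_combination (c : ℂ) ^ 2 * x ^ 2 * Complex.I_sq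
    have h5 : (c ^ 2 * x ^ 2 + ε ^ 2) - c ^ 2 / 2 * x ^ 2 ≤ ‖ζ x ^ 2 - (ε : ℂ) ^ 2‖ := by
      rw [h4, norm_sub_rev]
      refine le_trans ?_ (norm_sub_norm_le _ _)
      rw [Complex.norm_real, Real.norm_of_nonneg (by positivity)]
      linarith
    refine le_trans ?_ h5
    have ha : min (min (c ^ 2 / 2) 1) (η ^ 2 / 2) ≤ c ^ 2 / 2 :=
      (min_le_left _ _).trans (min_le_left _ _)
    have hb : min (min (c ^ 2 / 2) 1) (η ^ 2 / 2) ≤ 1 :=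
      (min_le_left _ _).trans (min_le_right _ _)
    nlinarith [mul_le_mul_of_nonneg_right ha (sq_nonneg x),
      mul_le_mul_of_nonneg_right hb (sq_nonneg ε)]
  · have h1 := hfar x ⟨hx, not_lt.1 hxδ⟩
    have h2 : ε < η / 2 := hε'.trans_le (min_le_left _ _)
    have h3 : ε < 1 / 2 := hε'.trans_le (min_le_right _ _)
    have h4 : η ^ 2 - ε ^ 2 ≤ ‖ζ x ^ 2 - (ε : ℂ) ^ 2‖ := by
      refine le_trans ?_ (norm_sub_norm_le _ _)
      rw [norm_pow, norm_pow, Complex.norm_real, Real.norm_of_nonneg hε.le]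
      have := pow_le_pow_left₀ hη.le h1 2
      linarith
    refine le_trans ?_ h4
    have hb : min (min (c ^ 2 / 2) 1) (η ^ 2 / 2) ≤ η ^ 2 / 2 := min_le_right _ _
    have hx2 : x ^ 2 ≤ 1 / 4 := by
      rw [← sq_abs]
      have : |x| ≤ 1 / 2 := abs_le.2 ⟨by linarith [hx.1], hx.2⟩
      nlinarith [abs_nonneg x]
    have hε2 : ε ^ 2 ≤ η ^ 2 / 4 := by nlinarith
    have hε3 : ε ^ 2 ≤ 1 / 4 := by nlinarith
    calc _ ≤ η ^ 2 / 2 * (x ^ 2 + ε ^ 2) := by gcongr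
      _ ≤ η ^ 2 / 2 * (1 / 4 + 1 / 4) := by gcongr
      _ ≤ _ := by nlinarith [sq_nonneg η]

lemma integral_two_mul_I_mul_inv_one_add_sq {c : ℝ} (hc : 0 < c) :
    ∫ s : ℝ, (2 * (c * Complex.I)) * ((1 + (c * s) ^ 2 : ℝ) : ℂ)⁻¹ = 2 * Real.pi * Complex.I := by
  rw [integral_const_mul]
  simp_rw [← Complex.ofReal_inv]
  rw [integral_complex_ofReal, Measure.integral_comp_mul_left (fun s => (1 + s ^ 2)⁻¹) c,
    integral_univ_inv_one_add_sq, abs_of_pos (inv_pos.2 hc)]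
  have : (c : ℂ) ≠ 0 := by exact_mod_cast hc.ne'
  simp only [smul_eq_mul, Complex.ofReal_mul, Complex.ofReal_inv]
  field_simp

/-- This is the jump of a Cauchy integral across its contour. Only the window `|x| ~ ε` contributes:
after `x = εs` the integrand tends to `2ci / (1 + c²s²)`, whose integral is `2πi`, and the quadratic
lower bound dominates it by a multiple of `(1 + s²)⁻¹`. -/
lemma tendsto_integral_jump {ζ : ℝ → ℂ} (hζ : ContDiff ℝ 1 ζ) (h0 : ζ 0 = 0) {c : ℝ}
    (hc : 0 < c) (hd : deriv ζ 0 = c * Complex.I)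
    (hne : ∀ x ∈ Icc (-1 / 2 : ℝ) (1 / 2), x ≠ 0 → ζ x ≠ 0) :
    Tendsto (fun ε : ℝ => ∫ x in (-1 / 2 : ℝ)..(1 / 2),
      deriv ζ x * ((ζ x + ε)⁻¹ - (ζ x - ε)⁻¹)) (𝓝[>] 0) (𝓝 (2 * Real.pi * Complex.I)) := by
  have hdiff : Differentiable ℝ ζ := hζ.differentiable (by norm_num)
  have hcd : Continuous (deriv ζ) := hζ.continuous_deriv le_rfl
  have hd0 : HasDerivAt ζ (c * Complex.I) 0 := hd ▸ (hdiff 0).hasDerivAt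
  obtain ⟨m, hm, ε₀, hε₀, hlow⟩ := exists_lower_bound_sq_sub_sq hζ.continuous h0 hc hd0 hne
  obtain ⟨M, hM⟩ := isCompact_Icc.exists_bound_of_continuousOn
    (s := Icc (-1 / 2 : ℝ) (1 / 2)) hcd.continuousOn
  have hM0 : 0 ≤ M := (norm_nonneg _).trans (hM 0 (by norm_num))
  set F : ℝ → ℝ → ℂ := fun ε => indicator (Ioc (-1 / 2 : ℝ) (1 / 2))
    (fun x => deriv ζ x * ((ζ x + ε)⁻¹ - (ζ x - ε)⁻¹)) with hF
  have hev : ∀ᶠ ε : ℝ in 𝓝[>] 0, 0 < ε ∧ ε < ε₀ :=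
    (eventually_mem_nhdsWithin).and ((eventually_lt_nhds hε₀).filter_mono nhdsWithin_le_nhds)
  have key : ∀ ε : ℝ, 0 < ε → ε < ε₀ → ∀ x ∈ Icc (-1 / 2 : ℝ) (1 / 2),
      (ζ x + ε)⁻¹ - (ζ x - ε)⁻¹ = -(2 * ε) / (ζ x ^ 2 - (ε : ℂ) ^ 2) := by
    intro ε hε hε' x hx
    have h1 : ζ x ^ 2 - (ε : ℂ) ^ 2 ≠ 0 := by
      rw [← norm_pos_iff]
      exact lt_of_lt_of_le (by positivity) (hlow ε hε hε' x hx)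
    have h2 : (ζ x + ε) * (ζ x - ε) = ζ x ^ 2 - (ε : ℂ) ^ 2 := by ring
    have h3 : ζ x + ε ≠ 0 := fun h => h1 (by rw [← h2, h, zero_mul])
    have h4 : ζ x - ε ≠ 0 := fun h => h1 (by rw [← h2, h, mul_zero])
    rw [← h2]
    field_simp
    ring
  -- Substitution `x = εs`; the indicator inside `F` makes the integral over the line equal to the
  -- one over the fixed period.
  have hscale : ∀ᶠ ε : ℝ in 𝓝[>] 0, ∫ s : ℝ, (ε : ℂ) * F ε (ε * s) =
      ∫ x in (-1 / 2 : ℝ)..(1 / 2), deriv ζ x * ((ζ x + ε)⁻¹ - (ζ x - ε)⁻¹) := by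
    filter_upwards [hev] with ε hε
    rw [integral_const_mul, Measure.integral_comp_mul_left (F ε) ε,
      intervalIntegral.integral_of_le (by norm_num), abs_of_pos (inv_pos.2 hε.1), hF,
      integral_indicator measurableSet_Ioc, Complex.real_smul, Complex.ofReal_inv,
      mul_inv_cancel_left₀ (by exact_mod_cast hε.1.ne')]
  refine Tendsto.congr' hscale ?_
  rw [← integral_two_mul_I_mul_inv_one_add_sq hc]
  refine tendsto_integral_filter_of_dominated_convergence
    (fun s => 2 * M / m * (1 + s ^ 2)⁻¹) ?_ ?_ ?_ ?_
  · refine Eventually.of_forall fun ε => ?_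
    have : Measurable (F ε) := by
      refine Measurable.indicator ?_ measurableSet_Ioc
      have := hζ.continuous.measurable
      have := hcd.measurable
      fun_prop
    exact ((this.comp (measurable_const_mul ε)).const_mul _).aestronglyMeasurable
  · filter_upwards [hev] with ε hε
    refine Eventually.of_forall fun s => ?_
    by_cases hs : ε * s ∈ Ioc (-1 / 2 : ℝ) (1 / 2)
    · have hs' := Ioc_subset_Icc_self hs
      have hl := hlow ε hε.1 hε.2 _ hs'
      rw [hF]
      simp only [indicator_of_mem hs]
      rw [key ε hε.1 hε.2 _ hs', norm_mul, norm_mul, norm_div, norm_neg, norm_mul,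
        Complex.norm_real, Real.norm_of_nonneg hε.1.le, RCLike.norm_ofNat]
      have h1 : 2 * ε / ‖ζ (ε * s) ^ 2 - (ε : ℂ) ^ 2‖ ≤ 2 * ε / (m * ((ε * s) ^ 2 + ε ^ 2)) := by
        have := hε.1
        gcongr
      calc ε * (‖deriv ζ (ε * s)‖ * (2 * ε / ‖ζ (ε * s) ^ 2 - (ε : ℂ) ^ 2‖))
          ≤ ε * (M * (2 * ε / (m * ((ε * s) ^ 2 + ε ^ 2)))) := by
            have := hM _ hs'
            have := hε.1.le
            gcongr
        _ = 2 * M / m * (1 + s ^ 2)⁻¹ := by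
            have := hε.1.ne'
            field_simp
            ring
    · rw [hF]
      simp only [indicator_of_notMem hs, mul_zero, norm_zero]
      positivity
  · exact integrable_inv_one_add_sq.const_mul _
  · refine Eventually.of_forall fun s => ?_
    have hlim1 : Tendsto (fun ε : ℝ => ε * s) (𝓝[>] 0) (𝓝 0) := by
      have : Tendsto (fun ε : ℝ => ε * s) (𝓝 0) (𝓝 (0 * s)) := tendsto_id.mul_const s
      rw [zero_mul] at this
      exact this.mono_left nhdsWithin_le_nhds
    have hin : ∀ᶠ ε : ℝ in 𝓝[>] 0, ε * s ∈ Ioc (-1 / 2 : ℝ) (1 / 2) :=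
      hlim1.eventually (Ioc_mem_nhds (by norm_num) (by norm_num))
    have hslope : Tendsto (fun ε : ℝ => ζ (ε * s) / ε) (𝓝[>] 0) (𝓝 (s * (c * Complex.I))) := by
      have h1 : HasDerivAt (fun ε : ℝ => ζ (ε * s)) (s • (c * Complex.I)) 0 := by
        have h2 : HasDerivAt (fun ε : ℝ => ε * s) s 0 := by
          simpa using (hasDerivAt_id (0 : ℝ)).mul_const s
        exact HasDerivAt.scomp (𝕜 := ℝ) 0 (by simpa using hd0) h2
      have h3 := h1.tendsto_slope_zero_right
      simp only [zero_add, zero_mul, h0, sub_zero, Complex.real_smul] at h3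
      refine h3.congr fun ε => ?_
      rw [div_eq_inv_mul, Complex.ofReal_inv]
    have hden : ((s : ℂ) * (c * Complex.I)) ^ 2 - 1 ≠ 0 := by
      have : ((s : ℂ) * (c * Complex.I)) ^ 2 - 1 = -((1 + (c * s) ^ 2 : ℝ) : ℂ) := by
        push_cast
        linear_combination (c : ℂ) ^ 2 * s ^ 2 * Complex.I_sq
      rw [this, neg_ne_zero]
      exact_mod_cast (by positivity : (1 + (c * s) ^ 2 : ℝ) ≠ 0)
    have hder : Tendsto (fun ε : ℝ => deriv ζ (ε * s)) (𝓝[>] 0) (𝓝 (c * Complex.I)) := by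
      rw [← hd]
      exact (hcd.tendsto 0).comp hlim1
    have hlim := (hder.mul_const (-2)).div ((hslope.pow 2).sub_const 1) hden
    have hval : (c * Complex.I) * (-2) / (((s : ℂ) * (c * Complex.I)) ^ 2 - 1) =
        (2 * (c * Complex.I)) * ((1 + (c * s) ^ 2 : ℝ) : ℂ)⁻¹ := by
      have : ((s : ℂ) * (c * Complex.I)) ^ 2 - 1 = -((1 + (c * s) ^ 2 : ℝ) : ℂ) := by
        push_cast
        linear_combination (c : ℂ) ^ 2 * s ^ 2 * Complex.I_sq
      rw [this, div_neg, div_eq_mul_inv]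
      ring
    rw [hval] at hlim
    refine hlim.congr' ?_
    filter_upwards [hev, hin] with ε hε hin
    rw [hF]
    simp only [indicator_of_mem hin]
    rw [key ε hε.1 hε.2 _ (Ioc_subset_Icc_self hin)]
    have he : (ε : ℂ) ≠ 0 := by exact_mod_cast hε.1.ne'
    have h2 : (ζ (ε * s) / ε) ^ 2 - 1 = (ζ (ε * s) ^ 2 - (ε : ℂ) ^ 2) / (ε : ℂ) ^ 2 := by
      field_simp
    rw [Pi.div_apply, h2]
    simp only [div_eq_mul_inv, mul_inv, inv_inv]
    ring

namespace SmoothJordanDomain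

variable (D : SmoothJordanDomain)

lemma continuous_deriv_γ : Continuous (deriv D.γ) :=
  D.smooth.continuous_deriv (by exact_mod_cast le_top)

lemma hasDerivAt_γ (x : ℝ) : HasDerivAt D.γ (deriv D.γ x) x :=
  (D.smooth.differentiable (by simp) x).hasDerivAt

lemma periodic_deriv_γ : Function.Periodic (deriv D.γ) 1 := fun x => by
  rw [← deriv_comp_add_const]
  congr 1
  exact funext D.periodic

/-- The integral `∫_{∂Ω} dz / (z - w)`. -/
def windingIntegral (w : ℂ) : ℂ := ∫ x in (0 : ℝ)..1, deriv D.γ x * (D.γ x - w)⁻¹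

lemma isCompact_range_γ : IsCompact (range D.γ) := by
  rw [D.range_eq]
  exact Metric.isCompact_of_isClosed_isBounded isClosed_frontier
    (D.isBounded.closure.subset frontier_subset_closure)

/-- Differentiating in `w` produces `γ' / (γ - w)²`, the derivative of the periodic function `-(γ -
w)⁻¹`, whose integral over a period vanishes. -/
lemma hasDerivAt_windingIntegral {w : ℂ} (hw : w ∉ range D.γ) :
    HasDerivAt D.windingIntegral 0 w := by
  have hopen : IsOpen (range D.γ)ᶜ := D.isCompact_range_γ.isClosed.isOpen_compl
  obtain ⟨δ, hδ, hball⟩ := Metric.isOpen_iff.1 hopen w hw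
  have hsep : ∀ x, ∀ v ∈ Metric.ball w (δ / 2), δ / 2 ≤ ‖D.γ x - v‖ := by
    intro x v hv
    by_contra! h
    refine hball (show D.γ x ∈ Metric.ball w δ from ?_) (mem_range_self x)
    rw [Metric.mem_ball] at hv ⊢
    calc dist (D.γ x) w ≤ dist (D.γ x) v + dist v w := dist_triangle _ _ _
      _ < δ / 2 + δ / 2 := add_lt_add (by rwa [dist_eq_norm]) hv
      _ = δ := add_halves δ
  have hne : ∀ x, ∀ v ∈ Metric.ball w (δ / 2), D.γ x - v ≠ 0 := fun x v hv =>
    norm_pos_iff.1 ((half_pos hδ).trans_le (hsep x v hv))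
  have hw' : w ∈ Metric.ball w (δ / 2) := Metric.mem_ball_self (half_pos hδ)
  have hcont : ∀ v ∈ Metric.ball w (δ / 2), Continuous fun x => deriv D.γ x * (D.γ x - v)⁻¹ :=
    fun v hv => D.continuous_deriv_γ.mul
      ((D.smooth.continuous.sub continuous_const).inv₀ fun x => hne x v hv)
  have hcont' : Continuous fun x => deriv D.γ x * ((D.γ x - w) ^ 2)⁻¹ :=
    D.continuous_deriv_γ.mul (((D.smooth.continuous.sub continuous_const).pow 2).inv₀
      fun x => pow_ne_zero 2 (hne x w hw'))
  have hzero : ∫ x in (0 : ℝ)..1, deriv D.γ x * ((D.γ x - w) ^ 2)⁻¹ = 0 := by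
    have hprim : ∀ x ∈ uIcc (0 : ℝ) 1, HasDerivAt (fun x => -(D.γ x - w)⁻¹)
        (deriv D.γ x * ((D.γ x - w) ^ 2)⁻¹) x := by
      intro x _
      have := (((D.hasDerivAt_γ x).sub_const w).fun_inv (hne x w hw')).neg
      convert! this using 1
      rw [neg_div, neg_neg, div_eq_mul_inv]
    rw [intervalIntegral.integral_eq_sub_of_hasDerivAt hprim (hcont'.intervalIntegrable _ _)]
    have := D.periodic 0
    rw [zero_add] at this
    simp [this]
  have := (intervalIntegral.hasDerivAt_integral_of_dominated_loc_of_deriv_le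
    (F := fun v x => deriv D.γ x * (D.γ x - v)⁻¹)
    (F' := fun v x => deriv D.γ x * ((D.γ x - v) ^ 2)⁻¹) (a := 0) (b := 1) (x₀ := w)
    (bound := fun x => ‖deriv D.γ x‖ * ((δ / 2) ^ 2)⁻¹) (μ := volume)
    (Metric.ball_mem_nhds w (half_pos hδ)) ?_ ((hcont w hw').intervalIntegrable _ _)
    hcont'.aestronglyMeasurable ?_
    ((D.continuous_deriv_γ.norm.mul continuous_const).intervalIntegrable _ _) ?_).2
  · rwa [hzero] at this
  · filter_upwards [Metric.ball_mem_nhds w (half_pos hδ)] with v hv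
    exact (hcont v hv).aestronglyMeasurable
  · refine Eventually.of_forall fun x _ v hv => ?_
    rw [norm_mul, norm_inv, norm_pow]
    have := hsep x v hv
    gcongr
  · refine Eventually.of_forall fun x _ v hv => ?_
    have := (((hasDerivAt_id v).const_sub (D.γ x)).fun_inv (hne x v hv)).const_mul (deriv D.γ x)
    convert! this using 1
    simp [div_eq_mul_inv]

lemma carrier_disjoint_range {w : ℂ} (hw : w ∈ D.carrier) : w ∉ range D.γ := by
  rw [D.range_eq, D.isOpen.frontier_eq]
  exact fun h => h.2 hw

lemma windingIntegral_eq_of_mem {v w : ℂ} (hv : v ∈ D.carrier) (hw : w ∈ D.carrier) :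
    D.windingIntegral v = D.windingIntegral w :=
  D.isOpen.is_const_of_deriv_eq_zero D.isConnected.isPreconnected
    (fun _ hu => (D.hasDerivAt_windingIntegral
      (D.carrier_disjoint_range hu)).differentiableAt.differentiableWithinAt)
    (fun _ hu => (D.hasDerivAt_windingIntegral (D.carrier_disjoint_range hu)).deriv) hv hw

/-- Seen from a point to the right of the whole curve, `w - γ` stays in the right half plane, so the
principal logarithm is a periodic primitive. -/
lemma windingIntegral_eq_zero {w : ℂ} (hw : ∀ x, (D.γ x).re < w.re) : D.windingIntegral w = 0 := by
  have hslit : ∀ x, w - D.γ x ∈ Complex.slitPlane := fun x =>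
    Or.inl (by simpa using hw x)
  have hne : ∀ x, D.γ x - w ≠ 0 := fun x h => by
    have := hw x
    rw [sub_eq_zero.1 h] at this
    exact lt_irrefl _ this
  have hprim : ∀ x ∈ uIcc (0 : ℝ) 1, HasDerivAt (fun x => Complex.log (w - D.γ x))
      (deriv D.γ x * (D.γ x - w)⁻¹) x := by
    intro x _
    convert! ((D.hasDerivAt_γ x).const_sub w).clog_real (hslit x) using 1
    rw [← neg_sub w, inv_neg, mul_neg, div_eq_mul_inv, neg_mul]
  have hcont : Continuous fun x => deriv D.γ x * (D.γ x - w)⁻¹ :=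
    D.continuous_deriv_γ.mul ((D.smooth.continuous.sub continuous_const).inv₀ hne)
  rw [windingIntegral, intervalIntegral.integral_eq_sub_of_hasDerivAt hprim
    (hcont.intervalIntegrable _ _)]
  have := D.periodic 0
  rw [zero_add] at this
  simp [this]

/-- The maximum of `Re` over the compact closure cannot be attained in the open domain, where there
is room to move right. -/
lemma re_le_of_mem {x₀ : ℝ} (hmax : ∀ x, (D.γ x).re ≤ (D.γ x₀).re) {z : ℂ} (hz : z ∈ D.carrier) :
    z.re ≤ (D.γ x₀).re := by
  by_contra! hlt
  have hcomp : IsCompact (closure D.carrier) := D.isBounded.isCompact_closure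
  obtain ⟨z₁, hz₁, hm⟩ := hcomp.exists_isMaxOn ⟨z, subset_closure hz⟩
    Complex.continuous_re.continuousOn
  have h1 : z.re ≤ z₁.re := hm (subset_closure hz)
  have h2 : z₁ ∈ D.carrier := by
    by_contra hn
    have : z₁ ∈ range D.γ := by
      rw [D.range_eq, D.isOpen.frontier_eq]
      exact ⟨hz₁, hn⟩
    obtain ⟨x, rfl⟩ := this
    linarith [hmax x]
  obtain ⟨δ, hδ, hball⟩ := Metric.isOpen_iff.1 D.isOpen z₁ h2
  have h3 : z₁ + ((δ / 2 : ℝ) : ℂ) ∈ D.carrier := by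
    refine hball ?_
    rw [Metric.mem_ball, dist_eq_norm, add_sub_cancel_left, Complex.norm_real,
      Real.norm_of_nonneg (by positivity)]
    linarith
  have h4 : (z₁ + ((δ / 2 : ℝ) : ℂ)).re ≤ z₁.re := hm (subset_closure h3)
  rw [Complex.add_re, Complex.ofReal_re] at h4
  linarith

lemma γ_injective_near {x₀ x : ℝ} (hx : x ∈ Icc (-1 / 2 : ℝ) (1 / 2)) (hx0 : x ≠ 0) :
    D.γ (x₀ + x) ≠ D.γ x₀ := by
  intro h
  have hfr : ∀ y, D.γ (Int.fract y) = D.γ y := fun y => by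
    have := D.periodic.sub_int_mul_eq (x := y) ⌊y⌋
    rwa [mul_one, ← Int.fract] at this
  have h1 := D.injOn ⟨Int.fract_nonneg _, Int.fract_lt_one _⟩
    ⟨Int.fract_nonneg _, Int.fract_lt_one _⟩ ((hfr (x₀ + x)).trans (h.trans (hfr x₀).symm))
  obtain ⟨n, hn⟩ := Int.fract_eq_fract.1 h1
  rw [add_sub_cancel_left] at hn
  have h2 : |(n : ℝ)| < 1 := by
    rw [← hn]
    exact (abs_le.2 ⟨by linarith [hx.1], hx.2⟩ : |x| ≤ 1 / 2).trans_lt (by norm_num)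
  have h3 : n = 0 := by
    rw [← Int.abs_lt_one_iff]
    exact_mod_cast h2
  exact hx0 (by rw [hn, h3, Int.cast_zero])

/-- The boundary of a smooth Jordan domain winds once around each point of the domain. -/
theorem windingIntegral_eq {w : ℂ} (hw : w ∈ D.carrier) :
    D.windingIntegral w = 2 * Real.pi * Complex.I := by
  -- At a rightmost boundary point the tangent is vertical. Points just to its left turn out to be
  -- in the domain, and points just to its right have winding integral zero. The jump between the
  -- two sides is therefore the winding integral of the domain, and the Jordan curve theorem is not
  -- needed.
  obtain ⟨_, ⟨x₀, rfl⟩, hm⟩ := D.isCompact_range_γ.exists_isMaxOn (range_nonempty _)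
    Complex.continuous_re.continuousOn
  have hmax : ∀ x, (D.γ x).re ≤ (D.γ x₀).re := fun x => hm (mem_range_self x)
  have hre : (deriv D.γ x₀).re = 0 := by
    have h1 : HasDerivAt (fun x => (D.γ x).re) (deriv D.γ x₀).re x₀ :=
      (Complex.reCLM.hasFDerivAt.comp_hasDerivAt x₀ (D.hasDerivAt_γ x₀))
    exact (IsLocalMax.hasDerivAt_eq_zero (Eventually.of_forall hmax) h1)
  set c : ℝ := (deriv D.γ x₀).im with hc
  have hder : deriv D.γ x₀ = c * Complex.I := by
    rw [← Complex.re_add_im (deriv D.γ x₀), hre, hc]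
    simp
  have hleft : ∀ᶠ r : ℝ in 𝓝[>] 0, D.γ x₀ - ((r * c : ℝ) : ℂ) ∈ D.carrier := by
    filter_upwards [D.left_mem x₀] with r hr
    convert hr using 1
    rw [hder]
    push_cast
    linear_combination (-(r : ℂ) * c) * Complex.I_sq
  -- If the tangent pointed down, the left-hand side of the curve would be to the right of its
  -- rightmost point, and `left_mem` would put points of the domain there.
  have hc0 : 0 < c := by
    by_contra! hle
    have hlt : c < 0 := lt_of_le_of_ne hle fun h =>
      D.deriv_ne_zero x₀ (by rw [hder, h]; simp)
    obtain ⟨r, hr, hr0⟩ := (hleft.and eventually_mem_nhdsWithin).exists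
    have h1 := D.re_le_of_mem hmax hr
    rw [Complex.sub_re, Complex.ofReal_re] at h1
    have : r * c < 0 := mul_neg_of_pos_of_neg hr0 hlt
    linarith
  have hin : ∀ᶠ ε : ℝ in 𝓝[>] 0, D.γ x₀ - (ε : ℂ) ∈ D.carrier := by
    have ht : Tendsto (fun ε : ℝ => ε / c) (𝓝[>] 0) (𝓝[>] 0) := by
      refine tendsto_nhdsWithin_iff.2 ⟨?_, ?_⟩
      · have : Tendsto (fun ε : ℝ => ε / c) (𝓝 0) (𝓝 (0 / c)) := tendsto_id.div_const c
        rw [zero_div] at this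
        exact this.mono_left nhdsWithin_le_nhds
      · filter_upwards [eventually_mem_nhdsWithin] with ε hε
        exact div_pos hε hc0
    filter_upwards [ht.eventually hleft] with ε hε
    rwa [div_mul_cancel₀ _ hc0.ne'] at hε
  set ζ : ℝ → ℂ := fun x => D.γ (x₀ + x) - D.γ x₀ with hζ
  have hζd : ∀ x, deriv ζ x = deriv D.γ (x₀ + x) := fun x => by
    rw [hζ, deriv_sub_const, deriv_comp_const_add]
  have hjump := tendsto_integral_jump (ζ := ζ) (c := c)
    (((D.smooth.comp (contDiff_const.add contDiff_id)).sub contDiff_const).of_le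
      (by exact_mod_cast le_top)) (by simp [hζ]) hc0 (by rw [hζd, add_zero, hder])
    (fun x hx hx0 => sub_ne_zero.2 (D.γ_injective_near hx hx0))
  -- The integral over the period centred at `x₀` is the winding integral at `γ x₀ - ε` minus the
  -- one at `γ x₀ + ε`. The second vanishes and the first does not depend on `ε`.
  have hconst : ∀ᶠ ε : ℝ in 𝓝[>] 0, ∫ x in (-1 / 2 : ℝ)..(1 / 2),
      deriv ζ x * ((ζ x + ε)⁻¹ - (ζ x - ε)⁻¹) = D.windingIntegral w := by
    filter_upwards [hin, eventually_mem_nhdsWithin] with ε hε hε0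
    have hright : ∀ x, (D.γ x).re < (D.γ x₀ + (ε : ℂ)).re := fun x => by
      rw [Complex.add_re, Complex.ofReal_re]
      exact lt_of_le_of_lt (hmax x) (lt_add_of_pos_right _ hε0)
    have hshift : ∀ v : ℂ, ∫ x in (-1 / 2 : ℝ)..(1 / 2), deriv ζ x * (D.γ (x₀ + x) - v)⁻¹ =
        D.windingIntegral v := fun v => by
      simp_rw [hζd]
      rw [intervalIntegral.integral_comp_add_left
        (fun x => deriv D.γ x * (D.γ x - v)⁻¹) x₀]
      have hper : Function.Periodic (fun x => deriv D.γ x * (D.γ x - v)⁻¹) 1 := fun x => by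
        simp only [D.periodic x, D.periodic_deriv_γ x]
      have := hper.intervalIntegral_add_eq (x₀ + -1 / 2) 0
      rw [zero_add, show x₀ + -1 / 2 + 1 = x₀ + 1 / 2 by ring] at this
      exact this
    have hcont : ∀ v : ℂ, v ∉ range D.γ →
        Continuous fun x => deriv ζ x * (D.γ (x₀ + x) - v)⁻¹ := fun v hv => by
      simp_rw [hζd]
      have h1 := D.continuous_deriv_γ
      have h2 := D.smooth.continuous
      refine Continuous.mul (by fun_prop) (Continuous.inv₀ (by fun_prop) fun x h => ?_)
      exact hv ⟨x₀ + x, sub_eq_zero.1 h⟩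
    have hsplit : ∀ x, deriv ζ x * ((ζ x + ε)⁻¹ - (ζ x - ε)⁻¹) =
        deriv ζ x * (D.γ (x₀ + x) - (D.γ x₀ - (ε : ℂ)))⁻¹ -
          deriv ζ x * (D.γ (x₀ + x) - (D.γ x₀ + (ε : ℂ)))⁻¹ := fun x => by
      rw [mul_sub]
      congr 3 <;> simp only [hζ] <;> ring
    simp_rw [hsplit]
    rw [intervalIntegral.integral_sub
      ((hcont _ (D.carrier_disjoint_range hε)).intervalIntegrable _ _)
      ((hcont _ ?_).intervalIntegrable _ _), hshift, hshift, D.windingIntegral_eq_zero hright,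
      sub_zero, D.windingIntegral_eq_of_mem hε hw]
    rintro ⟨x, hx⟩
    have := hright x
    rw [hx] at this
    exact lt_irrefl _ this
  exact tendsto_nhds_unique (tendsto_const_nhds.congr' (hconst.mono fun _ h => h.symm)) hjump

end SmoothJordanDomain
end

noncomputable section

/-! ### Test functions on the plane -/

/-- `φ` is smooth with compact support. -/
def IsTest (φ : ℂ → ℂ) : Prop := ContDiff ℝ (⊤ : ℕ∞) φ ∧ HasCompactSupport φ

namespace IsTest

variable {φ ψ : ℂ → ℂ}

lemma continuous (hφ : IsTest φ) : Continuous φ := hφ.1.continuous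

lemma differentiable (hφ : IsTest φ) : Differentiable ℝ φ := hφ.1.differentiable (by simp)

lemma integrable (hφ : IsTest φ) : Integrable φ :=
  hφ.continuous.integrable_of_hasCompactSupport hφ.2

lemma fderiv_apply (hφ : IsTest φ) (v : ℂ) : IsTest fun z => fderiv ℝ φ z v :=
  ⟨(hφ.1.fderiv_right (m := (⊤ : ℕ∞)) (by exact_mod_cast le_top)).clm_apply contDiff_const,
    hφ.2.fderiv_apply ℝ v⟩

lemma add (hφ : IsTest φ) (hψ : IsTest ψ) : IsTest fun z => φ z + ψ z :=
  ⟨hφ.1.add hψ.1, hφ.2.add hψ.2⟩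

lemma mul_left {g : ℂ → ℂ} (hg : ContDiff ℝ (⊤ : ℕ∞) g) (hφ : IsTest φ) :
    IsTest fun z => g z * φ z :=
  ⟨hg.mul hφ.1, hφ.2.mul_left⟩

lemma const_mul (hφ : IsTest φ) (c : ℂ) : IsTest fun z => c * φ z := mul_left contDiff_const hφ

lemma sub (hφ : IsTest φ) (hψ : IsTest ψ) : IsTest fun z => φ z - ψ z := by
  convert hφ.add (hψ.const_mul (-1)) using 2
  ring

lemma dz (hφ : IsTest φ) : IsTest (dz φ) :=
  ((hφ.fderiv_apply 1).sub ((hφ.fderiv_apply Complex.I).const_mul Complex.I)).const_mul _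

lemma dzbar (hφ : IsTest φ) : IsTest (dzbar φ) :=
  ((hφ.fderiv_apply 1).add ((hφ.fderiv_apply Complex.I).const_mul Complex.I)).const_mul _

lemma integral_fderiv_apply (hφ : IsTest φ) (v : ℂ) : ∫ z, fderiv ℝ φ z v = 0 := by
  have := integral_mul_fderiv_eq_neg_fderiv_mul_of_integrable (μ := volume) (𝕜 := ℂ)
    (f := fun _ : ℂ => (1 : ℂ)) (g := φ) (v := v)
    (by simp) (by simpa using (hφ.fderiv_apply v).integrable) (by simpa using hφ.integrable)
    (fun _ _ => differentiableAt_const _) (fun x _ => hφ.differentiable x)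
  simpa using this

lemma integral_dz (hφ : IsTest φ) : ∫ z, _root_.dz φ z = 0 := by
  simp only [_root_.dz]
  rw [integral_const_mul, integral_sub (hφ.fderiv_apply 1).integrable
    ((hφ.fderiv_apply Complex.I).const_mul _).integrable, integral_const_mul,
    hφ.integral_fderiv_apply, hφ.integral_fderiv_apply]
  simp

lemma integral_dzbar (hφ : IsTest φ) : ∫ z, _root_.dzbar φ z = 0 := by
  simp only [_root_.dzbar]
  rw [integral_const_mul, integral_add (hφ.fderiv_apply 1).integrable
    ((hφ.fderiv_apply Complex.I).const_mul _).integrable, integral_const_mul,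
    hφ.integral_fderiv_apply, hφ.integral_fderiv_apply]
  simp

lemma exists_support_subset_closedBall (hφ : IsTest φ) :
    ∃ R > 0, ∀ z, R < ‖z‖ → φ z = 0 := by
  obtain ⟨R, hR, h⟩ := hφ.2.isCompact.isBounded.subset_closedBall_lt 0 0
  refine ⟨R, hR, fun z hz => image_eq_zero_of_notMem_tsupport fun hmem => ?_⟩
  have := h hmem
  rw [mem_closedBall_zero_iff] at this
  exact absurd hz (not_lt.2 this)

end IsTest

/-! ### The Cauchy transform -/

/-- The fundamental solution `1 / (π w)` of `∂̄`. -/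
def cauchyKernel (w : ℂ) : ℂ := (Real.pi * w)⁻¹

/-- The solid Cauchy transform `π⁻¹ ∫ h(w) / (z - w) dw`. -/
def cauchyTransform (h : ℂ → ℂ) (z : ℂ) : ℂ := ∫ w, h w * cauchyKernel (z - w)

lemma norm_cauchyKernel (w : ℂ) : ‖cauchyKernel w‖ = (Real.pi * ‖w‖)⁻¹ := by
  rw [cauchyKernel, norm_inv, norm_mul, Complex.norm_real, Real.norm_of_nonneg Real.pi_pos.le]

lemma cauchyKernel_neg (w : ℂ) : cauchyKernel (-w) = -cauchyKernel w := by
  simp [cauchyKernel]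

@[fun_prop]
lemma measurable_cauchyKernel : Measurable cauchyKernel := by
  unfold cauchyKernel
  fun_prop

lemma locallyIntegrable_cauchyKernel : LocallyIntegrable cauchyKernel := by
  refine locallyIntegrable_of_norm_le_rpow (C := Real.pi⁻¹) (α := 1) ?_ ?_
    ?_ measurable_cauchyKernel.aestronglyMeasurable
  · simp [Complex.finrank_real_complex]
  · simp [Complex.finrank_real_complex]
  · refine Eventually.of_forall fun w => ?_
    rw [norm_cauchyKernel, mul_inv, Real.rpow_neg_one]

lemma cauchyTransform_eq_convolution (h : ℂ → ℂ) :
    cauchyTransform h = convolution h cauchyKernel (ContinuousLinearMap.mul ℝ ℂ) volume := rfl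

lemma cauchyTransform_congr_ae {h₁ h₂ : ℂ → ℂ} (h : h₁ =ᵐ[volume] h₂) :
    cauchyTransform h₁ = cauchyTransform h₂ := by
  ext z
  refine integral_congr_ae ?_
  filter_upwards [h] with w hw
  rw [hw]

lemma cauchyTransform_const_mul (c : ℂ) (h : ℂ → ℂ) (z : ℂ) :
    cauchyTransform (fun w => c * h w) z = c * cauchyTransform h z := by
  simp only [cauchyTransform, mul_assoc]
  rw [integral_const_mul]

namespace IsTest

variable {φ ψ : ℂ → ℂ}

lemma integrable_mul_cauchyKernel (hφ : IsTest φ) (z : ℂ) :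
    Integrable fun w => φ w * cauchyKernel (z - w) :=
  (hφ.2.convolutionExists_left (ContinuousLinearMap.mul ℝ ℂ) hφ.continuous
    locallyIntegrable_cauchyKernel) z

lemma contDiff_cauchyTransform (hφ : IsTest φ) : ContDiff ℝ (⊤ : ℕ∞) (cauchyTransform φ) :=
  hφ.2.contDiff_convolution_left (ContinuousLinearMap.mul ℝ ℂ) hφ.1 locallyIntegrable_cauchyKernel

lemma cauchyTransform_add (hφ : IsTest φ) (hψ : IsTest ψ) (z : ℂ) :
    cauchyTransform (fun w => φ w + ψ w) z = cauchyTransform φ z + cauchyTransform ψ z := by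
  simp only [cauchyTransform, add_mul]
  exact integral_add (hφ.integrable_mul_cauchyKernel z) (hψ.integrable_mul_cauchyKernel z)

lemma cauchyTransform_sub (hφ : IsTest φ) (hψ : IsTest ψ) (z : ℂ) :
    cauchyTransform (fun w => φ w - ψ w) z = cauchyTransform φ z - cauchyTransform ψ z := by
  simp only [cauchyTransform, sub_mul]
  exact integral_sub (hφ.integrable_mul_cauchyKernel z) (hψ.integrable_mul_cauchyKernel z)

/-- The Cauchy transform is a convolution with a locally integrable kernel, so derivatives can be
put on the test function. -/
lemma fderiv_cauchyTransform (hφ : IsTest φ) (z v : ℂ) :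
    fderiv ℝ (cauchyTransform φ) z v = cauchyTransform (fun w => fderiv ℝ φ w v) z := by
  have h1 := hφ.2.hasFDerivAt_convolution_left (ContinuousLinearMap.mul ℝ ℂ)
    (hφ.1.of_le (by exact_mod_cast le_top)) locallyIntegrable_cauchyKernel z
  have h2 := (hφ.2.fderiv ℝ).convolutionExists_left
    ((ContinuousLinearMap.mul ℝ ℂ).precompL ℂ) (hφ.1.continuous_fderiv (by simp))
    locallyIntegrable_cauchyKernel z
  rw [cauchyTransform_eq_convolution, h1.fderiv, convolution_def,
    ContinuousLinearMap.integral_apply h2]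
  rfl

lemma dz_cauchyTransform (hφ : IsTest φ) :
    _root_.dz (cauchyTransform φ) = cauchyTransform (_root_.dz φ) := by
  ext z
  unfold _root_.dz
  rw [cauchyTransform_const_mul, cauchyTransform_sub (hφ.fderiv_apply 1)
    ((hφ.fderiv_apply Complex.I).const_mul Complex.I), cauchyTransform_const_mul,
    hφ.fderiv_cauchyTransform, hφ.fderiv_cauchyTransform]

lemma dzbar_cauchyTransform (hφ : IsTest φ) :
    _root_.dzbar (cauchyTransform φ) = cauchyTransform (_root_.dzbar φ) := by
  ext z
  unfold _root_.dzbar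
  rw [cauchyTransform_const_mul, cauchyTransform_add (hφ.fderiv_apply 1)
    ((hφ.fderiv_apply Complex.I).const_mul Complex.I), cauchyTransform_const_mul,
    hφ.fderiv_cauchyTransform, hφ.fderiv_cauchyTransform]

lemma integrableOn_polar (hφ : IsTest φ) (z : ℂ) {g : ℝ → ℂ} (hg : Continuous g) :
    IntegrableOn (fun p : ℝ × ℝ =>
      fderiv ℝ φ (z + p.1 * Complex.exp (p.2 * Complex.I)) (g p.2))
      (Ioi 0 ×ˢ Ioo (-Real.pi) Real.pi) := by
  obtain ⟨R, hR, hsupp⟩ : ∃ R > 0, ∀ w, R < ‖w‖ → fderiv ℝ φ w = 0 := by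
    obtain ⟨R, hR, h⟩ := (hφ.2.fderiv ℝ).isCompact.isBounded.subset_closedBall_lt 0 0
    refine ⟨R, hR, fun w hw => image_eq_zero_of_notMem_tsupport fun hmem => ?_⟩
    have := h hmem
    rw [mem_closedBall_zero_iff] at this
    exact absurd hw (not_lt.2 this)
  have hcont : Continuous fun p : ℝ × ℝ =>
      fderiv ℝ φ (z + p.1 * Complex.exp (p.2 * Complex.I)) (g p.2) := by
    have h1 : Continuous (fderiv ℝ φ) := hφ.1.continuous_fderiv (by simp)
    fun_prop
  have h1 : IntegrableOn (fun p : ℝ × ℝ =>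
      fderiv ℝ φ (z + p.1 * Complex.exp (p.2 * Complex.I)) (g p.2))
      (Icc 0 (R + ‖z‖) ×ˢ Icc (-Real.pi) Real.pi) :=
    hcont.continuousOn.integrableOn_compact (isCompact_Icc.prod isCompact_Icc)
  refine h1.of_forall_sdiff_eq_zero (measurableSet_Ioi.prod measurableSet_Ioo) ?_
  rintro ⟨r, θ⟩ ⟨⟨hr, hθ⟩, hn⟩
  have hr' : R + ‖z‖ < r := by
    by_contra! h
    exact hn ⟨⟨le_of_lt hr, h⟩, Ioo_subset_Icc_self hθ⟩
  have h2 : R < ‖z + r * Complex.exp (θ * Complex.I)‖ := by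
    have h3 : ‖(r : ℂ) * Complex.exp (θ * Complex.I)‖ = r := by
      rw [norm_mul, Complex.norm_exp_ofReal_mul_I, mul_one, Complex.norm_real,
        Real.norm_of_nonneg (le_of_lt hr)]
    have h4 := norm_sub_norm_le ((r : ℂ) * Complex.exp (θ * Complex.I)) (-z)
    rw [sub_neg_eq_add, norm_neg, h3, add_comm _ z] at h4
    linarith
  simp [hsupp _ h2]

/-- On each ray the integrand is `d/dr φ(z + re^{iθ})`, which integrates to `-φ z`; the angles
contribute `2π`. -/
lemma integral_radial (hφ : IsTest φ) (z : ℂ) :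
    ∫ p in Ioi (0 : ℝ) ×ˢ Ioo (-Real.pi) Real.pi,
      fderiv ℝ φ (z + p.1 * Complex.exp (p.2 * Complex.I)) (Complex.exp (p.2 * Complex.I)) =
      -(2 * Real.pi * φ z) := by
  have hint := hφ.integrableOn_polar z
    (g := fun θ => Complex.exp (θ * Complex.I)) (by fun_prop)
  rw [Measure.volume_eq_prod] at hint ⊢
  rw [IntegrableOn, ← Measure.prod_restrict] at hint
  rw [← Measure.prod_restrict, integral_prod_symm _ hint]
  have hinner : ∀ θ : ℝ, ∫ r in Ioi (0 : ℝ), fderiv ℝ φ (z + r * Complex.exp (θ * Complex.I))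
      (Complex.exp (θ * Complex.I)) = -φ z := by
    intro θ
    set f : ℝ → ℂ := fun r => φ (z + r * Complex.exp (θ * Complex.I)) with hf
    have hder : ∀ r : ℝ, HasDerivAt f (fderiv ℝ φ (z + r * Complex.exp (θ * Complex.I))
      (Complex.exp (θ * Complex.I))) r := by
      intro r
      have h1 : HasDerivAt (fun r : ℝ => z + r * Complex.exp (θ * Complex.I))
          (Complex.exp (θ * Complex.I)) r := by
        simpa using ((hasDerivAt_id r).ofReal_comp.mul_const
          (Complex.exp (θ * Complex.I))).const_add z
      exact (hφ.differentiable _).hasFDerivAt.comp_hasDerivAt r h1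
    have hsm : ContDiff ℝ 1 f := by
      have h1 : ContDiff ℝ 1 φ := hφ.1.of_le (by exact_mod_cast le_top)
      refine h1.comp (contDiff_const.add (ContDiff.mul ?_ contDiff_const))
      exact Complex.ofRealCLM.contDiff
    have hcs : HasCompactSupport f := by
      obtain ⟨R, hR, hsupp⟩ := hφ.exists_support_subset_closedBall
      refine HasCompactSupport.intro (isCompact_Icc (a := -(R + ‖z‖)) (b := R + ‖z‖)) fun r hr => ?_
      refine hsupp _ ?_
      have hr' : R + ‖z‖ < |r| := by
        by_contra! h
        exact hr (abs_le.1 h)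
      have h3 : ‖(r : ℂ) * Complex.exp (θ * Complex.I)‖ = |r| := by
        rw [norm_mul, Complex.norm_exp_ofReal_mul_I, mul_one, Complex.norm_real, Real.norm_eq_abs]
      have h4 := norm_sub_norm_le ((r : ℂ) * Complex.exp (θ * Complex.I)) (-z)
      rw [sub_neg_eq_add, norm_neg, h3, add_comm _ z] at h4
      linarith
    have := hcs.integral_Ioi_deriv_eq hsm 0
    simp_rw [fun r => (hder r).deriv] at this
    rw [this, hf]
    simp
  simp_rw [hinner]
  rw [setIntegral_const]
  simp only [measureReal_def, Real.volume_Ioo, sub_neg_eq_add]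
  rw [ENNReal.toReal_ofReal (by positivity), Complex.real_smul]
  push_cast
  ring

/-- On each circle the integrand is `r⁻¹ d/dθ φ(z + re^{iθ})`, the derivative of a function with
equal values at `±π`. -/
lemma integral_angular (hφ : IsTest φ) (z : ℂ) :
    ∫ p in Ioi (0 : ℝ) ×ˢ Ioo (-Real.pi) Real.pi,
      fderiv ℝ φ (z + p.1 * Complex.exp (p.2 * Complex.I))
        (Complex.I * Complex.exp (p.2 * Complex.I)) = 0 := by
  have hint := hφ.integrableOn_polar z
    (g := fun θ => Complex.I * Complex.exp (θ * Complex.I)) (by fun_prop)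
  rw [Measure.volume_eq_prod] at hint ⊢
  rw [setIntegral_prod _ hint]
  refine setIntegral_eq_zero_of_forall_eq_zero fun r hr => ?_
  have hr0 : (r : ℂ) ≠ 0 := by exact_mod_cast (ne_of_gt hr)
  have hder : ∀ θ ∈ uIcc (-Real.pi) Real.pi, HasDerivAt
      (fun θ : ℝ => (r : ℂ)⁻¹ * φ (z + r * Complex.exp (θ * Complex.I)))
      (fderiv ℝ φ (z + r * Complex.exp (θ * Complex.I))
        (Complex.I * Complex.exp (θ * Complex.I))) θ := by
    intro θ _
    have h0 : HasDerivAt (fun θ : ℝ => (θ : ℂ) * Complex.I) Complex.I θ := by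
      simpa using (hasDerivAt_id θ).ofReal_comp.mul_const Complex.I
    have h1 : HasDerivAt (fun θ : ℝ => z + r * Complex.exp (θ * Complex.I))
        (r • (Complex.I * Complex.exp (θ * Complex.I))) θ := by
      convert! (h0.cexp.const_mul (r : ℂ)).const_add z using 1
      rw [Complex.real_smul, mul_comm Complex.I]
    have h2 := ((hφ.differentiable _).hasFDerivAt.comp_hasDerivAt θ h1).const_mul (r : ℂ)⁻¹
    convert! h2 using 1
    rw [map_smul, Complex.real_smul, inv_mul_cancel_left₀ hr0]
  have hcont : Continuous fun θ : ℝ => fderiv ℝ φ (z + r * Complex.exp (θ * Complex.I))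
        (Complex.I * Complex.exp (θ * Complex.I)) := by
    have h1 : Continuous (fderiv ℝ φ) := hφ.1.continuous_fderiv (by simp)
    fun_prop
  have h := intervalIntegral.integral_eq_sub_of_hasDerivAt hder (hcont.intervalIntegrable _ _)
  rw [intervalIntegral.integral_of_le (by linarith [Real.pi_pos]), integral_Ioc_eq_integral_Ioo] at h
  rw [h]
  simp [Complex.exp_neg]

/-- The Cauchy-Pompeiu formula for test functions. -/
theorem cauchyTransform_dzbar (hφ : IsTest φ) : cauchyTransform (_root_.dzbar φ) = φ := by
  ext z
  have h1 : cauchyTransform (_root_.dzbar φ) z =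
      ∫ u, -(_root_.dzbar φ (z + u) * cauchyKernel u) := by
    rw [cauchyTransform, ← integral_add_left_eq_self _ z]
    refine integral_congr_ae (Eventually.of_forall fun u => ?_)
    simp only [sub_add_cancel_left, cauchyKernel_neg, mul_neg]
  -- In polar coordinates around `z`, `∂̄ = (e^{iθ}/2)(∂_r + (i/r)∂_θ)`. The Jacobian `r` and the
  -- kernel `(πre^{iθ})⁻¹` cancel the prefactor up to `(2π)⁻¹`, leaving a radial and an angular
  -- part.
  have hkey : ∀ p ∈ Ioi (0 : ℝ) ×ˢ Ioo (-Real.pi) Real.pi,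
      p.1 • (-(_root_.dzbar φ (z + Complex.polarCoord.symm p) *
        cauchyKernel (Complex.polarCoord.symm p))) =
      -(2 * Real.pi : ℂ)⁻¹ * (fderiv ℝ φ (z + p.1 * Complex.exp (p.2 * Complex.I))
          (Complex.exp (p.2 * Complex.I)) +
        Complex.I * fderiv ℝ φ (z + p.1 * Complex.exp (p.2 * Complex.I))
          (Complex.I * Complex.exp (p.2 * Complex.I))) := by
    rintro ⟨r, θ⟩ ⟨hr, -⟩
    have hr0 : (r : ℂ) ≠ 0 := by exact_mod_cast (ne_of_gt hr)
    have hpi : (Real.pi : ℂ) ≠ 0 := by exact_mod_cast Real.pi_ne_zero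
    have hpol : Complex.polarCoord.symm (r, θ) = r * Complex.exp (θ * Complex.I) := by
      rw [Complex.polarCoord_symm_apply, Complex.exp_mul_I]
      push_cast
      ring
    have hlin : ∀ w : ℂ, ∀ L : ℂ →L[ℝ] ℂ, L w = w.re * L 1 + w.im * L Complex.I := by
      intro w L
      conv_lhs => rw [show w = w.re • (1 : ℂ) + w.im • Complex.I by
        simp [Complex.re_add_im]]
      rw [map_add, map_smul, map_smul, Complex.real_smul, Complex.real_smul]
    have hexp : Complex.exp (θ * Complex.I) ≠ 0 := Complex.exp_ne_zero _
    have hinv : (Complex.exp (θ * Complex.I))⁻¹ = Real.cos θ - Real.sin θ * Complex.I := by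
      rw [← Complex.exp_neg, ← neg_mul, ← Complex.ofReal_neg, Complex.exp_mul_I]
      simp [Complex.ofReal_cos, Complex.ofReal_sin, sub_eq_add_neg]
    have he : Complex.exp (θ * Complex.I) = Real.cos θ + Real.sin θ * Complex.I := by
      rw [Complex.exp_mul_I, Complex.ofReal_cos, Complex.ofReal_sin]
    simp only [hpol, Complex.real_smul, cauchyKernel, _root_.dzbar, mul_inv]
    rw [hlin (Complex.exp (θ * Complex.I)), hlin (Complex.I * Complex.exp (θ * Complex.I)), hinv]
    simp only [he]
    generalize fderiv ℝ φ (z + r * (Real.cos θ + Real.sin θ * Complex.I)) = L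
    have hre : ((Real.cos θ : ℂ) + Real.sin θ * Complex.I).re = Real.cos θ := by
      rw [← Complex.ofReal_re (Real.cos θ)]; simp [-Complex.ofReal_cos, -Complex.ofReal_sin]
    have him : ((Real.cos θ : ℂ) + Real.sin θ * Complex.I).im = Real.sin θ := by
      simp [-Complex.ofReal_cos, -Complex.ofReal_sin]
    rw [Complex.I_mul_re, Complex.I_mul_im, hre, him]
    field_simp
    push_cast
    linear_combination L Complex.I * Complex.sin θ * Complex.I_sq
  rw [h1, ← Complex.integral_comp_polarCoord_symm, polarCoord_target,
    setIntegral_congr_fun (measurableSet_Ioi.prod measurableSet_Ioo) hkey, integral_const_mul,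
    integral_add (hφ.integrableOn_polar z (g := fun θ => Complex.exp (θ * Complex.I)) (by fun_prop))
      ((hφ.integrableOn_polar z (g := fun θ => Complex.I * Complex.exp (θ * Complex.I))
        (by fun_prop)).const_mul _), integral_const_mul, hφ.integral_radial, hφ.integral_angular]
  have hpi : (Real.pi : ℂ) ≠ 0 := by exact_mod_cast Real.pi_ne_zero
  field_simp
  ring

end IsTest

/-! ### Decay of the Cauchy transform -/

lemma norm_cauchyKernel_sub_le {R : ℝ} {z w : ℂ} (hz : 2 * R ≤ ‖z‖) (hz0 : z ≠ 0) (hw : ‖w‖ ≤ R) :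
    ‖cauchyKernel (z - w)‖ ≤ 2 / Real.pi * ‖z‖⁻¹ := by
  have h1 : ‖z‖ / 2 ≤ ‖z - w‖ := by linarith [norm_sub_norm_le z w]
  have h2 : 0 < ‖z‖ := norm_pos_iff.2 hz0
  rw [norm_cauchyKernel]
  calc (Real.pi * ‖z - w‖)⁻¹ ≤ (Real.pi * (‖z‖ / 2))⁻¹ := by
        have := Real.pi_pos
        gcongr
    _ = _ := by
        have := Real.pi_ne_zero
        field_simp

lemma norm_cauchyTransform_le {h : ℂ → ℂ} (hint : Integrable h) {R : ℝ}
    (hsupp : ∀ w, R < ‖w‖ → h w = 0) {z : ℂ} (hz : 2 * R ≤ ‖z‖) (hz0 : z ≠ 0) :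
    ‖cauchyTransform h z‖ ≤ 2 / Real.pi * (∫ w, ‖h w‖) * ‖z‖⁻¹ := by
  rw [mul_assoc, mul_comm (∫ w, ‖h w‖), ← mul_assoc, ← integral_const_mul]
  refine norm_integral_le_of_norm_le (hint.norm.const_mul _) (Eventually.of_forall fun w => ?_)
  rcases le_or_gt ‖w‖ R with hw | hw
  · rw [norm_mul, mul_comm]
    exact mul_le_mul_of_nonneg_right (norm_cauchyKernel_sub_le hz hz0 hw) (norm_nonneg _)
  · simp [hsupp w hw]

/-- When the mean is zero, `cauchyKernel z` may be subtracted from the kernel, which gains a factor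
`‖w‖ / ‖z‖`. Derivatives of test functions have mean zero, so their transforms are `O(‖z‖⁻²)` and
hence square integrable. -/
lemma norm_cauchyTransform_le_of_integral_eq_zero {h : ℂ → ℂ} (hint : Integrable h) {R : ℝ}
    (hsupp : ∀ w, R < ‖w‖ → h w = 0) (hmean : ∫ w, h w = 0) {z : ℂ}
    (hz : 2 * R ≤ ‖z‖) (hz0 : z ≠ 0) (hconv : Integrable fun w => h w * cauchyKernel (z - w)) :
    ‖cauchyTransform h z‖ ≤ 2 * R / Real.pi * (∫ w, ‖h w‖) * ‖z‖⁻¹ ^ 2 := by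
  have h1 : cauchyTransform h z = ∫ w, h w * (cauchyKernel (z - w) - cauchyKernel z) := by
    simp only [mul_sub]
    rw [integral_sub hconv (hint.mul_const _), integral_mul_const, hmean, zero_mul, sub_zero]
    rfl
  rw [h1, mul_assoc, mul_comm (∫ w, ‖h w‖), ← mul_assoc, ← integral_const_mul]
  refine norm_integral_le_of_norm_le (hint.norm.const_mul _) (Eventually.of_forall fun w => ?_)
  rcases le_or_gt ‖w‖ R with hw | hw
  · rw [norm_mul, mul_comm]
    refine mul_le_mul_of_nonneg_right ?_ (norm_nonneg _)
    have hz1 : 0 < ‖z‖ := norm_pos_iff.2 hz0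
    have h2 : 0 < ‖z - w‖ := by linarith [norm_sub_norm_le z w]
    have h3 : cauchyKernel (z - w) - cauchyKernel z = cauchyKernel (z - w) * w * z⁻¹ := by
      have h4 : z - w ≠ 0 := norm_pos_iff.1 h2
      have hpi : (Real.pi : ℂ) ≠ 0 := by exact_mod_cast Real.pi_ne_zero
      simp only [cauchyKernel]
      field_simp
      ring
    rw [h3, norm_mul, norm_mul, norm_inv]
    calc ‖cauchyKernel (z - w)‖ * ‖w‖ * ‖z‖⁻¹ ≤ 2 / Real.pi * ‖z‖⁻¹ * R * ‖z‖⁻¹ := by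
          have := norm_cauchyKernel_sub_le hz hz0 hw
          have := Real.pi_pos
          gcongr
      _ = _ := by ring
  · simp [hsupp w hw]

lemma exists_norm_le_of_eventually {f : ℂ → ℂ} (hf : Continuous f) (n : ℕ) {A M : ℝ}
    (hA : 1 ≤ A) (h : ∀ z, A ≤ ‖z‖ → ‖f z‖ ≤ M * ‖z‖⁻¹ ^ n) :
    ∃ B, 0 ≤ B ∧ ∀ z, ‖f z‖ ≤ B * (1 + ‖z‖)⁻¹ ^ n := by
  obtain ⟨N, hN⟩ := (isCompact_closedBall (0 : ℂ) A).exists_bound_of_continuousOn hf.continuousOn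
  have hN0 : 0 ≤ N := (norm_nonneg _).trans (hN 0 (by simpa using zero_le_one.trans hA))
  -- The first summand covers the disc of radius `A`; the second covers its exterior, where `1 + ‖z‖
  -- ≤ 2‖z‖` because `A ≥ 1`.
  refine ⟨N * (1 + A) ^ n + |M| * 2 ^ n, by positivity, fun z => ?_⟩
  rcases le_or_gt ‖z‖ A with hz | hz
  · have h1 := hN z (by simpa using hz)
    have h2 : (1 + ‖z‖) ^ n ≤ (1 + A) ^ n := by gcongr
    have h3 : 0 < (1 + ‖z‖) ^ n := by positivity
    rw [inv_pow, ← div_eq_mul_inv, le_div_iff₀ h3]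
    calc ‖f z‖ * (1 + ‖z‖) ^ n ≤ N * (1 + A) ^ n := by gcongr
      _ ≤ _ := le_add_of_nonneg_right (by positivity)
  · have h1 := h z hz.le
    have hz0 : 0 < ‖z‖ := by linarith
    have h2 : ‖z‖⁻¹ ≤ 2 * (1 + ‖z‖)⁻¹ := by
      rw [← div_eq_mul_inv, inv_le_comm₀ hz0 (by positivity), inv_div, div_le_iff₀ two_pos]
      linarith
    calc ‖f z‖ ≤ M * ‖z‖⁻¹ ^ n := h1
      _ ≤ |M| * (2 * (1 + ‖z‖)⁻¹) ^ n := by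
          refine mul_le_mul (le_abs_self M) ?_ (by positivity) (abs_nonneg _)
          gcongr
      _ = |M| * 2 ^ n * (1 + ‖z‖)⁻¹ ^ n := by rw [mul_pow, mul_assoc]
      _ ≤ _ := by
          gcongr
          exact le_add_of_nonneg_left (by positivity)

namespace IsTest

variable {φ : ℂ → ℂ}

lemma exists_norm_cauchyTransform_le (hφ : IsTest φ) :
    ∃ B, 0 ≤ B ∧ ∀ z, ‖cauchyTransform φ z‖ ≤ B * (1 + ‖z‖)⁻¹ ^ 1 := by
  obtain ⟨R, hR, hsupp⟩ := hφ.exists_support_subset_closedBall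
  refine exists_norm_le_of_eventually hφ.contDiff_cauchyTransform.continuous 1
    (A := 2 * R + 1) (M := 2 / Real.pi * ∫ w, ‖φ w‖) (by linarith) fun z hz => ?_
  rw [pow_one]
  exact norm_cauchyTransform_le hφ.integrable hsupp (by linarith)
    (norm_pos_iff.1 (by linarith))

lemma exists_norm_cauchyTransform_le_of_integral_eq_zero (hφ : IsTest φ) (h0 : ∫ w, φ w = 0) :
    ∃ B, 0 ≤ B ∧ ∀ z, ‖cauchyTransform φ z‖ ≤ B * (1 + ‖z‖)⁻¹ ^ 2 := by
  obtain ⟨R, hR, hsupp⟩ := hφ.exists_support_subset_closedBall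
  refine exists_norm_le_of_eventually hφ.contDiff_cauchyTransform.continuous 2
    (A := 2 * R + 1) (M := 2 * R / Real.pi * ∫ w, ‖φ w‖) (by linarith) fun z hz => ?_
  exact norm_cauchyTransform_le_of_integral_eq_zero hφ.integrable hsupp h0 (by linarith)
    (norm_pos_iff.1 (by linarith)) (hφ.integrable_mul_cauchyKernel z)

end IsTest
end

noncomputable section

/-! ### Integration by parts for the Wirtinger derivatives -/

lemma integral_mul_dzbar_eq {F G : ℂ → ℂ} (hF : Differentiable ℝ F) (hG : Differentiable ℝ G)
    (hFG : Integrable fun z => F z * G z)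
    (hF' : ∀ v, Integrable fun z => fderiv ℝ F z v * G z)
    (hG' : ∀ v, Integrable fun z => F z * fderiv ℝ G z v) :
    ∫ z, F z * dzbar G z = -∫ z, dzbar F z * G z := by
  have h := fun v => integral_mul_fderiv_eq_neg_fderiv_mul_of_integrable (hF' v) (hG' v) hFG
    (fun x _ => hF x) (fun x _ => hG x)
  have h1 : ∀ z, F z * dzbar G z = 1 / 2 * (F z * fderiv ℝ G z 1 +
      Complex.I * (F z * fderiv ℝ G z Complex.I)) := fun z => by
    unfold dzbar; ring
  have h2 : ∀ z, dzbar F z * G z = 1 / 2 * (fderiv ℝ F z 1 * G z +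
      Complex.I * (fderiv ℝ F z Complex.I * G z)) := fun z => by
    unfold dzbar; ring
  simp_rw [h1, h2]
  rw [integral_const_mul, integral_const_mul, integral_add (hG' 1) ((hG' _).const_mul _),
    integral_add (hF' 1) ((hF' _).const_mul _), integral_const_mul, integral_const_mul, h, h]
  ring

lemma integral_mul_dz_eq {F G : ℂ → ℂ} (hF : Differentiable ℝ F) (hG : Differentiable ℝ G)
    (hFG : Integrable fun z => F z * G z)
    (hF' : ∀ v, Integrable fun z => fderiv ℝ F z v * G z)
    (hG' : ∀ v, Integrable fun z => F z * fderiv ℝ G z v) :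
    ∫ z, F z * dz G z = -∫ z, dz F z * G z := by
  have h := fun v => integral_mul_fderiv_eq_neg_fderiv_mul_of_integrable (hF' v) (hG' v) hFG
    (fun x _ => hF x) (fun x _ => hG x)
  have h1 : ∀ z, F z * dz G z = 1 / 2 * (F z * fderiv ℝ G z 1 -
      Complex.I * (F z * fderiv ℝ G z Complex.I)) := fun z => by
    unfold dz; ring
  have h2 : ∀ z, dz F z * G z = 1 / 2 * (fderiv ℝ F z 1 * G z -
      Complex.I * (fderiv ℝ F z Complex.I * G z)) := fun z => by
    unfold dz; ring
  simp_rw [h1, h2]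
  rw [integral_const_mul, integral_const_mul, integral_sub (hG' 1) ((hG' _).const_mul _),
    integral_sub (hF' 1) ((hF' _).const_mul _), integral_const_mul, integral_const_mul, h, h]
  ring

lemma fderiv_conj_apply {f : ℂ → ℂ} (hf : Differentiable ℝ f) (z v : ℂ) :
    fderiv ℝ (fun z => conj (f z)) z v = conj (fderiv ℝ f z v) := by
  have := (Complex.conjCLE.toContinuousLinearMap.hasFDerivAt.comp z (hf z).hasFDerivAt).fderiv
  exact congrArg (fun L : ℂ →L[ℝ] ℂ => L v) this

lemma dzbar_conj {f : ℂ → ℂ} (hf : Differentiable ℝ f) (z : ℂ) :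
    dzbar (fun z => conj (f z)) z = conj (dz f z) := by
  simp only [dzbar, dz, fderiv_conj_apply hf, map_mul, map_sub, map_div₀, map_one, map_ofNat,
    Complex.conj_I]
  ring

lemma dz_conj {f : ℂ → ℂ} (hf : Differentiable ℝ f) (z : ℂ) :
    dz (fun z => conj (f z)) z = conj (dzbar f z) := by
  simp only [dzbar, dz, fderiv_conj_apply hf, map_mul, map_add, map_div₀, map_one, map_ofNat,
    Complex.conj_I]
  ring

lemma integrable_inv_one_add_norm_pow {n : ℕ} (hn : 3 ≤ n) :
    Integrable fun z : ℂ => (1 + ‖z‖)⁻¹ ^ n := by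
  have h := integrable_one_add_norm (E := ℂ) (μ := volume) (r := n) (by
    rw [Complex.finrank_real_complex]
    exact_mod_cast hn)
  refine h.congr (Eventually.of_forall fun z => ?_)
  simp only
  rw [Real.rpow_neg (by positivity), Real.rpow_natCast, inv_pow]

lemma integrable_mul_of_decay {f g : ℂ → ℂ} (hf : Continuous f) (hg : Continuous g) {A B : ℝ}
    {n m : ℕ} (hnm : 3 ≤ n + m) (hA : 0 ≤ A) (hfA : ∀ z, ‖f z‖ ≤ A * (1 + ‖z‖)⁻¹ ^ n)
    (hgB : ∀ z, ‖g z‖ ≤ B * (1 + ‖z‖)⁻¹ ^ m) : Integrable fun z => f z * g z := by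
  refine ((integrable_inv_one_add_norm_pow hnm).const_mul (A * B)).mono'
    (hf.mul hg).aestronglyMeasurable (Eventually.of_forall fun z => ?_)
  rw [norm_mul]
  calc ‖f z‖ * ‖g z‖ ≤ (A * (1 + ‖z‖)⁻¹ ^ n) * (B * (1 + ‖z‖)⁻¹ ^ m) :=
        mul_le_mul (hfA z) (hgB z) (norm_nonneg _) (by positivity)
    _ = _ := by rw [pow_add]; ring

/-! ### The Beurling transform -/

namespace IsTest

variable {φ : ℂ → ℂ}

lemma dzbar_cauchyTransform_eq (hφ : IsTest φ) : _root_.dzbar (cauchyTransform φ) = φ :=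
  hφ.dzbar_cauchyTransform.trans hφ.cauchyTransform_dzbar

lemma exists_norm_cauchyTransform_fderiv_le (hφ : IsTest φ) (v : ℂ) :
    ∃ B, 0 ≤ B ∧ ∀ z, ‖cauchyTransform (fun w => fderiv ℝ φ w v) z‖ ≤ B * (1 + ‖z‖)⁻¹ ^ 2 :=
  (hφ.fderiv_apply v).exists_norm_cauchyTransform_le_of_integral_eq_zero
    (hφ.integral_fderiv_apply v)

lemma exists_norm_cauchyTransform_dz_le (hφ : IsTest φ) :
    ∃ B, 0 ≤ B ∧ ∀ z, ‖cauchyTransform (_root_.dz φ) z‖ ≤ B * (1 + ‖z‖)⁻¹ ^ 2 :=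
  hφ.dz.exists_norm_cauchyTransform_le_of_integral_eq_zero hφ.integral_dz

/-- With `v = Cφ` and `p = ∂v`, two integrations by parts give `∫ p ∂̄(conj v) = -∫ ∂̄p conj v = -∫
∂φ conj v = ∫ φ ∂(conj v)`, and `∂(conj v) = conj(∂̄v) = conj φ`. This is the `L²` isometry of the
Beurling transform. -/
lemma integral_cauchyTransform_dz_mul_conj (hφ : IsTest φ) :
    ∫ z, cauchyTransform (_root_.dz φ) z * conj (cauchyTransform (_root_.dz φ) z) =
      ∫ z, φ z * conj (φ z) := by
  obtain ⟨A, hA, hvA⟩ := hφ.exists_norm_cauchyTransform_le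
  obtain ⟨B, hB, hpB⟩ := hφ.exists_norm_cauchyTransform_dz_le
  set v := cauchyTransform φ with hv
  set p := cauchyTransform (_root_.dz φ) with hp
  have hvd : Differentiable ℝ v := hφ.contDiff_cauchyTransform.differentiable (by simp)
  have hpd : Differentiable ℝ p := hφ.dz.contDiff_cauchyTransform.differentiable (by simp)
  have hcd : Differentiable ℝ fun z => conj (v z) :=
    Complex.conjCLE.toContinuousLinearMap.differentiable.comp hvd
  have hvc : ∀ z, ‖conj (v z)‖ ≤ A * (1 + ‖z‖)⁻¹ ^ 1 := fun z => by
    rw [RCLike.norm_conj]; exact hvA z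
  have hcfd : ∀ u, (fun z => fderiv ℝ (fun z => conj (v z)) z u) =
      fun z => conj (cauchyTransform (fun w => fderiv ℝ φ w u) z) := fun u => by
    ext z
    rw [fderiv_conj_apply hvd, hφ.fderiv_cauchyTransform]
  have hcfc : ∀ u, Continuous fun z => conj (cauchyTransform (fun w => fderiv ℝ φ w u) z) :=
    fun u => Complex.continuous_conj.comp (hφ.fderiv_apply u).contDiff_cauchyTransform.continuous
  have h1 : ∀ z, conj (p z) = _root_.dzbar (fun z => conj (v z)) z := fun z => by
    rw [dzbar_conj hvd, hv, hφ.dz_cauchyTransform]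
  have h2 : ∀ z, conj (φ z) = _root_.dz (fun z => conj (v z)) z := fun z => by
    rw [dz_conj hvd, hv, hφ.dzbar_cauchyTransform_eq]
  simp_rw [h1]
  rw [integral_mul_dzbar_eq hpd hcd]
  · rw [hp, hφ.dz.dzbar_cauchyTransform_eq]
    simp_rw [h2]
    rw [integral_mul_dz_eq hφ.differentiable hcd]
    · exact (hφ.continuous.mul hcd.continuous).integrable_of_hasCompactSupport hφ.2.mul_right
    · exact fun u => ((hφ.fderiv_apply u).continuous.mul
        hcd.continuous).integrable_of_hasCompactSupport (hφ.fderiv_apply u).2.mul_right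
    · intro u
      rw [funext fun z => congrArg (φ z * ·) (congrFun (hcfd u) z)]
      exact (hφ.continuous.mul (hcfc u)).integrable_of_hasCompactSupport hφ.2.mul_right
  -- Decay of order two for `p` and order one for `v` reaches exactly the order three required for
  -- integrability in the plane.
  · exact integrable_mul_of_decay hpd.continuous hcd.continuous (by norm_num) hB hpB hvc
  · intro u
    obtain ⟨B', hB', hpB'⟩ := hφ.dz.exists_norm_cauchyTransform_fderiv_le u
    rw [hp, funext fun z => congrArg (· * conj (v z)) (hφ.dz.fderiv_cauchyTransform z u)]
    exact integrable_mul_of_decay (hφ.dz.fderiv_apply u).contDiff_cauchyTransform.continuous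
      hcd.continuous (by norm_num) hB' hpB' hvc
  · intro u
    obtain ⟨B', hB', hpB'⟩ := hφ.exists_norm_cauchyTransform_fderiv_le u
    rw [funext fun z => congrArg (p z * ·) (congrFun (hcfd u) z)]
    exact integrable_mul_of_decay hpd.continuous (hcfc u) (m := 2) (by norm_num) hB hpB
      (fun z => by rw [RCLike.norm_conj]; exact hpB' z)

lemma memLp (hφ : IsTest φ) : MemLp φ 2 := hφ.continuous.memLp_of_hasCompactSupport hφ.2

lemma memLp_cauchyTransform_dz (hφ : IsTest φ) : MemLp (cauchyTransform (_root_.dz φ)) 2 := by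
  obtain ⟨B, hB, hpB⟩ := hφ.exists_norm_cauchyTransform_dz_le
  have hc := hφ.dz.contDiff_cauchyTransform.continuous
  rw [memLp_two_iff_integrable_sq_norm hc.aestronglyMeasurable]
  have h := (integrable_mul_of_decay hc hc (by norm_num) hB hpB hpB).norm
  simpa only [norm_mul, sq] using h

end IsTest

/-- The space of test functions. -/
def testFunctions : Submodule ℂ (ℂ → ℂ) where
  carrier := {φ | IsTest φ}
  add_mem' := fun hφ hψ => IsTest.add hφ hψ
  zero_mem' := ⟨contDiff_const, HasCompactSupport.zero⟩
  smul_mem' := fun c _ hφ => IsTest.const_mul hφ c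

/-- The class of a test function in `L²`. -/
def testToL2 : testFunctions →ₗ[ℂ] Lp ℂ 2 (volume : Measure ℂ) where
  toFun φ := (IsTest.memLp φ.2).toLp
  map_add' _ _ := rfl
  map_smul' _ _ := rfl

lemma IsTest.dz_add {φ ψ : ℂ → ℂ} (hφ : IsTest φ) (hψ : IsTest ψ) :
    _root_.dz (φ + ψ) = fun z => _root_.dz φ z + _root_.dz ψ z := by
  ext z
  simp only [_root_.dz, fderiv_add (hφ.differentiable z) (hψ.differentiable z),
    add_apply]
  ring

lemma IsTest.dz_smul {φ : ℂ → ℂ} (hφ : IsTest φ) (c : ℂ) :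
    _root_.dz (c • φ) = fun z => c * _root_.dz φ z := by
  ext z
  simp only [_root_.dz, fderiv_const_smul (hφ.differentiable z), smul_apply,
    smul_eq_mul]
  ring

/-- The map `φ ↦ C(∂φ)` from test functions to `L²`. -/
def testBeurling : testFunctions →ₗ[ℂ] Lp ℂ 2 (volume : Measure ℂ) where
  toFun φ := (IsTest.memLp_cauchyTransform_dz φ.2).toLp
  map_add' φ ψ := by
    rw [← MemLp.toLp_add]
    congr 1
    ext z
    rw [Submodule.coe_add, IsTest.dz_add φ.2 ψ.2, IsTest.cauchyTransform_add φ.2.dz ψ.2.dz]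
    rfl
  map_smul' c φ := by
    rw [RingHom.id_apply, ← MemLp.toLp_const_smul]
    congr 1
    ext z
    rw [Submodule.coe_smul, IsTest.dz_smul φ.2, cauchyTransform_const_mul]
    rfl

lemma denseRange_testToL2 : DenseRange testToL2 := by
  refine (Lp.dense_hasCompactSupport_contDiff (E := ℂ) (F := ℂ) (μ := volume) (p := 2)
    (by simp)).mono ?_
  rintro f ⟨g, hfg, hg1, hg2⟩
  refine ⟨⟨g, hg2, hg1⟩, ?_⟩
  exact Lp.ext ((IsTest.memLp (φ := g) ⟨hg2, hg1⟩).coeFn_toLp.trans hfg.symm)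

lemma MeasureTheory.MemLp.norm_toLp_sq_eq {f : ℂ → ℂ} (hf : MemLp f 2) :
    ((‖hf.toLp‖ ^ 2 : ℝ) : ℂ) = ∫ z, f z * conj (f z) := by
  have h := inner_self_eq_norm_sq_to_K (𝕜 := ℂ) hf.toLp
  rw [L2.inner_def] at h
  push_cast
  refine (h.symm.trans (integral_congr_ae ?_))
  filter_upwards [hf.coeFn_toLp] with z hz
  rw [hz, RCLike.inner_apply]

lemma norm_testBeurling (φ : testFunctions) : ‖testBeurling φ‖ = ‖testToL2 φ‖ := by
  have h : ((‖testBeurling φ‖ ^ 2 : ℝ) : ℂ) = ((‖testToL2 φ‖ ^ 2 : ℝ) : ℂ) :=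
    (MemLp.norm_toLp_sq_eq (IsTest.memLp_cauchyTransform_dz φ.2)).trans
      ((IsTest.integral_cauchyTransform_dz_mul_conj φ.2).trans
        (MemLp.norm_toLp_sq_eq (IsTest.memLp φ.2)).symm)
  exact (sq_eq_sq₀ (norm_nonneg _) (norm_nonneg _)).1 (by exact_mod_cast h)

/-- The extension of `φ ↦ C(∂φ)` to `L²`. -/
def beurlingL2 : Lp ℂ 2 (volume : Measure ℂ) →L[ℂ] Lp ℂ 2 (volume : Measure ℂ) :=
  testBeurling.extendOfNorm testToL2

lemma beurlingL2_testToL2 (φ : testFunctions) : beurlingL2 (testToL2 φ) = testBeurling φ :=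
  LinearMap.extendOfNorm_eq denseRange_testToL2
    ⟨1, fun φ => by rw [one_mul, norm_testBeurling]⟩ φ

/-- Complex conjugation on `L²`. -/
def conjL2 : Lp ℂ 2 (volume : Measure ℂ) →L[ℝ] Lp ℂ 2 (volume : Measure ℂ) :=
  (Complex.conjCLE : ℂ →L[ℝ] ℂ).compLpL 2 volume

lemma coeFn_conjL2 (h : Lp ℂ 2 (volume : Measure ℂ)) : conjL2 h =ᵐ[volume] fun z => conj (h z) :=
  (Complex.conjCLE : ℂ →L[ℝ] ℂ).coeFn_compLpL h

/-- The Beurling transform on `L²`, as the transpose of `φ ↦ C(∂φ)`. -/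
def beurling : Lp ℂ 2 (volume : Measure ℂ) →L[ℝ] Lp ℂ 2 (volume : Measure ℂ) :=
  conjL2 ∘L (beurlingL2.adjoint.restrictScalars ℝ) ∘L conjL2

/-- The two conjugations in `beurling` turn the sesquilinear adjoint into a bilinear transpose. This
identity is what later makes `beurling h` the weak `∂`-derivative of the Cauchy transform of `h`. -/
lemma integral_beurling_mul (h : Lp ℂ 2 (volume : Measure ℂ)) {φ : ℂ → ℂ} (hφ : IsTest φ) :
    ∫ z, beurling h z * φ z = ∫ z, h z * cauchyTransform (dz φ) z := by
  have h1 := ContinuousLinearMap.adjoint_inner_left beurlingL2 (testToL2 ⟨φ, hφ⟩) (conjL2 h)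
  rw [beurlingL2_testToL2, L2.inner_def, L2.inner_def] at h1
  refine Eq.trans (integral_congr_ae ?_) (h1.trans (integral_congr_ae ?_))
  · filter_upwards [coeFn_conjL2 (beurlingL2.adjoint (conjL2 h)),
      (IsTest.memLp hφ).coeFn_toLp] with z hz1 hz2
    rw [RCLike.inner_apply, mul_comm]
    congr 1
    · exact hz2.symm
  · filter_upwards [coeFn_conjL2 h, (IsTest.memLp_cauchyTransform_dz hφ).coeFn_toLp] with z hz1 hz2
    rw [RCLike.inner_apply, mul_comm, hz1, Complex.conj_conj]
    congr 1
end

noncomputable section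

/-! ### Local `L²` bounds for the Cauchy transform -/

/-- The total mass of the Cauchy kernel on the disc of radius `2R`. -/
def kernelMass (R : ℝ) : ENNReal := ∫⁻ u in Metric.closedBall (0 : ℂ) (2 * R), ‖cauchyKernel u‖ₑ

lemma kernelMass_lt_top (R : ℝ) : kernelMass R < ⊤ :=
  (locallyIntegrable_cauchyKernel.integrableOn_isCompact (isCompact_closedBall _ _)).2

/-- Differences of points of the disc of radius `R` lie in the disc of radius `2R`. This is one of
the two row and column bounds of the Schur test; the other follows by symmetry. -/
lemma lintegral_cauchyKernel_le {R : ℝ} {w : ℂ} (hw : w ∈ Metric.closedBall (0 : ℂ) R) :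
    ∫⁻ z in Metric.closedBall (0 : ℂ) R, ‖cauchyKernel (z - w)‖ₑ ≤ kernelMass R := by
  rw [kernelMass, ← lintegral_indicator measurableSet_closedBall,
    ← lintegral_indicator measurableSet_closedBall,
    ← lintegral_sub_right_eq_self (indicator (Metric.closedBall (0 : ℂ) (2 * R)) _) w]
  refine lintegral_mono fun z => ?_
  by_cases hz : z ∈ Metric.closedBall (0 : ℂ) R
  · have : z - w ∈ Metric.closedBall (0 : ℂ) (2 * R) := by
      rw [mem_closedBall_zero_iff] at hz hw ⊢
      linarith [norm_sub_le z w]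
    rw [indicator_of_mem hz, indicator_of_mem this]
  · rw [indicator_of_notMem hz]
    exact zero_le

lemma enorm_cauchyKernel_sub_comm (z w : ℂ) :
    ‖cauchyKernel (z - w)‖ₑ = ‖cauchyKernel (w - z)‖ₑ := by
  rw [← neg_sub w z, cauchyKernel_neg, enorm_neg]

lemma lintegral_cauchyKernel_le' {R : ℝ} {z : ℂ} (hz : z ∈ Metric.closedBall (0 : ℂ) R) :
    ∫⁻ w in Metric.closedBall (0 : ℂ) R, ‖cauchyKernel (z - w)‖ₑ ≤ kernelMass R := by
  simp_rw [enorm_cauchyKernel_sub_comm z]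
  exact lintegral_cauchyKernel_le hz

lemma ENNReal.lintegral_mul_sq_le {α : Type*} [MeasurableSpace α] {μ : Measure α}
    {f k : α → ENNReal} (hf : AEMeasurable f μ) (hk : AEMeasurable k μ) :
    (∫⁻ x, f x * k x ∂μ) ^ 2 ≤ (∫⁻ x, f x ^ 2 * k x ∂μ) * ∫⁻ x, k x ∂μ := by
  have hsplit : ∀ a : ENNReal, a ^ (2⁻¹ : ℝ) * a ^ (2⁻¹ : ℝ) = a := fun a => by
    rw [← ENNReal.rpow_add_of_nonneg _ _ (by norm_num) (by norm_num)]
    norm_num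
  have hsq : ∀ a : ENNReal, (a ^ (2⁻¹ : ℝ)) ^ 2 = a := fun a => by rw [sq, hsplit]
  have h := ENNReal.lintegral_mul_le_Lp_mul_Lq μ Real.HolderConjugate.two_two
    (f := fun x => f x * k x ^ (2⁻¹ : ℝ)) (g := fun x => k x ^ (2⁻¹ : ℝ))
    (hf.mul (hk.pow_const _)) (hk.pow_const _)
  simp only [Pi.mul_apply, mul_assoc, hsplit, one_div, ENNReal.rpow_two, mul_pow, hsq] at h
  calc _ ≤ ((∫⁻ x, f x ^ 2 * k x ∂μ) ^ (2⁻¹ : ℝ) * (∫⁻ x, k x ∂μ) ^ (2⁻¹ : ℝ)) ^ 2 := by gcongr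
    _ = _ := by rw [mul_pow, hsq, hsq]

lemma aestronglyMeasurable_mul_cauchyKernel {h : ℂ → ℂ} (hm : AEStronglyMeasurable h) :
    AEStronglyMeasurable (fun p : ℂ × ℂ => h p.2 * cauchyKernel (p.1 - p.2))
      ((volume : Measure ℂ).prod volume) :=
  hm.comp_snd.mul (measurable_cauchyKernel.comp
    (measurable_fst.sub measurable_snd)).aestronglyMeasurable

lemma aestronglyMeasurable_cauchyTransform {h : ℂ → ℂ} (hm : AEStronglyMeasurable h) :
    AEStronglyMeasurable (cauchyTransform h) :=
  (aestronglyMeasurable_mul_cauchyKernel hm).integral_prod_right'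

/-- Schur test: Cauchy–Schwarz with the kernel split into two square roots costs one factor
`kernelMass R`, and integrating in `z` after Tonelli costs the other. -/
lemma lintegral_cauchyTransform_sq_le {h : ℂ → ℂ} (hm : AEStronglyMeasurable h) {R : ℝ}
    (hsupp : ∀ w ∉ Metric.closedBall (0 : ℂ) R, h w = 0) :
    ∫⁻ z in Metric.closedBall (0 : ℂ) R, ‖cauchyTransform h z‖ₑ ^ 2 ≤
      kernelMass R ^ 2 * ∫⁻ w, ‖h w‖ₑ ^ 2 := by
  set B := Metric.closedBall (0 : ℂ) R with hB
  have hpt : ∀ z ∈ B, ‖cauchyTransform h z‖ₑ ^ 2 ≤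
      (∫⁻ w in B, ‖h w‖ₑ ^ 2 * ‖cauchyKernel (z - w)‖ₑ) * kernelMass R := by
    intro z hz
    have h1 : ‖cauchyTransform h z‖ₑ ≤ ∫⁻ w in B, ‖h w‖ₑ * ‖cauchyKernel (z - w)‖ₑ := by
      refine (enorm_integral_le_lintegral_enorm _).trans ?_
      rw [← lintegral_indicator measurableSet_closedBall]
      refine lintegral_mono fun w => ?_
      by_cases hw : w ∈ B
      · rw [indicator_of_mem hw, enorm_mul]
      · simp [hsupp w hw]
    calc _ ≤ (∫⁻ w in B, ‖h w‖ₑ * ‖cauchyKernel (z - w)‖ₑ) ^ 2 := by gcongr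
      _ ≤ (∫⁻ w in B, ‖h w‖ₑ ^ 2 * ‖cauchyKernel (z - w)‖ₑ) *
          ∫⁻ w in B, ‖cauchyKernel (z - w)‖ₑ :=
        ENNReal.lintegral_mul_sq_le hm.enorm.restrict
          (measurable_cauchyKernel.comp (measurable_const.sub measurable_id)).enorm.aemeasurable
      _ ≤ _ := by
        gcongr
        exact lintegral_cauchyKernel_le' hz
  calc _ ≤ ∫⁻ z in B, (∫⁻ w in B, ‖h w‖ₑ ^ 2 * ‖cauchyKernel (z - w)‖ₑ) * kernelMass R :=
        setLIntegral_mono' measurableSet_closedBall hpt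
    _ = (∫⁻ w in B, ∫⁻ z in B, ‖h w‖ₑ ^ 2 * ‖cauchyKernel (z - w)‖ₑ) * kernelMass R := by
        rw [lintegral_mul_const' _ _ (kernelMass_lt_top R).ne]
        congr 1
        refine lintegral_lintegral_swap ?_
        have h1 : AEMeasurable (fun w => ‖h w‖ₑ ^ 2) (volume.restrict B) :=
          (hm.enorm.pow_const 2).restrict
        exact h1.comp_snd.mul (measurable_cauchyKernel.comp
          (measurable_fst.sub measurable_snd)).enorm.aemeasurable
    _ ≤ (∫⁻ w in B, ‖h w‖ₑ ^ 2 * kernelMass R) * kernelMass R := by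
        gcongr ?_ * _
        refine setLIntegral_mono' measurableSet_closedBall fun w hw => ?_
        rw [lintegral_const_mul' _ _ (by simp)]
        gcongr
        exact lintegral_cauchyKernel_le hw
    _ ≤ _ := by
        rw [lintegral_mul_const' _ _ (kernelMass_lt_top R).ne, mul_assoc, ← sq, mul_comm]
        gcongr
        exact Measure.restrict_le_self

lemma eLpNorm_two_sq {α : Type*} [MeasurableSpace α] {μ : Measure α} (f : α → ℂ) :
    eLpNorm f 2 μ ^ 2 = ∫⁻ x, ‖f x‖ₑ ^ 2 ∂μ := by
  have h := eLpNorm_nnreal_pow_eq_lintegral (f := f) (μ := μ) (p := 2) (by norm_num)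
  simpa using h

lemma eLpNorm_cauchyTransform_le {h : ℂ → ℂ} (hm : AEStronglyMeasurable h) {R : ℝ}
    (hsupp : ∀ w ∉ Metric.closedBall (0 : ℂ) R, h w = 0) :
    eLpNorm (cauchyTransform h) 2 (volume.restrict (Metric.closedBall (0 : ℂ) R)) ≤
      kernelMass R * eLpNorm h 2 := by
  have h1 := lintegral_cauchyTransform_sq_le hm hsupp
  rw [← eLpNorm_two_sq, ← eLpNorm_two_sq, ← mul_pow] at h1
  exact (ENNReal.pow_le_pow_left_iff two_ne_zero).1 h1

lemma memLp_cauchyTransform {h : ℂ → ℂ} (hh : MemLp h 2) {R : ℝ}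
    (hsupp : ∀ w ∉ Metric.closedBall (0 : ℂ) R, h w = 0) :
    MemLp (cauchyTransform h) 2 (volume.restrict (Metric.closedBall (0 : ℂ) R)) :=
  ⟨(aestronglyMeasurable_cauchyTransform hh.1).restrict,
    (eLpNorm_cauchyTransform_le hh.1 hsupp).trans_lt
      (ENNReal.mul_lt_top (kernelMass_lt_top R) hh.2)⟩

lemma memL2Loc_cauchyTransform {h : ℂ → ℂ} (hh : MemLp h 2) {R : ℝ}
    (hsupp : ∀ w ∉ Metric.closedBall (0 : ℂ) R, h w = 0) : MemL2Loc (cauchyTransform h) := by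
  intro K hK
  obtain ⟨r, hr⟩ := hK.isBounded.subset_closedBall 0
  have h1 : ∀ w ∉ Metric.closedBall (0 : ℂ) (max r R), h w = 0 := fun w hw =>
    hsupp w fun hw' => hw (Metric.closedBall_subset_closedBall (le_max_right _ _) hw')
  exact (memLp_cauchyTransform hh h1).mono_measure
    (Measure.restrict_mono (hr.trans (Metric.closedBall_subset_closedBall (le_max_left _ _))) le_rfl)

/-! ### Weak derivatives -/

lemma MemL2Loc.locallyIntegrable {f : ℂ → ℂ} (hf : MemL2Loc f) : LocallyIntegrable f := by
  rw [locallyIntegrable_iff]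
  intro K hK
  have : IsFiniteMeasure (volume.restrict K) := ⟨by simpa using hK.measure_lt_top⟩
  exact (hf K hK).integrable (by norm_num)

lemma MemLp.memL2Loc {f : ℂ → ℂ} (hf : MemLp f 2) : MemL2Loc f :=
  fun K _ => hf.restrict K

lemma MeasureTheory.LocallyIntegrable.integrable_mul_test {f : ℂ → ℂ} (hf : LocallyIntegrable f)
    {φ : ℂ → ℂ} (hφ : IsTest φ) : Integrable fun z => f z * φ z := by
  have := hf.integrable_smul_left_of_hasCompactSupport hφ.continuous hφ.2
  simpa only [smul_eq_mul, mul_comm] using this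

lemma MemL2Loc.continuous_mul {f g : ℂ → ℂ} (hf : MemL2Loc f) (hg : Continuous g) :
    MemL2Loc fun z => g z * f z := by
  intro K hK
  obtain ⟨C, hC⟩ := hK.exists_bound_of_continuousOn hg.continuousOn
  refine MemLp.mul (p := ⊤) (q := 2) (hf K hK) (memLp_top_of_bound hg.aestronglyMeasurable C ?_)
  exact (ae_restrict_iff' hK.measurableSet).2 (Eventually.of_forall hC)

lemma MemL2Loc.add {f g : ℂ → ℂ} (hf : MemL2Loc f) (hg : MemL2Loc g) :
    MemL2Loc fun z => f z + g z := fun K hK => (hf K hK).add (hg K hK)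

lemma memL2Loc_of_continuous {f : ℂ → ℂ} (hf : Continuous f) : MemL2Loc f := by
  intro K hK
  have : IsFiniteMeasure (volume.restrict K) := ⟨by simpa using hK.measure_lt_top⟩
  obtain ⟨C, hC⟩ := hK.exists_bound_of_continuousOn hf.continuousOn
  exact MemLp.of_bound hf.aestronglyMeasurable C
    ((ae_restrict_iff' hK.measurableSet).2 (Eventually.of_forall hC))

lemma isWeakDz_iff {f p : ℂ → ℂ} :
    IsWeakDz f p ↔ ∀ φ, IsTest φ → ∫ z, f z * dz φ z = -∫ z, p z * φ z :=
  ⟨fun h φ hφ => h φ hφ.1 hφ.2, fun h φ h1 h2 => h φ ⟨h1, h2⟩⟩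

lemma isWeakDzbar_iff {f p : ℂ → ℂ} :
    IsWeakDzbar f p ↔ ∀ φ, IsTest φ → ∫ z, f z * dzbar φ z = -∫ z, p z * φ z :=
  ⟨fun h φ hφ => h φ hφ.1 hφ.2, fun h φ h1 h2 => h φ ⟨h1, h2⟩⟩

lemma eq_zero_of_integral_mul_test {u : ℂ → ℂ} (hu : LocallyIntegrable u)
    (h : ∀ φ, IsTest φ → ∫ z, u z * φ z = 0) : u =ᵐ[volume] 0 := by
  refine ae_eq_zero_of_integral_contDiff_smul_eq_zero hu fun g hg hgs => ?_
  have := h (fun z => (g z : ℂ)) ⟨Complex.ofRealCLM.contDiff.comp hg,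
    hgs.comp_left (g := ((↑) : ℝ → ℂ)) Complex.ofReal_zero⟩
  simpa only [Complex.real_smul, mul_comm] using this

lemma IsWeakDz.ae_eq {f p q : ℂ → ℂ} (hp : IsWeakDz f p) (hq : IsWeakDz f q)
    (hpl : LocallyIntegrable p) (hql : LocallyIntegrable q) : p =ᵐ[volume] q := by
  have h := eq_zero_of_integral_mul_test (hpl.sub hql) fun φ hφ => by
    simp only [Pi.sub_apply, sub_mul]
    rw [integral_sub (hpl.integrable_mul_test hφ) (hql.integrable_mul_test hφ)]
    have := (isWeakDz_iff.1 hp φ hφ).symm.trans (isWeakDz_iff.1 hq φ hφ)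
    rw [neg_inj.1 this, sub_self]
  filter_upwards [h] with z hz
  exact sub_eq_zero.1 hz

lemma isWeakDz_const (c : ℂ) : IsWeakDz (fun _ => c) 0 := by
  rw [isWeakDz_iff]
  intro φ hφ
  rw [integral_const_mul, hφ.integral_dz]
  simp

lemma isWeakDzbar_const (c : ℂ) : IsWeakDzbar (fun _ => c) 0 := by
  rw [isWeakDzbar_iff]
  intro φ hφ
  rw [integral_const_mul, hφ.integral_dzbar]
  simp

lemma IsWeakDz.add {f g p q : ℂ → ℂ} (hf : IsWeakDz f p) (hg : IsWeakDz g q)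
    (hfl : LocallyIntegrable f) (hgl : LocallyIntegrable g) (hpl : LocallyIntegrable p)
    (hql : LocallyIntegrable q) : IsWeakDz (fun z => f z + g z) (fun z => p z + q z) := by
  rw [isWeakDz_iff] at *
  intro φ hφ
  simp only [add_mul]
  rw [integral_add (hfl.integrable_mul_test hφ.dz) (hgl.integrable_mul_test hφ.dz),
    integral_add (hpl.integrable_mul_test hφ) (hql.integrable_mul_test hφ), hf φ hφ, hg φ hφ]
  ring

lemma IsWeakDzbar.add {f g p q : ℂ → ℂ} (hf : IsWeakDzbar f p) (hg : IsWeakDzbar g q)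
    (hfl : LocallyIntegrable f) (hgl : LocallyIntegrable g) (hpl : LocallyIntegrable p)
    (hql : LocallyIntegrable q) : IsWeakDzbar (fun z => f z + g z) (fun z => p z + q z) := by
  rw [isWeakDzbar_iff] at *
  intro φ hφ
  simp only [add_mul]
  rw [integral_add (hfl.integrable_mul_test hφ.dzbar) (hgl.integrable_mul_test hφ.dzbar),
    integral_add (hpl.integrable_mul_test hφ) (hql.integrable_mul_test hφ), hf φ hφ, hg φ hφ]
  ring

lemma IsWeakDzbar.const_mul {f p : ℂ → ℂ} (hf : IsWeakDzbar f p) (c : ℂ) :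
    IsWeakDzbar (fun z => c * f z) (fun z => c * p z) := by
  rw [isWeakDzbar_iff] at *
  intro φ hφ
  simp only [mul_assoc]
  rw [integral_const_mul, integral_const_mul, hf φ hφ, mul_neg]

/-! ### Multiplication by exponentials -/

lemma fderiv_cexp_mul (a z v : ℂ) :
    fderiv ℝ (fun z => Complex.exp (a * z)) z v = v * (a * Complex.exp (a * z)) := by
  have h : HasDerivAt (fun z => Complex.exp (a * z)) (a * Complex.exp (a * z)) z := by
    have := ((hasDerivAt_id z).const_mul a).cexp
    simpa [mul_comm] using this
  have h1 := (h.hasFDerivAt.restrictScalars ℝ).fderiv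
  rw [h1]
  simp

lemma contDiff_cexp_mul (a : ℂ) : ContDiff ℝ (⊤ : ℕ∞) fun z : ℂ => Complex.exp (a * z) :=
  (contDiff_const.mul contDiff_id).cexp

lemma fderiv_mul_apply {f g : ℂ → ℂ} {z : ℂ} (hf : DifferentiableAt ℝ f z)
    (hg : DifferentiableAt ℝ g z) (v : ℂ) :
    fderiv ℝ (fun z => f z * g z) z v = f z * fderiv ℝ g z v + fderiv ℝ f z v * g z := by
  rw [show (fun z => f z * g z) = f * g from rfl, fderiv_mul hf hg]
  simp [mul_comm]

lemma dzbar_mul {f g : ℂ → ℂ} {z : ℂ} (hf : DifferentiableAt ℝ f z)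
    (hg : DifferentiableAt ℝ g z) :
    dzbar (fun z => f z * g z) z = f z * dzbar g z + dzbar f z * g z := by
  simp only [dzbar, fderiv_mul_apply hf hg]
  ring

lemma dz_cexp_mul (a : ℂ) {φ : ℂ → ℂ} (hφ : IsTest φ) (z : ℂ) :
    dz (fun z => Complex.exp (a * z) * φ z) z =
      Complex.exp (a * z) * dz φ z + a * (Complex.exp (a * z) * φ z) := by
  simp only [dz, fderiv_mul_apply ((contDiff_cexp_mul a).differentiable (by simp) z)
    (hφ.differentiable z), fderiv_cexp_mul]
  linear_combination (-(1 / 2) * a * Complex.exp (a * z) * φ z) * Complex.I_sq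

lemma dzbar_cexp_mul (a : ℂ) {φ : ℂ → ℂ} (hφ : IsTest φ) (z : ℂ) :
    dzbar (fun z => Complex.exp (a * z) * φ z) z = Complex.exp (a * z) * dzbar φ z := by
  simp only [dzbar, fderiv_mul_apply ((contDiff_cexp_mul a).differentiable (by simp) z)
    (hφ.differentiable z), fderiv_cexp_mul]
  linear_combination ((1 / 2) * a * Complex.exp (a * z) * φ z) * Complex.I_sq

/-- Move the exponential onto the test function: it is holomorphic, so `∂̄` passes through it. -/
lemma IsWeakDzbar.cexp_mul {f q : ℂ → ℂ} (hf : IsWeakDzbar f q) (a : ℂ) :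
    IsWeakDzbar (fun z => Complex.exp (a * z) * f z) (fun z => Complex.exp (a * z) * q z) := by
  rw [isWeakDzbar_iff] at *
  intro φ hφ
  have h := hf _ (IsTest.mul_left (contDiff_cexp_mul a) hφ)
  simp_rw [dzbar_cexp_mul a hφ] at h
  convert h using 2
  · ext z; ring
  · congr 1; ext z; ring

lemma IsWeakDz.cexp_mul {f p : ℂ → ℂ} (hf : IsWeakDz f p) (hfl : LocallyIntegrable f)
    (hpl : LocallyIntegrable p) (a : ℂ) :
    IsWeakDz (fun z => Complex.exp (a * z) * f z)
      (fun z => Complex.exp (a * z) * (p z + a * f z)) := by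
  rw [isWeakDz_iff] at *
  intro φ hφ
  have hψ := IsTest.mul_left (contDiff_cexp_mul a) hφ
  have h := hf _ hψ
  have h1 : ∀ z, Complex.exp (a * z) * f z * dz φ z =
      f z * dz (fun z => Complex.exp (a * z) * φ z) z -
        a * (f z * (Complex.exp (a * z) * φ z)) := fun z => by
    rw [dz_cexp_mul a hφ]; ring
  have h2 : ∀ z, Complex.exp (a * z) * (p z + a * f z) * φ z =
      p z * (Complex.exp (a * z) * φ z) + a * (f z * (Complex.exp (a * z) * φ z)) := fun z => by
    ring
  simp_rw [h1, h2]
  rw [integral_sub (hfl.integrable_mul_test hψ.dz) ((hfl.integrable_mul_test hψ).const_mul _),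
    integral_add (hpl.integrable_mul_test hψ) ((hfl.integrable_mul_test hψ).const_mul _), h]
  ring

/-! ### The weak derivatives of a Cauchy transform -/

/-- Tonelli with the `z`-integral innermost: it is at most `kernelMass` times the bound of `ψ`, on a
disc containing both supports. -/
lemma integrable_prod_cauchyKernel {h : ℂ → ℂ} (hint : Integrable h) {R : ℝ}
    (hsupp : ∀ w ∉ Metric.closedBall (0 : ℂ) R, h w = 0) {ψ : ℂ → ℂ} (hψ : IsTest ψ) :
    Integrable (fun p : ℂ × ℂ => h p.2 * cauchyKernel (p.1 - p.2) * ψ p.1)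
      ((volume : Measure ℂ).prod volume) := by
  obtain ⟨M, hM⟩ := hψ.continuous.bounded_above_of_compact_support hψ.2
  obtain ⟨R', hR', hψR⟩ := hψ.exists_support_subset_closedBall
  set R₁ := max R R' with hR₁
  set B := Metric.closedBall (0 : ℂ) R₁
  have hsupp' : ∀ w ∉ B, h w = 0 := fun w hw =>
    hsupp w fun hw' => hw (Metric.closedBall_subset_closedBall (le_max_left _ _) hw')
  have hψ' : ∀ z ∉ B, ψ z = 0 := fun z hz => hψR z (by
    rw [mem_closedBall_zero_iff, not_le] at hz
    exact (le_max_right _ _).trans_lt hz)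
  have hmeas : AEStronglyMeasurable (fun p : ℂ × ℂ => h p.2 * cauchyKernel (p.1 - p.2) * ψ p.1)
      ((volume : Measure ℂ).prod volume) :=
    (aestronglyMeasurable_mul_cauchyKernel hint.1).mul
      (hψ.continuous.comp continuous_fst).aestronglyMeasurable
  refine ⟨hmeas, ?_⟩
  rw [HasFiniteIntegral, lintegral_prod_symm _ hmeas.enorm]
  have hinner : ∀ w, ∫⁻ z, ‖h w * cauchyKernel (z - w) * ψ z‖ₑ ≤
      ‖h w‖ₑ * (kernelMass R₁ * ENNReal.ofReal M) := by
    intro w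
    by_cases hw : w ∈ B
    · calc ∫⁻ z, ‖h w * cauchyKernel (z - w) * ψ z‖ₑ
          ≤ ∫⁻ z in B, ‖h w‖ₑ * (‖cauchyKernel (z - w)‖ₑ * ENNReal.ofReal M) := by
            rw [← lintegral_indicator measurableSet_closedBall]
            refine lintegral_mono fun z => ?_
            by_cases hz : z ∈ B
            · rw [indicator_of_mem hz, enorm_mul, enorm_mul, mul_assoc]
              gcongr
              rw [← ofReal_norm]
              exact ENNReal.ofReal_le_ofReal (hM z)
            · simp [hψ' z hz]
        _ ≤ _ := by
            rw [lintegral_const_mul' _ _ (by simp), lintegral_mul_const' _ _ (by simp)]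
            gcongr
            exact lintegral_cauchyKernel_le hw
    · simp [hsupp' w hw]
  refine (lintegral_mono hinner).trans_lt ?_
  rw [lintegral_mul_const' _ _ (ENNReal.mul_lt_top (kernelMass_lt_top _) (by simp)).ne]
  exact ENNReal.mul_lt_top hint.2 (ENNReal.mul_lt_top (kernelMass_lt_top _) (by simp))

/-- Fubini and the oddness of the kernel. The transposition moves weak derivatives of `C h` onto
transforms of test functions, where they can be computed. -/
lemma integral_cauchyTransform_mul {h : ℂ → ℂ} (hint : Integrable h) {R : ℝ}
    (hsupp : ∀ w ∉ Metric.closedBall (0 : ℂ) R, h w = 0) {ψ : ℂ → ℂ} (hψ : IsTest ψ) :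
    ∫ z, cauchyTransform h z * ψ z = -∫ w, h w * cauchyTransform ψ w := by
  have hprod := integrable_prod_cauchyKernel hint hsupp hψ
  have hswap := integral_integral_swap (f := fun z w => h w * cauchyKernel (z - w) * ψ z) hprod
  calc ∫ z, cauchyTransform h z * ψ z = ∫ z, ∫ w, h w * cauchyKernel (z - w) * ψ z := by
        simp_rw [integral_mul_const]
        rfl
    _ = ∫ w, ∫ z, h w * cauchyKernel (z - w) * ψ z := hswap
    _ = ∫ w, -(h w * cauchyTransform ψ w) := by
        refine integral_congr_ae (Eventually.of_forall fun w => ?_)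
        simp only [mul_assoc]
        rw [integral_const_mul, ← mul_neg, cauchyTransform, ← integral_neg]
        congr 2
        ext z
        rw [← neg_sub z w, cauchyKernel_neg]
        ring
    _ = _ := integral_neg _

lemma isWeakDzbar_cauchyTransform {h : ℂ → ℂ} (hint : Integrable h) {R : ℝ}
    (hsupp : ∀ w ∉ Metric.closedBall (0 : ℂ) R, h w = 0) :
    IsWeakDzbar (cauchyTransform h) h := by
  rw [isWeakDzbar_iff]
  intro φ hφ
  rw [integral_cauchyTransform_mul hint hsupp hφ.dzbar, hφ.cauchyTransform_dzbar]

lemma isWeakDz_cauchyTransform {h : ℂ → ℂ} (hh : MemLp h 2) (hint : Integrable h) {R : ℝ}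
    (hsupp : ∀ w ∉ Metric.closedBall (0 : ℂ) R, h w = 0) :
    IsWeakDz (cauchyTransform h) (beurling hh.toLp) := by
  rw [isWeakDz_iff]
  intro φ hφ
  rw [integral_cauchyTransform_mul hint hsupp hφ.dz, integral_beurling_mul _ hφ]
  congr 1
  refine integral_congr_ae ?_
  filter_upwards [hh.coeFn_toLp] with z hz
  rw [hz]

/-! ### Weakly holomorphic functions that decay at infinity -/

lemma norm_dzbar_le (f : ℂ → ℂ) (z : ℂ) : ‖dzbar f z‖ ≤ ‖fderiv ℝ f z‖ := by
  rw [dzbar, norm_mul]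
  have h1 := (fderiv ℝ f z).le_opNorm 1
  have h2 := (fderiv ℝ f z).le_opNorm Complex.I
  rw [norm_one, mul_one] at h1
  rw [Complex.norm_I, mul_one] at h2
  have h3 : ‖fderiv ℝ f z 1 + Complex.I * fderiv ℝ f z Complex.I‖ ≤
      ‖fderiv ℝ f z‖ + ‖fderiv ℝ f z‖ := by
    refine (norm_add_le _ _).trans (add_le_add h1 ?_)
    rwa [norm_mul, Complex.norm_I, one_mul]
  have h4 : ‖(1 / 2 : ℂ)‖ = 1 / 2 := by norm_num
  rw [h4]
  linarith

/-- Smooth cutoff functions equal to one on the disc of radius `r` with gradient `O(1 / r)`. -/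
lemma exists_cutoff : ∃ L : ℝ, 0 ≤ L ∧ ∀ r : ℝ, 0 < r → ∃ χ : ℂ → ℂ, IsTest χ ∧
    (∀ z, ‖z‖ < r → χ z = 1) ∧ (∀ z, 2 * r < ‖z‖ → dzbar χ z = 0) ∧
    (∀ z, ‖z‖ < r → dzbar χ z = 0) ∧ ∀ z, ‖dzbar χ z‖ ≤ L / r := by
  let b : ContDiffBump (0 : ℂ) := ⟨1, 2, one_pos, one_lt_two⟩
  set χ₁ : ℂ → ℂ := fun z => (b z : ℂ) with hχ₁
  have htest : IsTest χ₁ := ⟨Complex.ofRealCLM.contDiff.comp b.contDiff,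
    b.hasCompactSupport.comp_left (g := ((↑) : ℝ → ℂ)) Complex.ofReal_zero⟩
  obtain ⟨L, hL⟩ := (htest.1.continuous_fderiv (by simp)).bounded_above_of_compact_support
    (htest.2.fderiv ℝ)
  refine ⟨L, (norm_nonneg _).trans (hL 0), fun r hr => ?_⟩
  set χ : ℂ → ℂ := fun z => χ₁ (r⁻¹ • z) with hχ
  have hr' : r⁻¹ ≠ 0 := inv_ne_zero hr.ne'
  have hχt : IsTest χ := ⟨htest.1.comp (contDiff_const_smul _), htest.2.comp_smul hr'⟩
  have hnorm : ∀ z : ℂ, ‖r⁻¹ • z‖ = ‖z‖ / r := fun z => by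
    rw [norm_smul, norm_inv, Real.norm_of_nonneg hr.le, inv_mul_eq_div]
  have hone : ∀ z, ‖z‖ < r → χ z = 1 := fun z hz => by
    have : b (r⁻¹ • z) = 1 := b.one_of_mem_closedBall (by
      rw [mem_closedBall_zero_iff, hnorm, div_le_iff₀ hr]
      exact hz.le.trans_eq (one_mul r).symm)
    simp only [hχ, hχ₁, this, Complex.ofReal_one]
  have hzero : ∀ z, 2 * r < ‖z‖ → χ z = 0 := fun z hz => by
    have : b (r⁻¹ • z) = 0 := b.zero_of_le_dist (by
      rw [dist_zero_right, hnorm, le_div_iff₀ hr]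
      exact hz.le)
    simp only [hχ, hχ₁, this, Complex.ofReal_zero]
  have hloc : ∀ z c, (∀ᶠ w in 𝓝 z, χ w = c) → dzbar χ z = 0 := fun z c h => by
    have : χ =ᶠ[𝓝 z] fun _ => c := h
    simp [dzbar, this.fderiv_eq]
  refine ⟨χ, hχt, hone, fun z hz => hloc z 0 ?_, fun z hz => hloc z 1 ?_, fun z => ?_⟩
  · filter_upwards [(isOpen_lt continuous_const continuous_norm).mem_nhds hz] with w hw
    exact hzero w hw
  · filter_upwards [(isOpen_lt continuous_norm continuous_const).mem_nhds hz] with w hw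
    exact hone w hw
  · refine (norm_dzbar_le χ z).trans ?_
    rw [hχ, fderiv_comp_smul, norm_smul, norm_inv, Real.norm_of_nonneg hr.le, inv_mul_eq_div]
    gcongr
    exact hL _

/-- For a general density the integral defining `C h` is only known to converge almost everywhere,
which still gives additivity of `C` on `L²`. Fubini against cutoffs that equal one on growing discs
shows the convergence. -/
lemma ae_integrable_mul_cauchyKernel {h : ℂ → ℂ} (hint : Integrable h) {R : ℝ}
    (hsupp : ∀ w ∉ Metric.closedBall (0 : ℂ) R, h w = 0) :
    ∀ᵐ z, Integrable fun w => h w * cauchyKernel (z - w) := by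
  obtain ⟨L, -, hcut⟩ := exists_cutoff
  choose χ hχ hχ1 using fun n : ℕ => hcut (n + 1) (by positivity)
  have h1 := ae_all_iff.2 fun n => (integrable_prod_cauchyKernel hint hsupp (hχ n)).prod_right_ae
  filter_upwards [h1] with z hz
  obtain ⟨n, hn⟩ := exists_nat_gt ‖z‖
  have h2 := hz n
  rw [(hχ1 n).1 z (hn.trans (lt_add_one _))] at h2
  simpa using h2

/-- A weak Liouville theorem. A test function `ψ` equals `∂̄v` with `v = Cψ`, which is not compactly
supported. Cutting `v` off at radius `r` gives `∫ uψ = -∫ u v ∂̄χ`, supported in `r ≤ ‖z‖ ≤ 2r`.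
There each of `u`, `v`, `∂̄χ` is `O(1/r)` and the area is `O(r²)`, so the integral is `O(1/r)`. -/
lemma ae_eq_zero_of_isWeakDzbar_zero {u : ℂ → ℂ} (hu : LocallyIntegrable u)
    (hw : IsWeakDzbar u 0) (hO : u =O[Bornology.cobounded ℂ] fun z => z⁻¹) :
    u =ᵐ[volume] 0 := by
  refine eq_zero_of_integral_mul_test hu fun ψ hψ => ?_
  obtain ⟨L, hL0, hcut⟩ := exists_cutoff
  obtain ⟨B, hB0, hB⟩ := hψ.exists_norm_cauchyTransform_le
  obtain ⟨C, hC0, hC⟩ := hO.exists_pos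
  obtain ⟨R, hR⟩ : ∃ R : ℝ, ∀ z : ℂ, R ≤ ‖z‖ → ‖u z‖ ≤ C * ‖z⁻¹‖ := by
    have := hC.bound
    rw [← comap_norm_atTop, eventually_comap] at this
    obtain ⟨R, hR⟩ := eventually_atTop.1 this
    exact ⟨R, fun z hz => hR _ hz z rfl⟩
  obtain ⟨R', hR', hψR⟩ := hψ.exists_support_subset_closedBall
  set v := cauchyTransform ψ with hv
  have hvs := hψ.contDiff_cauchyTransform
  -- The area `4πr²` of the disc of radius `2r`, times the pointwise bound `CBL / r³`, is `A / r`.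
  set A := 4 * Real.pi * C * B * L with hA
  have hbound : ∀ r : ℝ, max R R' < r → ‖∫ z, u z * ψ z‖ ≤ A / r := by
    intro r hr
    have hr0 : 0 < r := hR'.trans ((le_max_right _ _).trans_lt hr)
    obtain ⟨χ, hχ, hχ1, hχ0, hχ0', hχL⟩ := hcut r hr0
    have hφ : IsTest fun z => v z * χ z := IsTest.mul_left hvs hχ
    have h0 := isWeakDzbar_iff.1 hw _ hφ
    have h1 : ∀ z, u z * dzbar (fun z => v z * χ z) z =
        u z * ψ z + u z * (v z * dzbar χ z) := fun z => by
      rw [dzbar_mul (hvs.differentiable (by simp) z) (hχ.differentiable z), hv,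
        hψ.dzbar_cauchyTransform_eq]
      rcases lt_or_ge ‖z‖ r with hz | hz
      · rw [hχ1 z hz]; ring
      · rw [hψR z (((le_max_right _ _).trans_lt hr).trans_le hz)]; ring
    simp_rw [h1] at h0
    rw [integral_add (hu.integrable_mul_test hψ)
      (hu.integrable_mul_test (IsTest.mul_left hvs hχ.dzbar))] at h0
    simp only [Pi.zero_apply, zero_mul, integral_zero, neg_zero] at h0
    rw [eq_neg_of_add_eq_zero_left h0, norm_neg]
    have h2 : ∀ z, ‖u z * (v z * dzbar χ z)‖ ≤
        indicator (Metric.closedBall (0 : ℂ) (2 * r)) (fun _ => C * B * L / r ^ 3) z := by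
      intro z
      rcases lt_or_ge (2 * r) ‖z‖ with hz | hz
      · rw [hχ0 z hz]
        simp only [mul_zero, norm_zero]
        exact indicator_nonneg (fun _ _ => by positivity) z
      rw [indicator_of_mem (mem_closedBall_zero_iff.2 hz)]
      rcases lt_or_ge ‖z‖ r with hz' | hz'
      · rw [hχ0' z hz']
        simp only [mul_zero, norm_zero]
        positivity
      · have h3 := hR z (((le_max_left _ _).trans hr.le).trans hz')
        have h4 := hB z
        have h5 := hχL z
        rw [norm_mul, norm_mul]
        rw [norm_inv] at h3
        rw [pow_one] at h4
        have h6 : ‖z‖⁻¹ ≤ r⁻¹ := by gcongr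
        have h7 : (1 + ‖z‖)⁻¹ ≤ r⁻¹ := by gcongr; linarith
        calc ‖u z‖ * (‖v z‖ * ‖dzbar χ z‖) ≤ (C * r⁻¹) * ((B * r⁻¹) * (L / r)) := by
              gcongr
              · exact h3.trans (by gcongr)
              · exact h4.trans (by gcongr)
          _ = _ := by field_simp
    refine (norm_integral_le_of_norm_le ?_ (Eventually.of_forall h2)).trans ?_
    · rw [integrable_indicator_iff measurableSet_closedBall]
      exact integrableOn_const (measure_closedBall_lt_top).ne
    · rw [integral_indicator measurableSet_closedBall, setIntegral_const, measureReal_def,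
        Complex.volume_closedBall]
      simp only [ENNReal.toReal_mul, ENNReal.toReal_pow, smul_eq_mul]
      rw [ENNReal.toReal_ofReal (by positivity)]
      simp only [ENNReal.coe_toReal, NNReal.coe_real_pi]
      rw [hA]
      refine le_of_eq ?_
      field_simp
      ring
  have hlim : Tendsto (fun r : ℝ => A / r) atTop (𝓝 0) := tendsto_const_nhds.div_atTop tendsto_id
  have := ge_of_tendsto hlim ((eventually_gt_atTop _).mono hbound)
  exact norm_le_zero_iff.1 this
end

noncomputable section

/-! ### The Cauchy and Beurling transforms of functions on a bounded set -/

variable {Ω₀ : Set ℂ} {R : ℝ}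

/-- `L²(Ω₀)`. -/
abbrev DensitySpace (Ω₀ : Set ℂ) : Type := Lp ℂ 2 (volume.restrict Ω₀)

lemma memLp_indicator (hΩ₀ : MeasurableSet Ω₀) (h : DensitySpace Ω₀) :
    MemLp (Ω₀.indicator h) 2 :=
  (memLp_indicator_iff_restrict hΩ₀).2 (Lp.memLp h)

lemma indicator_eq_zero_of_notMem_closedBall (hR : Ω₀ ⊆ Metric.closedBall 0 R) (h : ℂ → ℂ) :
    ∀ w ∉ Metric.closedBall (0 : ℂ) R, Ω₀.indicator h w = 0 :=
  fun _ hw => indicator_of_notMem (fun hw' => hw (hR hw')) _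

lemma volume_lt_top_of_subset_closedBall (hR : Ω₀ ⊆ Metric.closedBall 0 R) : volume Ω₀ < ⊤ :=
  (measure_mono hR).trans_lt measure_closedBall_lt_top

lemma isFiniteMeasure_restrict (hR : Ω₀ ⊆ Metric.closedBall 0 R) :
    IsFiniteMeasure (volume.restrict Ω₀) :=
  ⟨by simpa using volume_lt_top_of_subset_closedBall hR⟩

lemma integrable_indicator (hΩ₀ : MeasurableSet Ω₀) (hR : Ω₀ ⊆ Metric.closedBall 0 R)
    (h : DensitySpace Ω₀) : Integrable (Ω₀.indicator h) := by
  have := isFiniteMeasure_restrict hR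
  exact (integrable_indicator_iff hΩ₀).2 ((Lp.memLp h).integrable (by norm_num))

lemma indicator_add_ae_eq (hΩ₀ : MeasurableSet Ω₀) (h₁ h₂ : DensitySpace Ω₀) :
    Ω₀.indicator ⇑(h₁ + h₂) =ᵐ[volume] fun w => Ω₀.indicator h₁ w + Ω₀.indicator h₂ w := by
  refine ((ae_eq_restrict_iff_indicator_ae_eq hΩ₀).1 (Lp.coeFn_add h₁ h₂)).trans ?_
  rw [indicator_add']
  rfl

lemma indicator_smul_ae_eq (hΩ₀ : MeasurableSet Ω₀) (c : ℝ) (h : DensitySpace Ω₀) :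
    Ω₀.indicator ⇑(c • h) =ᵐ[volume] fun w => (c : ℂ) * Ω₀.indicator h w := by
  refine ((ae_eq_restrict_iff_indicator_ae_eq hΩ₀).1 (Lp.coeFn_smul c h)).trans ?_
  refine Eventually.of_forall fun w => ?_
  by_cases hw : w ∈ Ω₀ <;> simp [hw]

/-- The extension by zero `L²(Ω₀) → L²(ℂ)`. -/
def extendL2 (hΩ₀ : MeasurableSet Ω₀) : DensitySpace Ω₀ →L[ℝ] Lp ℂ 2 (volume : Measure ℂ) :=
  LinearMap.mkContinuous
    { toFun := fun h => (memLp_indicator hΩ₀ h).toLp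
      map_add' := fun h₁ h₂ => by
        rw [← MemLp.toLp_add, MemLp.toLp_eq_toLp_iff]
        exact indicator_add_ae_eq hΩ₀ h₁ h₂
      map_smul' := fun c h => by
        rw [RingHom.id_apply, ← MemLp.toLp_const_smul, MemLp.toLp_eq_toLp_iff]
        exact (indicator_smul_ae_eq hΩ₀ c h).trans
          (Eventually.of_forall fun w => (Complex.real_smul).symm) } 1 fun h => by
    rw [one_mul]
    simp only [LinearMap.coe_mk, AddHom.coe_mk, Lp.norm_toLp]
    rw [eLpNorm_indicator_eq_eLpNorm_restrict hΩ₀]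
    exact le_of_eq (Lp.norm_def h).symm

lemma extendL2_apply (hΩ₀ : MeasurableSet Ω₀) (h : DensitySpace Ω₀) :
    extendL2 hΩ₀ h = (memLp_indicator hΩ₀ h).toLp := rfl

lemma cauchyTransform_indicator_add (hΩ₀ : MeasurableSet Ω₀)
    (h₁ h₂ : DensitySpace Ω₀) {z : ℂ}
    (hz₁ : Integrable fun w => Ω₀.indicator h₁ w * cauchyKernel (z - w))
    (hz₂ : Integrable fun w => Ω₀.indicator h₂ w * cauchyKernel (z - w)) :
    cauchyTransform (Ω₀.indicator ⇑(h₁ + h₂)) z =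
      cauchyTransform (Ω₀.indicator h₁) z + cauchyTransform (Ω₀.indicator h₂) z := by
  rw [cauchyTransform_congr_ae (indicator_add_ae_eq hΩ₀ h₁ h₂)]
  simp only [cauchyTransform, add_mul]
  exact integral_add hz₁ hz₂

lemma cauchyTransform_indicator_smul (hΩ₀ : MeasurableSet Ω₀) (c : ℝ) (h : DensitySpace Ω₀)
    (z : ℂ) : cauchyTransform (Ω₀.indicator ⇑(c • h)) z =
      c • cauchyTransform (Ω₀.indicator h) z := by
  rw [cauchyTransform_congr_ae (indicator_smul_ae_eq hΩ₀ c h), cauchyTransform_const_mul,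
    Complex.real_smul]

lemma memLp_cauchyTransform_indicator (hΩ₀ : MeasurableSet Ω₀)
    (hR : Ω₀ ⊆ Metric.closedBall 0 R) {S : Set ℂ} (hS : S ⊆ Metric.closedBall 0 R)
    (h : DensitySpace Ω₀) :
    MemLp (cauchyTransform (Ω₀.indicator h)) 2 (volume.restrict S) :=
  (memLp_cauchyTransform (memLp_indicator hΩ₀ h)
    (indicator_eq_zero_of_notMem_closedBall hR h)).mono_measure (Measure.restrict_mono hS le_rfl)

/-- The Cauchy transform `L²(Ω₀) → L²(S)`, for bounded `Ω₀` and `S`. -/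
def cauchyL2 (hΩ₀ : MeasurableSet Ω₀) (hR : Ω₀ ⊆ Metric.closedBall 0 R) {S : Set ℂ}
    (hS : S ⊆ Metric.closedBall 0 R) : DensitySpace Ω₀ →L[ℝ] Lp ℂ 2 (volume.restrict S) :=
  LinearMap.mkContinuous
    { toFun := fun h => (memLp_cauchyTransform_indicator hΩ₀ hR hS h).toLp
      map_add' := fun h₁ h₂ => by
        rw [← MemLp.toLp_add, MemLp.toLp_eq_toLp_iff]
        refine ae_restrict_of_ae ?_
        filter_upwards [ae_integrable_mul_cauchyKernel (integrable_indicator hΩ₀ hR h₁)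
            (indicator_eq_zero_of_notMem_closedBall hR h₁),
          ae_integrable_mul_cauchyKernel (integrable_indicator hΩ₀ hR h₂)
            (indicator_eq_zero_of_notMem_closedBall hR h₂)] with z hz₁ hz₂
        exact cauchyTransform_indicator_add hΩ₀ h₁ h₂ hz₁ hz₂
      map_smul' := fun c h => by
        rw [RingHom.id_apply, ← MemLp.toLp_const_smul, MemLp.toLp_eq_toLp_iff]
        exact Eventually.of_forall fun z => cauchyTransform_indicator_smul hΩ₀ c h z }
    (kernelMass R).toReal fun h => by
    simp only [LinearMap.coe_mk, AddHom.coe_mk, Lp.norm_toLp]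
    rw [Lp.norm_def, ← ENNReal.toReal_mul]
    refine ENNReal.toReal_mono (ENNReal.mul_lt_top (kernelMass_lt_top R) (Lp.memLp h).2).ne ?_
    rw [← eLpNorm_indicator_eq_eLpNorm_restrict hΩ₀]
    exact (eLpNorm_mono_measure _ (Measure.restrict_mono hS le_rfl)).trans
      (eLpNorm_cauchyTransform_le (memLp_indicator hΩ₀ h).1
        (indicator_eq_zero_of_notMem_closedBall hR h))

lemma coeFn_cauchyL2 (hΩ₀ : MeasurableSet Ω₀) (hR : Ω₀ ⊆ Metric.closedBall 0 R) {S : Set ℂ}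
    (hS : S ⊆ Metric.closedBall 0 R) (h : DensitySpace Ω₀) :
    cauchyL2 hΩ₀ hR hS h =ᵐ[volume.restrict S] cauchyTransform (Ω₀.indicator h) :=
  (memLp_cauchyTransform_indicator hΩ₀ hR hS h).coeFn_toLp

/-! ### The Cauchy transform off the support -/

lemma norm_mul_cauchyKernel_le_of_sep {δ : ℝ} (hδ : 0 < δ) {z : ℂ}
    (hz : ∀ w ∈ Ω₀, δ ≤ ‖z - w‖) (h : ℂ → ℂ) (w : ℂ) :
    ‖Ω₀.indicator h w * cauchyKernel (z - w)‖ ≤ (Real.pi * δ)⁻¹ * ‖Ω₀.indicator h w‖ := by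
  by_cases hw : w ∈ Ω₀
  · rw [norm_mul, mul_comm, norm_cauchyKernel]
    have := hz w hw
    have := Real.pi_pos
    gcongr
  · simp [indicator_of_notMem hw]

lemma integrable_mul_cauchyKernel_of_sep {δ : ℝ} (hδ : 0 < δ) {z : ℂ}
    (hz : ∀ w ∈ Ω₀, δ ≤ ‖z - w‖) {h : ℂ → ℂ} (hint : Integrable (Ω₀.indicator h)) :
    Integrable fun w => Ω₀.indicator h w * cauchyKernel (z - w) :=
  (hint.norm.const_mul (Real.pi * δ)⁻¹).mono' (hint.1.mul (measurable_cauchyKernel.comp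
    (measurable_const.sub measurable_id)).aestronglyMeasurable)
    (Eventually.of_forall (norm_mul_cauchyKernel_le_of_sep hδ hz h))

lemma norm_cauchyTransform_le_of_sep {δ : ℝ} (hδ : 0 < δ) {z : ℂ}
    (hz : ∀ w ∈ Ω₀, δ ≤ ‖z - w‖) {h : ℂ → ℂ} (hint : Integrable (Ω₀.indicator h)) :
    ‖cauchyTransform (Ω₀.indicator h) z‖ ≤ (Real.pi * δ)⁻¹ * ∫ w, ‖Ω₀.indicator h w‖ := by
  rw [← integral_const_mul]
  exact norm_integral_le_of_norm_le (hint.norm.const_mul _)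
    (Eventually.of_forall (norm_mul_cauchyKernel_le_of_sep hδ hz h))

lemma continuousOn_cauchyTransform {h : ℂ → ℂ} (hint : Integrable (Ω₀.indicator h)) :
    ContinuousOn (cauchyTransform (Ω₀.indicator h)) (closure Ω₀)ᶜ := by
  intro z hz
  refine ContinuousAt.continuousWithinAt ?_
  obtain ⟨ε, hε, hball⟩ := Metric.isOpen_iff.1 isClosed_closure.isOpen_compl z hz
  have hsep : ∀ v ∈ Metric.ball z (ε / 2), ∀ w ∈ Ω₀, ε / 2 ≤ ‖v - w‖ := by
    intro v hv w hw
    by_contra! hlt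
    refine hball (show w ∈ Metric.ball z ε from ?_) (subset_closure hw)
    rw [Metric.mem_ball, dist_eq_norm] at hv ⊢
    calc ‖w - z‖ = ‖(v - z) - (v - w)‖ := by ring_nf
      _ ≤ ‖v - z‖ + ‖v - w‖ := norm_sub_le _ _
      _ < ε / 2 + ε / 2 := add_lt_add hv hlt
      _ = ε := add_halves ε
  refine continuousAt_of_dominated
    (bound := fun w => (Real.pi * (ε / 2))⁻¹ * ‖Ω₀.indicator h w‖) ?_ ?_
    (hint.norm.const_mul _) (Eventually.of_forall fun w => ?_)
  · exact Eventually.of_forall fun v => hint.1.mul (measurable_cauchyKernel.comp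
      (measurable_const.sub measurable_id)).aestronglyMeasurable
  · filter_upwards [Metric.ball_mem_nhds z (half_pos hε)] with v hv
    exact Eventually.of_forall (norm_mul_cauchyKernel_le_of_sep (half_pos hε) (hsep v hv) h)
  · by_cases hw : w ∈ Ω₀
    · refine continuousAt_const.mul ?_
      have hne : Real.pi * (z - w) ≠ 0 := by
        refine mul_ne_zero (by exact_mod_cast Real.pi_ne_zero) (sub_ne_zero.2 ?_)
        rintro rfl
        exact hz (subset_closure hw)
      unfold cauchyKernel
      exact ContinuousAt.inv₀ (by fun_prop) hne
    · simp only [indicator_of_notMem hw, zero_mul]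
      exact continuousAt_const

/-- Hölder on a set of finite measure: the exponent `1/2` is `1 - 1/2`. -/
lemma integral_norm_indicator_le (hΩ₀ : MeasurableSet Ω₀) (hR : Ω₀ ⊆ Metric.closedBall 0 R)
    (h : DensitySpace Ω₀) :
    ∫ w, ‖Ω₀.indicator h w‖ ≤ (volume Ω₀ ^ (2⁻¹ : ℝ)).toReal * ‖h‖ := by
  have h1 := integral_norm_eq_lintegral_enorm (integrable_indicator hΩ₀ hR h).1
  rw [h1, ← eLpNorm_one_eq_lintegral_enorm, eLpNorm_indicator_eq_eLpNorm_restrict hΩ₀, mul_comm,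
    Lp.norm_def, ← ENNReal.toReal_mul]
  have hfin : volume Ω₀ ^ (2⁻¹ : ℝ) ≠ ⊤ :=
    ENNReal.rpow_ne_top_of_nonneg (by norm_num) (volume_lt_top_of_subset_closedBall hR).ne
  refine ENNReal.toReal_mono (ENNReal.mul_ne_top (Lp.memLp h).2.ne hfin) ?_
  have h2 := eLpNorm_le_eLpNorm_mul_rpow_measure_univ (p := 1) (q := 2) (by norm_num)
    (Lp.memLp h).1
  convert h2 using 2
  rw [Measure.restrict_apply_univ]
  norm_num

lemma notMem_closure_of_sep {δ : ℝ} (hδ : 0 < δ) {z : ℂ} (hz : ∀ w ∈ Ω₀, δ ≤ ‖z - w‖) :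
    z ∉ closure Ω₀ := by
  intro h
  obtain ⟨w, hw, hlt⟩ := Metric.mem_closure_iff.1 h δ hδ
  rw [dist_eq_norm] at hlt
  exact absurd hlt (not_lt.2 (hz w hw))

/-- The Cauchy transform from `L²(Ω₀)` to continuous functions on a set `T` away from `Ω₀`. -/
def cauchyBdd (hΩ₀ : MeasurableSet Ω₀) (hR : Ω₀ ⊆ Metric.closedBall 0 R) {T : Set ℂ} {δ : ℝ}
    (hδ : 0 < δ) (hT : ∀ z ∈ T, ∀ w ∈ Ω₀, δ ≤ ‖z - w‖) :
    DensitySpace Ω₀ →L[ℝ] BoundedContinuousFunction T ℂ :=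
  have hbound : ∀ (h : DensitySpace Ω₀) (z : T), ‖cauchyTransform (Ω₀.indicator h) z‖ ≤
      (Real.pi * δ)⁻¹ * (volume Ω₀ ^ (2⁻¹ : ℝ)).toReal * ‖h‖ := fun h z => by
    refine (norm_cauchyTransform_le_of_sep hδ (hT z z.2) (integrable_indicator hΩ₀ hR h)).trans ?_
    rw [mul_assoc]
    have := integral_norm_indicator_le hΩ₀ hR h
    have := Real.pi_pos
    gcongr
  LinearMap.mkContinuous
    { toFun := fun h => BoundedContinuousFunction.ofNormedAddCommGroup
        (fun z : T => cauchyTransform (Ω₀.indicator h) z)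
        ((continuousOn_cauchyTransform (integrable_indicator hΩ₀ hR h)).comp_continuous
          continuous_subtype_val fun z => notMem_closure_of_sep hδ (hT z z.2)) _ (hbound h)
      map_add' := fun h₁ h₂ => by
        ext z
        exact cauchyTransform_indicator_add hΩ₀ h₁ h₂
          (integrable_mul_cauchyKernel_of_sep hδ (hT z z.2) (integrable_indicator hΩ₀ hR h₁))
          (integrable_mul_cauchyKernel_of_sep hδ (hT z z.2) (integrable_indicator hΩ₀ hR h₂))
      map_smul' := fun c h => by
        ext z
        exact cauchyTransform_indicator_smul hΩ₀ c h z }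
    ((Real.pi * δ)⁻¹ * (volume Ω₀ ^ (2⁻¹ : ℝ)).toReal) fun h =>
      BoundedContinuousFunction.norm_ofNormedAddCommGroup_le _
        (by have := Real.pi_pos; positivity) (hbound h)

/-! ### The operator of the integral equation -/

/-- The unimodular function `e^{-ikz} conj(e^{ikz})`. -/
def phase (k z : ℂ) : ℂ :=
  Complex.exp (-(Complex.I * k * z)) * conj (Complex.exp (Complex.I * k * z))

lemma continuous_phase (k : ℂ) : Continuous (phase k) := by
  unfold phase
  fun_prop

lemma norm_phase (k z : ℂ) : ‖phase k z‖ = 1 := by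
  rw [phase, norm_mul, RCLike.norm_conj, ← norm_mul, ← Complex.exp_add, neg_add_cancel,
    Complex.exp_zero, norm_one]

lemma memLp_top_phase (k : ℂ) (μ : Measure ℂ) : MemLp (phase k) ⊤ μ :=
  memLp_top_of_bound (continuous_phase k).aestronglyMeasurable 1
    (Eventually.of_forall fun z => (norm_phase k z).le)

/-- Multiplication `L^∞(Ω₀) × L²(Ω₀) → L²(Ω₀)`. -/
def mulL2 (Ω₀ : Set ℂ) : CoeffSpace Ω₀ →L[ℝ] DensitySpace Ω₀ →L[ℝ] DensitySpace Ω₀ :=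
  (ContinuousLinearMap.mul ℝ ℂ).holderL (volume.restrict Ω₀) ⊤ 2 2

lemma coeFn_mulL2 (μ : CoeffSpace Ω₀) (h : DensitySpace Ω₀) :
    mulL2 Ω₀ μ h =ᵐ[volume.restrict Ω₀] fun w => μ w * h w :=
  (ContinuousLinearMap.mul ℝ ℂ).coeFn_holder μ h

lemma memLp_phase_mul (hR : Ω₀ ⊆ Metric.closedBall 0 R) (k c : ℂ) :
    MemLp (fun w => phase k w * c) 2 (volume.restrict Ω₀) :=
  (memL2Loc_of_continuous ((continuous_phase k).mul continuous_const) _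
    (isCompact_closedBall 0 R)).mono_measure (Measure.restrict_mono hR le_rfl)

/-- The inhomogeneous term `e^{-ikz} conj(e^{ikz}) conj(ik)`. -/
def cgoSource (hR : Ω₀ ⊆ Metric.closedBall 0 R) (k : ℂ) : DensitySpace Ω₀ :=
  (memLp_phase_mul hR k (conj (Complex.I * k))).toLp

/-- The operator `h ↦ e^{-ikz} conj(e^{ikz}) conj(ik Ch + Bh)` on `L²(Ω₀)`. -/
def cgoOperator (hΩ₀ : MeasurableSet Ω₀) (hR : Ω₀ ⊆ Metric.closedBall 0 R) (k : ℂ) :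
    DensitySpace Ω₀ →L[ℝ] DensitySpace Ω₀ :=
  (mulL2 Ω₀ (memLp_top_phase k _).toLp) ∘L
    ((Complex.conjCLE : ℂ →L[ℝ] ℂ).compLpL 2 (volume.restrict Ω₀)) ∘L
    (((ContinuousLinearMap.mul ℝ ℂ (Complex.I * k)).compLpL 2 (volume.restrict Ω₀)) ∘L
        cauchyL2 hΩ₀ hR hR +
      LpToLpRestrictCLM ℂ ℂ ℝ volume 2 Ω₀ ∘L beurling ∘L extendL2 hΩ₀)

lemma coeFn_cgoSource (hR : Ω₀ ⊆ Metric.closedBall 0 R) (k : ℂ) :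
    cgoSource hR k =ᵐ[volume.restrict Ω₀] fun w => phase k w * conj (Complex.I * k) :=
  MemLp.coeFn_toLp _

lemma coeFn_cgoOperator (hΩ₀ : MeasurableSet Ω₀) (hR : Ω₀ ⊆ Metric.closedBall 0 R) (k : ℂ)
    (h : DensitySpace Ω₀) :
    cgoOperator hΩ₀ hR k h =ᵐ[volume.restrict Ω₀] fun w => phase k w *
      conj (Complex.I * k * cauchyTransform (Ω₀.indicator h) w + beurling (extendL2 hΩ₀ h) w) := by
  set g₁ := (ContinuousLinearMap.mul ℝ ℂ (Complex.I * k)).compLpL 2 (volume.restrict Ω₀)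
    (cauchyL2 hΩ₀ hR hR h)
  set g₂ := LpToLpRestrictCLM ℂ ℂ ℝ volume 2 Ω₀ (beurling (extendL2 hΩ₀ h))
  filter_upwards [coeFn_mulL2 (memLp_top_phase k (volume.restrict Ω₀)).toLp
      ((Complex.conjCLE : ℂ →L[ℝ] ℂ).compLpL 2 (volume.restrict Ω₀) (g₁ + g₂)),
    (memLp_top_phase k (volume.restrict Ω₀)).coeFn_toLp,
    (Complex.conjCLE : ℂ →L[ℝ] ℂ).coeFn_compLpL (g₁ + g₂), Lp.coeFn_add g₁ g₂,
    (ContinuousLinearMap.mul ℝ ℂ (Complex.I * k)).coeFn_compLpL (cauchyL2 hΩ₀ hR hR h),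
    coeFn_cauchyL2 hΩ₀ hR hR h,
    LpToLpRestrictCLM_coeFn ℝ Ω₀ (beurling (extendL2 hΩ₀ h))] with w h1 h2 h3 h4 h5 h6 h7
  refine h1.trans ?_
  rw [h2, h3, h4, Pi.add_apply, h5, h6, h7]
  rfl
end

noncomputable section

/-! ### Bilinear fixed point equations -/

section FixedPoint

variable {V H : Type*} [NormedAddCommGroup V] [NormedSpace ℝ V] [NormedAddCommGroup H]
  [NormedSpace ℝ H]

lemma eventually_norm_bilin_comp_le (M : V →L[ℝ] H →L[ℝ] H) (A : H →L[ℝ] H) :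
    ∀ᶠ μ in 𝓝 (0 : V), ‖(M μ) ∘L A‖ ≤ 1 / 2 := by
  have h : Tendsto (fun μ => ‖(M μ) ∘L A‖) (𝓝 0) (𝓝 0) := by
    have hc : Continuous fun μ => ‖(M μ) ∘L A‖ := by fun_prop
    have := hc.tendsto 0
    simpa using this
  exact h.eventually (Iic_mem_nhds (by norm_num))

/-- `1 - T` is invertible by the Neumann series. -/
lemma existsUnique_fixedPoint [CompleteSpace H] (T : H →L[ℝ] H) (hT : ‖T‖ ≤ 1 / 2) (b : H) :
    ∃! h, h = b + T h := by
  set u := Units.oneSub T (hT.trans_lt (by norm_num)) with hu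
  have hval : ∀ x, (u : H →L[ℝ] H) x = x - T x := fun x => by simp [hu]
  refine ⟨(↑u⁻¹ : H →L[ℝ] H) b, ?_, fun h hh => ?_⟩
  · have h1 : (u : H →L[ℝ] H) ((↑u⁻¹ : H →L[ℝ] H) b) = b := by
      rw [← mul_apply_eq_comp, Units.mul_inv, one_apply_eq_self]
    rw [hval] at h1
    exact sub_eq_iff_eq_add.1 h1
  · have h1 : (u : H →L[ℝ] H) h = b := by
      rw [hval]
      exact sub_eq_iff_eq_add.2 hh
    rw [← h1, ← mul_apply_eq_comp, Units.inv_mul, one_apply_eq_self]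

/-- The smallness of `M μ ∘ A` gives `‖h‖ ≤ 2‖M μ a‖`, so `h` is of first order in `μ` and the
remainder `M μ (A h)` is of second order. -/
lemma norm_fixedPoint_sub_le (M : V →L[ℝ] H →L[ℝ] H) (A : H →L[ℝ] H) (a : H) {μ : V}
    (hμ : ‖(M μ) ∘L A‖ ≤ 1 / 2) {h : H} (hh : h = M μ a + ((M μ) ∘L A) h) :
    ‖h - M μ a‖ ≤ 2 * ‖M‖ ^ 2 * ‖A‖ * ‖a‖ * ‖μ‖ ^ 2 := by
  have h1 : ‖M μ a‖ ≤ ‖M‖ * ‖μ‖ * ‖a‖ := M.le_opNorm₂ μ a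
  have h2 : ‖h‖ ≤ 2 * ‖M μ a‖ := by
    have h3 : ‖h‖ ≤ ‖M μ a‖ + 1 / 2 * ‖h‖ := by
      conv_lhs => rw [hh]
      refine (norm_add_le _ _).trans ?_
      gcongr
      exact (ContinuousLinearMap.le_opNorm _ _).trans (by gcongr)
    linarith
  have h4 : h - M μ a = M μ (A h) := sub_eq_iff_eq_add'.2 hh
  rw [h4]
  calc ‖M μ (A h)‖ ≤ ‖M‖ * ‖μ‖ * ‖A h‖ := M.le_opNorm₂ μ _
    _ ≤ ‖M‖ * ‖μ‖ * (‖A‖ * (2 * (‖M‖ * ‖μ‖ * ‖a‖))) := by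
        gcongr
        refine (A.le_opNorm h).trans ?_
        gcongr
        exact h2.trans (by gcongr)
    _ = _ := by ring

/-- If `f` maps each small `μ` to `L h`, where `h = M μ (a + A h)`, then `f` is differentiable at
`0` with derivative `μ ↦ L (M μ a)`. -/
lemma hasFDerivAt_of_fixedPoint [CompleteSpace H] {W : Type*} [NormedAddCommGroup W]
    [NormedSpace ℝ W]
    (M : V →L[ℝ] H →L[ℝ] H) (A : H →L[ℝ] H) (a : H) (L : H →L[ℝ] W) (f : V → W)
    (hf : ∀ᶠ μ in 𝓝 (0 : V), ∀ h, h = M μ a + ((M μ) ∘L A) h → f μ = L h) :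
    HasFDerivAt f (L ∘L M.flip a) 0 := by
  have hf0 : f 0 = 0 := by
    have := hf.self_of_nhds 0 (by simp)
    rw [this, map_zero]
  have hO : (fun μ => f μ - (L ∘L M.flip a) μ) =O[𝓝 0] fun μ => ‖μ - 0‖ ^ 2 := by
    refine Asymptotics.IsBigO.of_bound (‖L‖ * (2 * ‖M‖ ^ 2 * ‖A‖ * ‖a‖)) ?_
    filter_upwards [hf, eventually_norm_bilin_comp_le M A] with μ hμ hs
    obtain ⟨h, hh, -⟩ := existsUnique_fixedPoint _ hs (M μ a)
    rw [hμ h hh]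
    simp only [ContinuousLinearMap.comp_apply, ContinuousLinearMap.flip_apply, sub_zero]
    rw [← map_sub, Real.norm_of_nonneg (by positivity), mul_assoc]
    refine (L.le_opNorm _).trans ?_
    gcongr
    exact norm_fixedPoint_sub_le M A a hs hh
  -- A quadratic remainder has derivative zero, so only the linear part remains.
  have h1 := (hO.hasFDerivAt one_lt_two).add (L ∘L M.flip a).hasFDerivAt
  rw [zero_add] at h1
  exact h1.congr_of_eventuallyEq (Eventually.of_forall fun μ => by simp)

end FixedPoint

/-! ### The integral equation for the CGO solutions -/

variable {Ω₀ : Set ℂ} {R : ℝ}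

lemma IsWeakDz.congr_left {f g p : ℂ → ℂ} (hf : IsWeakDz f p) (h : f =ᵐ[volume] g) :
    IsWeakDz g p := by
  intro φ h1 h2
  rw [← hf φ h1 h2]
  refine integral_congr_ae ?_
  filter_upwards [h] with z hz
  rw [hz]

lemma IsWeakDzbar.congr_right {f q r : ℂ → ℂ} (hf : IsWeakDzbar f q) (h : q =ᵐ[volume] r) :
    IsWeakDzbar f r := by
  intro φ h1 h2
  rw [hf φ h1 h2]
  congr 1
  refine integral_congr_ae ?_
  filter_upwards [h] with z hz
  rw [hz]

lemma isBigO_cauchyTransform {h : ℂ → ℂ} (hint : Integrable h)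
    (hsupp : ∀ w ∉ Metric.closedBall (0 : ℂ) R, h w = 0) :
    cauchyTransform h =O[Bornology.cobounded ℂ] fun z => z⁻¹ := by
  refine Asymptotics.IsBigO.of_bound (2 / Real.pi * ∫ w, ‖h w‖) ?_
  have h1 : ∀ᶠ z : ℂ in Bornology.cobounded ℂ, 2 * R ≤ ‖z‖ ∧ 0 < ‖z‖ := by
    rw [← comap_norm_atTop]
    exact ((eventually_ge_atTop (2 * R)).and (eventually_gt_atTop 0)).comap _
  filter_upwards [h1] with z hz
  rw [norm_inv]
  exact norm_cauchyTransform_le hint (fun w hw => hsupp w (by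
    rwa [mem_closedBall_zero_iff, not_le])) hz.1 (norm_pos_iff.1 hz.2)

/-- The trace pair of the Cauchy transform of a density on `Ω₀`. -/
def traceOperator (D : SmoothJordanDomain) (hΩ₀ : MeasurableSet Ω₀)
    (hR : Ω₀ ⊆ Metric.closedBall 0 R) (hD : D.carrier ⊆ Metric.closedBall 0 R) {δ : ℝ}
    (hδ : 0 < δ) (hT : ∀ z ∈ frontier D.carrier, ∀ w ∈ Ω₀, δ ≤ ‖z - w‖) :
    DensitySpace Ω₀ →L[ℝ] TraceSpace D :=
  (cauchyL2 hΩ₀ hR hD).prod (cauchyBdd hΩ₀ hR hδ hT)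

/-- Multiplication by `±μ`. -/
def signedMul (Ω₀ : Set ℂ) (s : ℤˣ) : CoeffSpace Ω₀ →L[ℝ] DensitySpace Ω₀ →L[ℝ] DensitySpace Ω₀ :=
  ((s : ℤ) : ℝ) • mulL2 Ω₀

lemma coeFn_signedMul (s : ℤˣ) (μ : CoeffSpace Ω₀) (h : DensitySpace Ω₀) :
    signedMul Ω₀ s μ h =ᵐ[volume.restrict Ω₀] fun w => ((s : ℤ) : ℂ) * μ w * h w := by
  have h1 : signedMul Ω₀ s μ h = ((s : ℤ) : ℝ) • mulL2 Ω₀ μ h := by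
    simp [signedMul]
  rw [h1]
  filter_upwards [Lp.coeFn_smul ((s : ℤ) : ℝ) (mulL2 Ω₀ μ h), coeFn_mulL2 μ h] with w h2 h3
  rw [h2, Pi.smul_apply, h3, Complex.real_smul, Complex.ofReal_intCast, mul_assoc]

/-- The right-hand form is the Beltrami equation for `e^{ikz}(1 + C h)` divided by `e^{ikz}`, since
`∂̄` gives `e^{ikz} h` and `∂` gives `e^{ikz}(ik(1 + C h) + B h)`. It extends to the plane because
both sides vanish off `Ω₀`. -/
lemma fixedPoint_iff (hΩ₀ : MeasurableSet Ω₀) (hR : Ω₀ ⊆ Metric.closedBall 0 R) (s : ℤˣ) (k : ℂ)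
    (μ : CoeffSpace Ω₀) (h : DensitySpace Ω₀) :
    h = signedMul Ω₀ s μ (cgoSource hR k) + (signedMul Ω₀ s μ ∘L cgoOperator hΩ₀ hR k) h ↔
      Ω₀.indicator h =ᵐ[volume] fun w => signedCoeff Ω₀ s μ w * (phase k w *
        conj (Complex.I * k * (1 + cauchyTransform (Ω₀.indicator h) w) +
          beurling (extendL2 hΩ₀ h) w)) := by
  set F : ℂ → ℂ := fun w => ((s : ℤ) : ℂ) * μ w * (phase k w *
        conj (Complex.I * k * (1 + cauchyTransform (Ω₀.indicator h) w) +
          beurling (extendL2 hΩ₀ h) w)) with hF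
  have h1 : ⇑(signedMul Ω₀ s μ (cgoSource hR k) + (signedMul Ω₀ s μ ∘L cgoOperator hΩ₀ hR k) h)
      =ᵐ[volume.restrict Ω₀] F := by
    filter_upwards [Lp.coeFn_add (signedMul Ω₀ s μ (cgoSource hR k))
        ((signedMul Ω₀ s μ ∘L cgoOperator hΩ₀ hR k) h),
      coeFn_signedMul s μ (cgoSource hR k), coeFn_signedMul s μ (cgoOperator hΩ₀ hR k h),
      coeFn_cgoSource hR k, coeFn_cgoOperator hΩ₀ hR k h] with w h1 h2 h3 h4 h5
    rw [h1, Pi.add_apply, h2, ContinuousLinearMap.comp_apply, h3, h4, h5, hF]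
    simp only [map_add, map_mul, map_one]
    ring
  have h2 : (fun w => signedCoeff Ω₀ s μ w * (phase k w *
        conj (Complex.I * k * (1 + cauchyTransform (Ω₀.indicator h) w) +
          beurling (extendL2 hΩ₀ h) w))) = Ω₀.indicator F := by
    ext w
    by_cases hw : w ∈ Ω₀ <;> simp [signedCoeff, hF, hw]
  rw [h2, ← ae_eq_restrict_iff_indicator_ae_eq hΩ₀, Lp.ext_iff]
  exact ⟨fun h => h.trans h1, fun h => h.trans h1.symm⟩

lemma cexp_mul_phase (k z x : ℂ) :
    Complex.exp (Complex.I * k * z) * (phase k z * conj x) =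
      conj (Complex.exp (Complex.I * k * z) * x) := by
  rw [phase, map_mul, Complex.exp_neg]
  have := Complex.exp_ne_zero (Complex.I * k * z)
  field_simp

lemma isCGO_of_fixedPoint (hΩ₀ : MeasurableSet Ω₀) (hR : Ω₀ ⊆ Metric.closedBall 0 R) (s : ℤˣ)
    (k : ℂ) (μ : CoeffSpace Ω₀) {h : DensitySpace Ω₀}
    (hh : h = signedMul Ω₀ s μ (cgoSource hR k) +
      (signedMul Ω₀ s μ ∘L cgoOperator hΩ₀ hR k) h) :
    IsCGO Ω₀ (signedCoeff Ω₀ s μ) k (cauchyTransform (Ω₀.indicator h)) := by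
  have hmem := memLp_indicator hΩ₀ h
  have hsupp := indicator_eq_zero_of_notMem_closedBall hR h
  have hint := integrable_indicator hΩ₀ hR h
  have hω := memL2Loc_cauchyTransform hmem hsupp
  have hω1 : MemL2Loc fun z => 1 + cauchyTransform (Ω₀.indicator h) z :=
    (memL2Loc_of_continuous continuous_const).add hω
  have hB : MemL2Loc (beurling (extendL2 hΩ₀ h)) := MemLp.memL2Loc (Lp.memLp _)
  have hh' : MemL2Loc (Ω₀.indicator h) := MemLp.memL2Loc hmem
  have h0 : MemL2Loc (0 : ℂ → ℂ) := memL2Loc_of_continuous continuous_const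
  have h1 : MemL2Loc fun _ : ℂ => (1 : ℂ) := memL2Loc_of_continuous continuous_const
  have hdz := (isWeakDz_const 1).add (isWeakDz_cauchyTransform hmem hint hsupp)
    h1.locallyIntegrable hω.locallyIntegrable h0.locallyIntegrable hB.locallyIntegrable
  have hdzbar := (isWeakDzbar_const 1).add (isWeakDzbar_cauchyTransform hint hsupp)
    h1.locallyIntegrable hω.locallyIntegrable h0.locallyIntegrable hh'.locallyIntegrable
  have hexp : Continuous fun z => Complex.exp (Complex.I * k * z) := by fun_prop
  refine ⟨⟨_, _, hω1.continuous_mul hexp, ?_, ?_,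
    hdz.cexp_mul hω1.locallyIntegrable (h0.add hB).locallyIntegrable (Complex.I * k),
    hdzbar.cexp_mul (Complex.I * k), ?_⟩, isBigO_cauchyTransform hint hsupp,
    continuousOn_cauchyTransform hint⟩
  · exact ((h0.add hB).add (hω1.continuous_mul
      (g := fun _ => Complex.I * k) continuous_const)).continuous_mul hexp
  · exact (h0.add hh').continuous_mul hexp
  · filter_upwards [(fixedPoint_iff hΩ₀ hR s k μ h).1 hh] with z hz
    rw [Pi.zero_apply, zero_add, zero_add, ← cexp_mul_phase, hz]
    rw [← extendL2_apply hΩ₀ h, add_comm (beurling (extendL2 hΩ₀ h) z)]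
    ring

/-- Uniqueness is used twice. The Liouville theorem forces `ω` to be the Cauchy transform of its own
`∂̄`-derivative, and uniqueness of weak derivatives then forces `∂ω` to be the Beurling transform.
-/
lemma exists_fixedPoint_of_isCGO (hΩ₀ : MeasurableSet Ω₀) (hR : Ω₀ ⊆ Metric.closedBall 0 R)
    (s : ℤˣ) (k : ℂ) (μ : CoeffSpace Ω₀) {ω : ℂ → ℂ}
    (hω : IsCGO Ω₀ (signedCoeff Ω₀ s μ) k ω) :
    ∃ h : DensitySpace Ω₀, h = signedMul Ω₀ s μ (cgoSource hR k) +
      (signedMul Ω₀ s μ ∘L cgoOperator hΩ₀ hR k) h ∧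
      ω =ᵐ[volume] cauchyTransform (Ω₀.indicator h) := by
  obtain ⟨⟨p, q, hfl, hpl, hql, hfp, hfq, hpq⟩, hO, -⟩ := hω
  set a := Complex.I * k with ha
  have hexp : Continuous fun z => Complex.exp (a * z) := by fun_prop
  have hexp' : Continuous fun z => Complex.exp (-a * z) := by fun_prop
  have hcancel : ∀ z, Complex.exp (-a * z) * Complex.exp (a * z) = 1 := fun z => by
    rw [← Complex.exp_add, neg_mul, neg_add_cancel, Complex.exp_zero]
  have hback : (fun z => Complex.exp (-a * z) * (Complex.exp (a * z) * (1 + ω z))) =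
      fun z => 1 + ω z := by
    ext z
    rw [← mul_assoc, hcancel, one_mul]
  -- `g` is `∂̄ω`. By the equation it vanishes where the coefficient does, so it is the extension by
  -- zero of an element of `L²(Ω₀)`.
  set g : ℂ → ℂ := fun z => Complex.exp (-a * z) * q z with hg
  have hgl : MemL2Loc g := hql.continuous_mul hexp'
  have hgD : MemLp g 2 (volume.restrict Ω₀) :=
    (hgl _ (isCompact_closedBall 0 R)).mono_measure (Measure.restrict_mono hR le_rfl)
  set h : DensitySpace Ω₀ := hgD.toLp with hh
  have hgh : g =ᵐ[volume] Ω₀.indicator h := by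
    have h1 := (ae_eq_restrict_iff_indicator_ae_eq hΩ₀).1 hgD.coeFn_toLp
    filter_upwards [h1, hpq] with z hz hz'
    rw [hz]
    by_cases hzΩ : z ∈ Ω₀
    · rw [indicator_of_mem hzΩ]
    · rw [indicator_of_notMem hzΩ, hg]
      simp only
      rw [hz', signedCoeff, indicator_of_notMem hzΩ, zero_mul, mul_zero]
  have hmem := memLp_indicator hΩ₀ h
  have hsupp := indicator_eq_zero_of_notMem_closedBall hR h
  have hint := integrable_indicator hΩ₀ hR h
  have hCl := memL2Loc_cauchyTransform hmem hsupp
  have hB : MemL2Loc (beurling (extendL2 hΩ₀ h)) := MemLp.memL2Loc (Lp.memLp _)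
  have h0 : MemL2Loc (0 : ℂ → ℂ) := memL2Loc_of_continuous continuous_const
  have hc : ∀ c : ℂ, MemL2Loc fun _ : ℂ => c := fun c => memL2Loc_of_continuous continuous_const
  have hω1 : MemL2Loc fun z => 1 + ω z := by
    rw [← hback]
    exact hfl.continuous_mul hexp'
  have hωl : MemL2Loc ω := by
    have := (hc (-1)).add hω1
    simpa using this
  have hdzbar : IsWeakDzbar ω (Ω₀.indicator h) := by
    have h1 := hfq.cexp_mul (-a)
    rw [hback] at h1
    have h2 := (isWeakDzbar_const (-1)).add (h1.congr_right hgh) (hc (-1)).locallyIntegrable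
      hω1.locallyIntegrable h0.locallyIntegrable
      ((MemLp.memL2Loc hmem).locallyIntegrable)
    simpa using h2
  have hCneg : MemL2Loc fun z => -1 * cauchyTransform (Ω₀.indicator h) z :=
    hCl.continuous_mul (g := fun _ => -1) continuous_const
  have hωC : ω =ᵐ[volume] cauchyTransform (Ω₀.indicator h) := by
    have h1 := hdzbar.add ((isWeakDzbar_cauchyTransform hint hsupp).const_mul (-1))
      hωl.locallyIntegrable hCneg.locallyIntegrable (MemLp.memL2Loc hmem).locallyIntegrable
      ((MemLp.memL2Loc hmem).continuous_mul (g := fun _ => -1) continuous_const).locallyIntegrable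
    have h2 : (fun z => Ω₀.indicator h z + -1 * Ω₀.indicator h z) = 0 := by
      ext z
      simp
    rw [h2] at h1
    have h3 := ae_eq_zero_of_isWeakDzbar_zero (hωl.add hCneg).locallyIntegrable h1
      (hO.add ((isBigO_cauchyTransform hint hsupp).const_mul_left (-1)))
    filter_upwards [h3] with z hz
    have hz' : ω z + -1 * cauchyTransform (Ω₀.indicator h) z = 0 := hz
    linear_combination hz'
  -- Both sides are weak `∂`-derivatives of `1 + ω`: the left by the product rule applied to
  -- `e^{-az} f`, the right through `ω = C h`.
  have hpB : (fun z => Complex.exp (-a * z) * (p z + -a * (Complex.exp (a * z) * (1 + ω z))))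
      =ᵐ[volume] beurling (extendL2 hΩ₀ h) := by
    have h1 := hfp.cexp_mul hfl.locallyIntegrable hpl.locallyIntegrable (-a)
    rw [hback] at h1
    have h2 := (isWeakDz_const 1).add
      ((isWeakDz_cauchyTransform hmem hint hsupp).congr_left hωC.symm)
      (hc 1).locallyIntegrable hωl.locallyIntegrable h0.locallyIntegrable hB.locallyIntegrable
    have h3 := h1.ae_eq h2 ((hpl.add (hfl.continuous_mul (g := fun _ => -a)
      continuous_const)).continuous_mul hexp').locallyIntegrable (h0.add hB).locallyIntegrable
    filter_upwards [h3] with z hz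
    rw [hz, Pi.zero_apply, zero_add]
    rfl
  refine ⟨h, (fixedPoint_iff hΩ₀ hR s k μ h).2 ?_, hωC⟩
  filter_upwards [hgh, hωC, hpB, hpq] with z h1 h2 h3 h4
  have h5 : p z = Complex.exp (a * z) * (a * (1 + ω z) + beurling (extendL2 hΩ₀ h) z) := by
    rw [← h3]
    linear_combination (a * Complex.exp (a * z) * (1 + ω z) - p z) * hcancel z
  rw [← h1, ← h2, hg]
  simp only
  rw [h4, h5, ← cexp_mul_phase, ← ha]
  linear_combination (signedCoeff Ω₀ s μ z * (phase k z *
    conj (a * (1 + ω z) + beurling (extendL2 hΩ₀ h) z))) * hcancel z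

lemma isCGOTrace_iff (D : SmoothJordanDomain) (hΩ₀ : MeasurableSet Ω₀)
    (hR : Ω₀ ⊆ Metric.closedBall 0 R) (hD : D.carrier ⊆ Metric.closedBall 0 R) {δ : ℝ} (hδ : 0 < δ)
    (hT : ∀ z ∈ frontier D.carrier, ∀ w ∈ Ω₀, δ ≤ ‖z - w‖) (s : ℤˣ) (k : ℂ)
    (μ : CoeffSpace Ω₀) (y : TraceSpace D) :
    IsCGOTrace D Ω₀ s k μ y ↔ ∃ h : DensitySpace Ω₀,
      h = signedMul Ω₀ s μ (cgoSource hR k) + (signedMul Ω₀ s μ ∘L cgoOperator hΩ₀ hR k) h ∧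
        y = traceOperator D hΩ₀ hR hD hδ hT h := by
  constructor
  · rintro ⟨ω, hω, hy1, hy2⟩
    obtain ⟨h, hh, hωh⟩ := exists_fixedPoint_of_isCGO hΩ₀ hR s k μ hω
    refine ⟨h, hh, Prod.ext (Lp.ext ?_) (BoundedContinuousFunction.ext fun z => ?_)⟩
    · filter_upwards [hy1, ae_restrict_of_ae hωh, coeFn_cauchyL2 hΩ₀ hR hD h] with z h1 h2 h3
      rw [h1, h2]
      exact h3.symm
    · rw [hy2 z]
      -- Two functions continuous on the open complement of `closure Ω₀` that agree almost
      -- everywhere there agree everywhere there, in particular on the boundary curve.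
      exact Measure.eqOn_open_of_ae_eq (ae_restrict_of_ae hωh) isClosed_closure.isOpen_compl hω.2.2
        (continuousOn_cauchyTransform (integrable_indicator hΩ₀ hR h))
        (notMem_closure_of_sep hδ (hT z z.2))
  · rintro ⟨h, hh, rfl⟩
    exact ⟨_, isCGO_of_fixedPoint hΩ₀ hR s k μ hh, coeFn_cauchyL2 hΩ₀ hR hD h, fun z => rfl⟩

lemma eventually_existsUnique_isCGOTrace (D : SmoothJordanDomain) (hΩ₀ : MeasurableSet Ω₀)
    (hR : Ω₀ ⊆ Metric.closedBall 0 R) (hD : D.carrier ⊆ Metric.closedBall 0 R) {δ : ℝ} (hδ : 0 < δ)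
    (hT : ∀ z ∈ frontier D.carrier, ∀ w ∈ Ω₀, δ ≤ ‖z - w‖) (s : ℤˣ) (k : ℂ) :
    ∀ᶠ μ : CoeffSpace Ω₀ in 𝓝 0, ∃! y, IsCGOTrace D Ω₀ s k μ y := by
  filter_upwards [eventually_norm_bilin_comp_le (signedMul Ω₀ s) (cgoOperator hΩ₀ hR k)] with μ hμ
  obtain ⟨h, hh, huniq⟩ := existsUnique_fixedPoint _ hμ (signedMul Ω₀ s μ (cgoSource hR k))
  simp_rw [isCGOTrace_iff D hΩ₀ hR hD hδ hT s k μ]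
  refine ⟨_, ⟨h, hh, rfl⟩, ?_⟩
  rintro y ⟨h', hh', rfl⟩
  rw [huniq h' hh']

/-- `cgoMap` picks a trace by choice. For small `μ` the trace is unique, so the choice is the trace
operator applied to the fixed point, and the abstract differentiation lemma applies. -/
lemma hasFDerivAt_cgoMap (D : SmoothJordanDomain) (hΩ₀ : MeasurableSet Ω₀)
    (hR : Ω₀ ⊆ Metric.closedBall 0 R) (hD : D.carrier ⊆ Metric.closedBall 0 R) {δ : ℝ} (hδ : 0 < δ)
    (hT : ∀ z ∈ frontier D.carrier, ∀ w ∈ Ω₀, δ ≤ ‖z - w‖) (s : ℤˣ) (k : ℂ) :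
    HasFDerivAt (cgoMap D Ω₀ s k) (traceOperator D hΩ₀ hR hD hδ hT ∘L
      (signedMul Ω₀ s).flip (cgoSource hR k)) 0 := by
  refine hasFDerivAt_of_fixedPoint _ (cgoOperator hΩ₀ hR k) _ _ _ ?_
  filter_upwards [eventually_existsUnique_isCGOTrace D hΩ₀ hR hD hδ hT s k] with μ hμ h hh
  have hy : IsCGOTrace D Ω₀ s k μ (traceOperator D hΩ₀ hR hD hδ hT h) :=
    (isCGOTrace_iff D hΩ₀ hR hD hδ hT s k μ _).2 ⟨h, hh, rfl⟩
  have hex : ∃ y, IsCGOTrace D Ω₀ s k μ y := ⟨_, hy⟩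
  rw [cgoMap, dif_pos hex]
  exact hμ.unique hex.choose_spec hy

lemma firstTerm_eq (D : SmoothJordanDomain) (hΩ₀ : MeasurableSet Ω₀)
    (hR : Ω₀ ⊆ Metric.closedBall 0 R) (hD : D.carrier ⊆ Metric.closedBall 0 R) {δ : ℝ} (hδ : 0 < δ)
    (hT : ∀ z ∈ frontier D.carrier, ∀ w ∈ Ω₀, δ ≤ ‖z - w‖) (s : ℤˣ) (k : ℂ)
    (μ : CoeffSpace Ω₀) (z : frontier D.carrier) :
    firstTerm D Ω₀ s μ k z = cauchyTransform (Ω₀.indicator fun w =>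
      ((s : ℤ) : ℂ) * μ w * (phase k w * conj (Complex.I * k))) z := by
  rw [firstTerm, (hasFDerivAt_cgoMap D hΩ₀ hR hD hδ hT s k).fderiv]
  change cauchyTransform (Ω₀.indicator (signedMul Ω₀ s μ (cgoSource hR k))) z = _
  refine congrFun (cauchyTransform_congr_ae
    ((ae_eq_restrict_iff_indicator_ae_eq hΩ₀).1 ?_)) _
  filter_upwards [coeFn_signedMul s μ (cgoSource hR k), coeFn_cgoSource hR k] with w h1 h2
  rw [h1, h2]

/-- The compact set `closure Ω₀` has a uniform thickening inside the open domain, which keeps the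
boundary at distance `δ`. -/
lemma SmoothJordanDomain.exists_geometry (D : SmoothJordanDomain) (hΩ₀D : closure Ω₀ ⊆ D.carrier) :
    ∃ R : ℝ, ∃ δ : ℝ, 0 < δ ∧ Ω₀ ⊆ Metric.closedBall 0 R ∧ D.carrier ⊆ Metric.closedBall 0 R ∧
      ∀ z ∈ frontier D.carrier, ∀ w ∈ Ω₀, δ ≤ ‖z - w‖ := by
  obtain ⟨R, hR⟩ := D.isBounded.subset_closedBall 0
  have hcomp : IsCompact (closure Ω₀) :=
    Metric.isCompact_of_isClosed_isBounded isClosed_closure (D.isBounded.subset hΩ₀D)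
  obtain ⟨δ, hδ, hthick⟩ := hcomp.exists_thickening_subset_open D.isOpen hΩ₀D
  refine ⟨R, δ, hδ, subset_closure.trans (hΩ₀D.trans hR), hR, fun z hz w hw => ?_⟩
  by_contra! hlt
  rw [D.isOpen.frontier_eq] at hz
  refine hz.2 (hthick (Metric.mem_thickening_iff.2 ⟨w, subset_closure hw, ?_⟩))
  rwa [dist_eq_norm]
end

noncomputable section

/-! ### Boundary averages of Cauchy transforms -/

namespace SmoothJordanDomain

lemma γ_mem_frontier (D : SmoothJordanDomain) (x : ℝ) : D.γ x ∈ frontier D.carrier :=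
  D.range_eq ▸ mem_range_self x

lemma integral_deriv_mul_cauchyKernel (D : SmoothJordanDomain) {w : ℂ} (hw : w ∈ D.carrier) :
    ∫ x in (0 : ℝ)..1, deriv D.γ x * cauchyKernel (D.γ x - w) = 2 * Complex.I := by
  have hpi : (Real.pi : ℂ) ≠ 0 := by exact_mod_cast Real.pi_ne_zero
  have h1 : ∀ x, deriv D.γ x * cauchyKernel (D.γ x - w) =
      (Real.pi : ℂ)⁻¹ * (deriv D.γ x * (D.γ x - w)⁻¹) := fun x => by
    rw [cauchyKernel, mul_inv]
    ring
  simp_rw [h1]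
  rw [intervalIntegral.integral_const_mul]
  change (Real.pi : ℂ)⁻¹ * D.windingIntegral w = _
  rw [D.windingIntegral_eq hw]
  field_simp

lemma continuous_contourIntegrand_cauchyTransform {Ω₀ : Set ℂ} {δ : ℝ} (D : SmoothJordanDomain) (hδ : 0 < δ)
    (hT : ∀ z ∈ frontier D.carrier, ∀ w ∈ Ω₀, δ ≤ ‖z - w‖) {h : ℂ → ℂ}
    (hint : Integrable (Ω₀.indicator h)) :
    Continuous (D.contourIntegrand fun z => cauchyTransform (Ω₀.indicator h) z) := by
  refine Continuous.mul ?_ D.continuous_deriv_γ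
  exact (continuousOn_cauchyTransform hint).comp_continuous D.smooth.continuous
    fun x => notMem_closure_of_sep hδ (hT _ (D.γ_mem_frontier x))

/-- By Fubini every `w ∈ Ω₀` contributes the contour integral of its kernel, which is `π⁻¹` times
the winding integral `2πi`. Fubini is harmless because the kernel is bounded by `(πδ)⁻¹` on the
boundary. -/
lemma contourIntegral_cauchyTransform {Ω₀ : Set ℂ} {δ : ℝ} (D : SmoothJordanDomain) (hδ : 0 < δ)
    (hT : ∀ z ∈ frontier D.carrier, ∀ w ∈ Ω₀, δ ≤ ‖z - w‖) (hΩ₀D : Ω₀ ⊆ D.carrier) {h : ℂ → ℂ}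
    (hint : Integrable (Ω₀.indicator h)) :
    D.contourIntegral (fun z => cauchyTransform (Ω₀.indicator h) z) =
      2 * Complex.I * ∫ w, Ω₀.indicator h w := by
  have hγ' : Integrable (deriv D.γ) (volume.restrict (uIoc (0 : ℝ) 1)) :=
    intervalIntegrable_iff.1 (D.continuous_deriv_γ.intervalIntegrable 0 1)
  have hprod : Integrable (fun p : ℝ × ℂ => Ω₀.indicator h p.2 * cauchyKernel (D.γ p.1 - p.2) *
      deriv D.γ p.1) ((volume.restrict (uIoc (0 : ℝ) 1)).prod volume) := by
    have hm : AEStronglyMeasurable (fun p : ℝ × ℂ => Ω₀.indicator h p.2)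
        ((volume.restrict (uIoc (0 : ℝ) 1)).prod volume) :=
      hint.aestronglyMeasurable.comp_snd
    have hk : Measurable fun p : ℝ × ℂ => cauchyKernel (D.γ p.1 - p.2) :=
      measurable_cauchyKernel.comp
        ((D.smooth.continuous.measurable.comp measurable_fst).sub measurable_snd)
    refine (hγ'.mul_prod (hint.const_mul (((Real.pi * δ)⁻¹ : ℝ) : ℂ))).mono
      ((hm.mul hk.aestronglyMeasurable).mul
        (D.continuous_deriv_γ.measurable.comp measurable_fst).aestronglyMeasurable)
      (ae_of_all _ fun p => ?_)
    rw [norm_mul, mul_comm, norm_mul (deriv D.γ p.1), norm_mul ((_ : ℝ) : ℂ), Complex.norm_real,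
      Real.norm_of_nonneg (by positivity)]
    exact mul_le_mul_of_nonneg_left (norm_mul_cauchyKernel_le_of_sep hδ
      (hT _ (D.γ_mem_frontier p.1)) h p.2) (norm_nonneg _)
  have h1 : ∀ x, D.contourIntegrand (fun z => cauchyTransform (Ω₀.indicator h) z) x =
      ∫ w, Ω₀.indicator h w * cauchyKernel (D.γ x - w) * deriv D.γ x := fun x => by
    rw [integral_mul_const]
    rfl
  rw [contourIntegral]
  simp_rw [h1]
  rw [intervalIntegral_integral_swap hprod, ← integral_const_mul]
  refine integral_congr_ae (ae_of_all _ fun w => ?_)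
  by_cases hw : w ∈ Ω₀
  · have h2 : ∀ x, Ω₀.indicator h w * cauchyKernel (D.γ x - w) * deriv D.γ x =
        Ω₀.indicator h w * (deriv D.γ x * cauchyKernel (D.γ x - w)) := fun x => by ring
    simp_rw [h2]
    rw [intervalIntegral.integral_const_mul, D.integral_deriv_mul_cauchyKernel (hΩ₀D hw), mul_comm]
  · simp [indicator_of_notMem hw]

end SmoothJordanDomain

/-! ### The phase transform -/

/-- The integral of a density against the phases `exp (-2i Re (k w))`. -/
def phaseTransform (f : ℂ → ℂ) (k : ℂ) : ℂ := ∫ w, f w * phase k w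

lemma continuous_phase_uncurry : Continuous fun p : ℂ × ℂ => phase p.1 p.2 := by
  unfold phase
  fun_prop

lemma norm_phaseTransform_le (f : ℂ → ℂ) (k : ℂ) : ‖phaseTransform f k‖ ≤ ∫ w, ‖f w‖ := by
  refine (norm_integral_le_integral_norm _).trans_eq (integral_congr_ae (ae_of_all _ fun w => ?_))
  simp only [norm_mul, norm_phase, mul_one]

lemma continuous_phaseTransform {f : ℂ → ℂ} (hf : Integrable f) :
    Continuous (phaseTransform f) := by
  refine continuous_of_dominated (bound := fun w => ‖f w‖) (fun k => ?_) (fun k => ?_) hf.norm ?_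
  · exact hf.aestronglyMeasurable.mul (continuous_phase k).aestronglyMeasurable
  · exact ae_of_all _ fun w => by rw [norm_mul, norm_phase, mul_one]
  · exact ae_of_all _ fun w => continuous_const.mul
      (continuous_phase_uncurry.comp (continuous_id.prodMk continuous_const))

lemma integral_phaseTransform_line_mul {f : ℂ → ℂ} (hf : Integrable f) {β : ℝ → ℂ}
    (hβ : Integrable β) (e : ℂ) :
    ∫ τ : ℝ, phaseTransform f (τ * e) * β τ = ∫ w, f w * ∫ τ : ℝ, phase (τ * e) w * β τ := by
  have hprod : Integrable (fun p : ℝ × ℂ => f p.2 * phase (p.1 * e) p.2 * β p.1)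
      (volume.prod volume) := by
    have hph : Continuous fun p : ℝ × ℂ => phase (p.1 * e) p.2 :=
      continuous_phase_uncurry.comp (f := fun p : ℝ × ℂ => ((p.1 : ℂ) * e, p.2)) (by fun_prop)
    refine (hβ.mul_prod hf).mono ((hf.aestronglyMeasurable.comp_snd.mul
      hph.aestronglyMeasurable).mul hβ.aestronglyMeasurable.comp_fst) (ae_of_all _ fun p => ?_)
    rw [norm_mul, norm_mul, norm_phase, mul_one, norm_mul, mul_comm]
  calc ∫ τ : ℝ, phaseTransform f (τ * e) * β τ
      = ∫ τ : ℝ, ∫ w, f w * phase (τ * e) w * β τ := by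
        refine integral_congr_ae (ae_of_all _ fun τ => ?_)
        simp only
        rw [integral_mul_const]
        rfl
    _ = ∫ w, ∫ τ : ℝ, f w * phase (τ * e) w * β τ := integral_integral_swap hprod
    _ = _ := by
        refine integral_congr_ae (ae_of_all _ fun w => ?_)
        simp only
        rw [← integral_const_mul]
        simp_rw [mul_assoc]

/-- The symbol of the averaged first scattering term as a function of `k = τ e`. -/
def symbol (s : ℤˣ) (f : ℂ → ℂ) (k : ℂ) : ℂ :=
  ((s : ℤ) : ℂ) / Real.pi * conj (Complex.I * k) * phaseTransform f k

/-! ### The Fourier transform on the line -/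

/-- The transform `fourierLine` as an operator on Schwartz functions. -/
def fourierLineCLM : 𝓢(ℝ, ℂ) →L[ℂ] 𝓢(ℝ, ℂ) :=
  (SchwartzMap.compCLMOfContinuousLinearEquiv ℂ (ContinuousLinearEquiv.unitsEquivAut ℝ
    (Units.mk0 (2 * Real.pi)⁻¹ (by positivity)))) ∘L (FourierTransform.fourierCLM ℂ 𝓢(ℝ, ℂ))

open scoped FourierTransform in
lemma fourierLine_eq_fourier (g : ℝ → ℂ) (τ : ℝ) : fourierLine g τ = 𝓕 g (τ * (2 * Real.pi)⁻¹) := by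
  rw [Real.fourier_real_eq_integral_exp_smul, fourierLine]
  refine integral_congr_ae (ae_of_all _ fun t => ?_)
  simp only [smul_eq_mul]
  congr 2
  push_cast
  field_simp

lemma fourierLineCLM_apply (g : 𝓢(ℝ, ℂ)) (τ : ℝ) : fourierLineCLM g τ = fourierLine g τ := by
  rw [fourierLine_eq_fourier]
  simp [fourierLineCLM, SchwartzMap.fourier_coe]

lemma coe_fourierLineCLM (g : 𝓢(ℝ, ℂ)) : ⇑(fourierLineCLM g) = fourierLine g :=
  funext (fourierLineCLM_apply g)

lemma integrable_mul_fourierLine (g : 𝓢(ℝ, ℂ)) : Integrable fun τ : ℝ => (τ : ℂ) * fourierLine g τ := by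
  rw [← coe_fourierLineCLM]
  have := (SchwartzMap.smulLeftCLM ℂ (fun τ : ℝ => (τ : ℂ)) (fourierLineCLM g)).integrable (μ := volume)
  refine this.congr (ae_of_all _ fun τ => ?_)
  rw [SchwartzMap.smulLeftCLM_apply_apply (by fun_prop)]
  rfl

end

noncomputable section

/-! ### The averaged first scattering term in terms of its symbol -/

lemma integrable_indicator_coeff {Ω₀ : Set ℂ} {R : ℝ} (hΩ₀ : MeasurableSet Ω₀)
    (hR : Ω₀ ⊆ Metric.closedBall 0 R) (μ : CoeffSpace Ω₀) : Integrable (Ω₀.indicator μ) := by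
  have := isFiniteMeasure_restrict hR
  exact (integrable_indicator_iff hΩ₀).2 ((Lp.memLp μ).integrable le_top)

/-- The density of the phases against a function on the line of direction `e`. -/
def phaseAverage (β : ℝ → ℂ) (e w : ℂ) : ℂ := ∫ τ : ℝ, phase (τ * e) w * β τ

lemma norm_phaseAverage_le (β : ℝ → ℂ) (e w : ℂ) : ‖phaseAverage β e w‖ ≤ ∫ τ, ‖β τ‖ := by
  refine (norm_integral_le_integral_norm _).trans_eq (integral_congr_ae (ae_of_all _ fun τ => ?_))
  simp only [norm_mul, norm_phase, one_mul]

lemma continuous_phaseAverage {β : ℝ → ℂ} (hβ : Integrable β) (e : ℂ) :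
    Continuous (phaseAverage β e) := by
  refine continuous_of_dominated (bound := fun τ => ‖β τ‖) (fun w => ?_) (fun w => ?_) hβ.norm ?_
  · have hph : Continuous fun τ : ℝ => phase (τ * e) w :=
      continuous_phase_uncurry.comp (f := fun τ : ℝ => ((τ : ℂ) * e, w)) (by fun_prop)
    exact hph.aestronglyMeasurable.mul hβ.aestronglyMeasurable
  · exact ae_of_all _ fun τ => by rw [norm_mul, norm_phase, one_mul]
  · exact ae_of_all _ fun τ => (continuous_phase _).mul continuous_const

lemma indicator_mul_apply {Ω₀ : Set ℂ} (f g : ℂ → ℂ) (w : ℂ) :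
    Ω₀.indicator (fun w => f w * g w) w = Ω₀.indicator f w * g w := by
  by_cases hw : w ∈ Ω₀ <;> simp [hw]

/-- The function paired with the phase transform of `μ` in the averaged first term. -/
def lineSymbol (s : ℤˣ) (e : ℂ) (g : ℝ → ℂ) (τ : ℝ) : ℂ :=
  ((s : ℤ) : ℂ) * conj (Complex.I * (τ * e)) * fourierLine g τ

lemma integrable_lineSymbol (s : ℤˣ) (e : ℂ) (g : 𝓢(ℝ, ℂ)) : Integrable (lineSymbol s e g) := by
  refine ((integrable_mul_fourierLine g).const_mul (((s : ℤ) : ℂ) * conj (Complex.I * e))).congr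
    (ae_of_all _ fun τ => ?_)
  simp only [lineSymbol, map_mul, Complex.conj_ofReal]
  ring

/-- The unbounded factor `conj(ik)` is moved onto the rapidly decreasing `fourierLine g`; what
remains is bounded in `τ`. -/
lemma pairingIntegrand_eq {Ω₀ : Set ℂ} {R δ : ℝ} (D : SmoothJordanDomain) (hΩ₀ : MeasurableSet Ω₀)
    (hR : Ω₀ ⊆ Metric.closedBall 0 R) (hD : D.carrier ⊆ Metric.closedBall 0 R) (hδ : 0 < δ)
    (hT : ∀ z ∈ frontier D.carrier, ∀ w ∈ Ω₀, δ ≤ ‖z - w‖) (s : ℤˣ) (μ : CoeffSpace Ω₀)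
    (e : Circle) (g : 𝓢(ℝ, ℂ)) (z : frontier D.carrier) (τ : ℝ) :
    pairingIntegrand D Ω₀ s μ e g z τ =
      phaseTransform (fun w => Ω₀.indicator μ w * cauchyKernel (z - w)) (τ * e) *
        lineSymbol s e g τ := by
  have key : firstTerm D Ω₀ s μ (τ * e) z =
      phaseTransform (fun w => Ω₀.indicator μ w * cauchyKernel (z - w)) (τ * e) *
        (((s : ℤ) : ℂ) * conj (Complex.I * (τ * e))) := by
    rw [firstTerm_eq D hΩ₀ hR hD hδ hT, phaseTransform, cauchyTransform, ← integral_mul_const]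
    refine integral_congr_ae (ae_of_all _ fun w => ?_)
    by_cases hw : w ∈ Ω₀
    · simp only [indicator_of_mem hw]
      ring
    · simp [indicator_of_notMem hw]
  rw [pairingIntegrand, key, lineSymbol]
  ring

lemma integrable_mul_phaseAverage {f : ℂ → ℂ} {b : ℝ → ℂ} (hf : Integrable f) (hb : Integrable b)
    (e : ℂ) : Integrable fun w => f w * phaseAverage b e w :=
  hf.mul_bdd (c := ∫ τ, ‖b τ‖) (continuous_phaseAverage hb e).aestronglyMeasurable
    (ae_of_all _ fun w => norm_phaseAverage_le b e w)

/-- Integrating in `τ` first shows that the pairing with `g` is, as a function of `z`, again a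
Cauchy transform of a density on `Ω₀`. The contour integral then collapses it to an integral over
`Ω₀`. -/
lemma isAveragedFirstTerm_of_symbol {Ω₀ : Set ℂ} (D : SmoothJordanDomain) (hΩ₀ : MeasurableSet Ω₀)
    (hΩ₀D : closure Ω₀ ⊆ D.carrier) (s : ℤˣ) (μ : CoeffSpace Ω₀) (G : Circle → 𝓢'(ℝ, ℂ))
    (hG : ∀ (e : Circle) (g : 𝓢(ℝ, ℂ)),
      G e g = ∫ τ : ℝ, symbol s (Ω₀.indicator μ) (τ * e) * fourierLine g τ) :
    IsAveragedFirstTerm D Ω₀ s μ G := by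
  obtain ⟨R, δ, hδ, hR, hD, hT⟩ := D.exists_geometry hΩ₀D
  intro e g
  have hμ := integrable_indicator_coeff hΩ₀ hR μ
  have hβ := integrable_lineSymbol s e g
  have hker : ∀ z : frontier D.carrier,
      Integrable fun w => Ω₀.indicator μ w * cauchyKernel (z - w) := fun z =>
    integrable_mul_cauchyKernel_of_sep hδ (hT z z.2) hμ
  have hΦ : Integrable (Ω₀.indicator fun w => μ w * phaseAverage (lineSymbol s e g) e w) :=
    (integrable_mul_phaseAverage hμ hβ e).congr
      (ae_of_all _ fun w => (indicator_mul_apply _ _ w).symm)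
  have hhat : firstTermHat D Ω₀ s μ e g = fun z : frontier D.carrier =>
      cauchyTransform (Ω₀.indicator fun w => μ w * phaseAverage (lineSymbol s e g) e w) z := by
    ext z
    rw [firstTermHat]
    simp_rw [pairingIntegrand_eq D hΩ₀ hR hD hδ hT]
    rw [integral_phaseTransform_line_mul (hker z) hβ, cauchyTransform]
    refine integral_congr_ae (ae_of_all _ fun w => ?_)
    simp only
    rw [indicator_mul_apply, phaseAverage]
    ring
  refine ⟨fun z => ?_, ?_, ?_⟩
  · refine Integrable.congr (hβ.bdd_mul (c := _) (f := fun τ : ℝ => phaseTransform (fun w =>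
      Ω₀.indicator μ w * cauchyKernel (z - w)) (τ * e)) ?_ (ae_of_all _ fun τ =>
      norm_phaseTransform_le _ _)) (ae_of_all _ fun τ =>
        (pairingIntegrand_eq D hΩ₀ hR hD hδ hT s μ e g z τ).symm)
    exact ((continuous_phaseTransform (hker z)).comp (by fun_prop)).aestronglyMeasurable
  · rw [hhat]
    exact (D.continuous_contourIntegrand_cauchyTransform hδ hT hΦ).intervalIntegrable 0 1
  -- The constant `2i / (2πi)` is the `1/π` in `symbol`.
  · rw [hhat, D.contourIntegral_cauchyTransform hδ hT (subset_closure.trans hΩ₀D) hΦ, hG]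
    simp_rw [indicator_mul_apply, phaseAverage]
    rw [← integral_phaseTransform_line_mul hμ hβ, ← integral_const_mul, ← integral_const_mul]
    refine integral_congr_ae (ae_of_all _ fun τ => ?_)
    have hpi : (Real.pi : ℂ) ≠ 0 := by exact_mod_cast Real.pi_ne_zero
    simp only [symbol, lineSymbol]
    field_simp

/-! ### Duality on the line -/

open scoped FourierTransform in
-- Conjugation turns the second transform into an inverse one. The factor `2π` is the missing
-- normalisation of the kernel `e^{-itτ}`, and it becomes the constant of Plancherel's identity on
-- each line.
lemma fourierLineCLM_conj_fourierLineCLM (a : 𝓢(ℝ, ℂ)) (τ : ℝ) :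
    fourierLine (conjSchwartz (fourierLineCLM a)) τ = 2 * Real.pi * conj (a τ) := by
  have hinv : a τ = 𝓕⁻ (𝓕 (a : ℝ → ℂ)) τ := by
    rw [MeasureTheory.Integrable.fourierInv_fourier_eq a.integrable
      (by rw [← SchwartzMap.fourier_coe]; exact (𝓕 a).integrable) a.continuous.continuousAt]
  have hval : ∀ t, conjSchwartz (fourierLineCLM a) t = conj (𝓕 (a : ℝ → ℂ) (t * (2 * Real.pi)⁻¹)) :=
    fun t => by
      rw [← fourierLine_eq_fourier, ← fourierLineCLM_apply]
      rfl
  have hΦ := Measure.integral_comp_mul_right (fun u : ℝ => conj (Complex.exp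
    (((2 * Real.pi * (τ * u) : ℝ) : ℂ) * Complex.I) * 𝓕 (a : ℝ → ℂ) u)) (2 * Real.pi)⁻¹
  rw [inv_inv, abs_of_pos (by positivity), Complex.real_smul] at hΦ
  rw [fourierLine, hinv, Real.fourierInv_eq']
  have hin : ∀ v : ℝ, inner ℝ v τ = τ * v := fun v => by simp
  simp_rw [hin, smul_eq_mul]
  rw [← integral_conj]
  push_cast at hΦ ⊢
  rw [← hΦ]
  refine integral_congr_ae (ae_of_all _ fun t => ?_)
  have hpi : (Real.pi : ℂ) ≠ 0 := by exact_mod_cast Real.pi_ne_zero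
  simp only [hval, map_mul, ← Complex.exp_conj, Complex.conj_ofReal, Complex.conj_I]
  congr 2
  simp only [map_inv₀, map_mul, Complex.conj_ofReal, map_ofNat]
  field_simp

lemma integral_fourierLine_mul_eq_flip {f g : ℝ → ℂ} (hf : Integrable f) (hg : Integrable g) :
    ∫ τ, fourierLine f τ * g τ = ∫ τ, f τ * fourierLine g τ := by
  have hc : Continuous fun p : ℝ × ℝ => Complex.exp (-(Complex.I * p.2 * p.1)) := by fun_prop
  have hprod : Integrable (fun p : ℝ × ℝ => Complex.exp (-(Complex.I * p.2 * p.1)) * f p.2 * g p.1)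
      (volume.prod volume) := by
    refine (hg.mul_prod hf).mono ((hc.aestronglyMeasurable.mul hf.aestronglyMeasurable.comp_snd).mul
      hg.aestronglyMeasurable.comp_fst) (ae_of_all _ fun p => ?_)
    have : -(Complex.I * p.2 * p.1) = ((-(p.2 * p.1) : ℝ) : ℂ) * Complex.I := by
      push_cast
      ring
    simp only [norm_mul, this, Complex.norm_exp_ofReal_mul_I, one_mul]
    rw [mul_comm]
  calc ∫ τ, fourierLine f τ * g τ
      = ∫ τ : ℝ, ∫ t : ℝ, Complex.exp (-(Complex.I * t * τ)) * f t * g τ := by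
        refine integral_congr_ae (ae_of_all _ fun τ => ?_)
        simp only
        rw [integral_mul_const]
        rfl
    _ = ∫ t : ℝ, ∫ τ : ℝ, Complex.exp (-(Complex.I * t * τ)) * f t * g τ :=
        integral_integral_swap hprod
    _ = _ := by
        refine integral_congr_ae (ae_of_all _ fun t => ?_)
        simp only [fourierLine]
        rw [← integral_const_mul]
        refine integral_congr_ae (ae_of_all _ fun τ => ?_)
        simp only
        rw [show Complex.I * t * τ = Complex.I * τ * t by ring]
        ring

end

noncomputable section

open scoped FourierTransform

/-! ### Tempered distributions given by functions of polynomial growth -/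

section Growth

variable {E : Type*} [NormedAddCommGroup E] [NormedSpace ℝ E] [FiniteDimensional ℝ E]
  [MeasureSpace E] [BorelSpace E] [(volume : Measure E).IsAddHaarMeasure]

/-- The distribution given by the product of a bounded function and a function of temperate
growth. -/
def growthDistribution (p : E → ℂ) {b : E → ℂ} (hb : MemLp b ⊤ volume) : 𝓢'(E, ℂ) :=
  TemperedDistribution.smulLeftCLM ℂ p (Lp.toTemperedDistribution (hb.toLp b))

lemma integrable_bounded_mul {b : E → ℂ} (hb : MemLp b ⊤ volume) (g : 𝓢(E, ℂ)) :
    Integrable fun x => b x * g x :=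
  memLp_one_iff_integrable.1 ((memLp_one_iff_integrable.2 g.integrable).mul hb)

lemma growthDistribution_apply {p : E → ℂ} (hp : p.HasTemperateGrowth) {b : E → ℂ}
    (hb : MemLp b ⊤ volume) (g : 𝓢(E, ℂ)) :
    growthDistribution p hb g = ∫ x, b x * (p x * g x) := by
  rw [growthDistribution, TemperedDistribution.smulLeftCLM_apply_apply,
    Lp.toTemperedDistribution_apply]
  refine integral_congr_ae ?_
  filter_upwards [hb.coeFn_toLp] with x hx
  rw [hx, SchwartzMap.smulLeftCLM_apply_apply hp, smul_eq_mul, smul_eq_mul, mul_comm]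

lemma isGivenBy_growthDistribution {p : ℂ → ℂ} (hp : p.HasTemperateGrowth) {b : ℂ → ℂ}
    (hb : MemLp b ⊤ volume) : IsGivenBy (growthDistribution p hb) fun z => b z * p z := by
  refine fun g => ⟨?_, ?_⟩
  · refine (integrable_bounded_mul hb (SchwartzMap.smulLeftCLM ℂ p g)).congr
      (ae_of_all _ fun z => ?_)
    simp only
    rw [SchwartzMap.smulLeftCLM_apply_apply hp, smul_eq_mul, mul_assoc]
  · simp_rw [growthDistribution_apply hp, mul_assoc]

end Growth

lemma memLp_top_of_continuous_of_bound {E : Type*} [TopologicalSpace E] [MeasurableSpace E]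
    [OpensMeasurableSpace E] [SecondCountableTopologyEither E ℂ] {μ : Measure E} {b : E → ℂ}
    (hb : Continuous b) (C : ℝ) (hC : ∀ x, ‖b x‖ ≤ C) : MemLp b ⊤ μ :=
  memLp_top_of_bound hb.aestronglyMeasurable C (ae_of_all _ hC)

/-! ### The phase transform as a Fourier transform -/

/-- The phase is `exp(-2i Re(kw))`, and `Re(kw)` is the real inner product of `w` with `conj k`.
Matching the kernel `e^{-2πi⟨w, ξ⟩}` gives `ξ = conj k / π`. -/
lemma phaseTransform_eq_fourier (f : ℂ → ℂ) (k : ℂ) :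
    phaseTransform f k = 𝓕 f (conj k / Real.pi) := by
  rw [Real.fourier_eq', phaseTransform]
  refine integral_congr_ae (ae_of_all _ fun w => ?_)
  have h1 : (inner ℝ w (conj k / Real.pi) : ℝ) = (k * w).re / Real.pi := by
    rw [div_eq_inv_mul, ← Complex.ofReal_inv, ← Complex.real_smul, inner_smul_right, Complex.inner]
    simp
    ring
  have hpi : (Real.pi : ℂ) ≠ 0 := by exact_mod_cast Real.pi_ne_zero
  simp only [smul_eq_mul]
  rw [mul_comm, phase, ← Complex.exp_conj, ← Complex.exp_add, h1]
  congr 2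
  apply Complex.ext
  · simp
    ring
  · simp
    field_simp
    ring

lemma norm_fourier_le {f : ℂ → ℂ} (ξ : ℂ) : ‖𝓕 f ξ‖ ≤ ∫ w, ‖f w‖ :=
  VectorFourier.norm_fourierIntegral_le_integral_norm _ _ _ _ _

lemma continuous_fourier {f : ℂ → ℂ} (hf : Integrable f) : Continuous (𝓕 f) :=
  VectorFourier.fourierIntegral_continuous Real.continuous_fourierChar
    (by exact continuous_inner) hf

/-! ### The symbol of a Schwartz function -/

/-- The line is parametrised with speed `1/π`. The lower bound on distances is what keeps the
restriction of a Schwartz function to the line Schwartz. -/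
lemma antilipschitzWith_smul_line {e : ℂ} (he : ‖e‖ = 1) :
    AntilipschitzWith (Real.toNNReal Real.pi) fun τ : ℝ => τ • (conj e / Real.pi) := by
  refine AntilipschitzWith.of_le_mul_dist fun x y => ?_
  rw [dist_eq_norm (_ • _), ← sub_smul, norm_smul, norm_div, RCLike.norm_conj, he, Complex.norm_real,
    Real.norm_of_nonneg Real.pi_pos.le, Real.coe_toNNReal _ Real.pi_pos.le, dist_eq_norm]
  have := Real.pi_pos
  field_simp
  exact le_rfl

/-- The restriction of the symbol of a Schwartz function to a line through the origin. -/
def symbolSchwartz (s : ℤˣ) (ψ : 𝓢(ℂ, ℂ)) (e : Circle) : 𝓢(ℝ, ℂ) :=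
  (((s : ℤ) : ℂ) / Real.pi * conj (Complex.I * e)) •
    SchwartzMap.smulLeftCLM ℂ (fun τ : ℝ => (τ : ℂ))
      (SchwartzMap.compCLMOfAntilipschitz ℂ (g := fun τ : ℝ => τ • (conj (e : ℂ) / Real.pi))
        (by fun_prop) (antilipschitzWith_smul_line (Circle.norm_coe e)) (𝓕 ψ))

lemma symbolSchwartz_apply (s : ℤˣ) (ψ : 𝓢(ℂ, ℂ)) (e : Circle) (τ : ℝ) :
    symbolSchwartz s ψ e τ = symbol s ψ (τ * e) := by
  rw [symbolSchwartz, smul_apply, SchwartzMap.smulLeftCLM_apply_apply (by fun_prop),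
    SchwartzMap.compCLMOfAntilipschitz_apply, symbol, phaseTransform_eq_fourier,
    Function.comp_apply, SchwartzMap.fourier_coe]
  have h : (τ • (conj (e : ℂ) / Real.pi) : ℂ) = conj ((τ : ℂ) * e) / Real.pi := by
    rw [map_mul, Complex.conj_ofReal, Complex.real_smul, mul_div_assoc]
  rw [h]
  simp only [smul_eq_mul, map_mul, Complex.conj_ofReal]
  ring

lemma symbol_congr_ae (s : ℤˣ) {f g : ℂ → ℂ} (h : f =ᵐ[volume] g) : symbol s f = symbol s g := by
  ext k
  rw [symbol, symbol, phaseTransform, phaseTransform, integral_congr_ae]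
  filter_upwards [h] with w hw
  rw [hw]

/-- The symbol depends only on the density in the plane, which is `ψ` almost everywhere whatever `D`
and `Ω₀` are; hence the independence of the domain. -/
lemma isAveragedTest_fourierLineCLM (s : ℤˣ) (ψ : 𝓢(ℂ, ℂ)) :
    IsAveragedTest s ψ fun e => fourierLineCLM (symbolSchwartz s ψ e) := by
  intro D Ω₀ hΩ₀ hΩ₀D hψ ν hν
  refine isAveragedFirstTerm_of_symbol D hΩ₀ hΩ₀D s ν _ fun e g => ?_
  have h1 : Ω₀.indicator ν =ᵐ[volume] ψ := by
    refine ((ae_eq_restrict_iff_indicator_ae_eq hΩ₀).1 hν).trans (ae_of_all _ fun z => ?_)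
    by_cases hz : z ∈ Ω₀
    · rw [indicator_of_mem hz]
    · rw [indicator_of_notMem hz, image_eq_zero_of_notMem_tsupport fun hz' => hz (hψ hz')]
  rw [symbol_congr_ae s h1]
  have h2 : ofSchwartz (fourierLineCLM (symbolSchwartz s ψ e)) g =
      ∫ t, fourierLine (symbolSchwartz s ψ e) t * g t := by
    rw [ofSchwartz, SchwartzMap.toTemperedDistributionCLM_apply_apply volume]
    simp_rw [fourierLineCLM_apply, smul_eq_mul, mul_comm]
  simp only
  rw [h2, integral_fourierLine_mul_eq_flip (symbolSchwartz s ψ e).integrable g.integrable]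
  simp_rw [symbolSchwartz_apply]

/-! ### The averaged first term as a distribution -/

lemma memLp_top_line_phaseTransform {f : ℂ → ℂ} (hf : Integrable f) (s : ℤˣ) (e : ℂ) :
    MemLp (fun τ : ℝ => ((s : ℤ) : ℂ) / Real.pi * conj (Complex.I * e) *
      phaseTransform f (τ * e)) ⊤ volume := by
  refine memLp_top_of_continuous_of_bound
    (continuous_const.mul ((continuous_phaseTransform hf).comp (by fun_prop)))
    (‖((s : ℤ) : ℂ) / Real.pi * conj (Complex.I * e)‖ * ∫ w, ‖f w‖) fun τ => ?_
  rw [norm_mul]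
  exact mul_le_mul_of_nonneg_left (norm_phaseTransform_le _ _) (norm_nonneg _)

/-- The distribution of the variable `t` with the Fourier symbol `τ ↦ symbol s f (τ e)`. -/
def averagedDistribution (s : ℤˣ) {f : ℂ → ℂ} (hf : Integrable f) (e : Circle) : 𝓢'(ℝ, ℂ) :=
  PointwiseConvergenceCLM.precomp ℂ fourierLineCLM
    (growthDistribution (fun τ : ℝ => (τ : ℂ)) (memLp_top_line_phaseTransform hf s e))

lemma averagedDistribution_apply (s : ℤˣ) {f : ℂ → ℂ} (hf : Integrable f) (e : Circle)
    (g : 𝓢(ℝ, ℂ)) :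
    averagedDistribution s hf e g = ∫ τ : ℝ, symbol s f (τ * e) * fourierLine g τ := by
  change growthDistribution (fun τ : ℝ => (τ : ℂ)) (memLp_top_line_phaseTransform hf s e)
    (fourierLineCLM g) = _
  rw [growthDistribution_apply (by fun_prop)]
  refine integral_congr_ae (ae_of_all _ fun τ => ?_)
  simp only [symbol, fourierLineCLM_apply, map_mul, Complex.conj_ofReal]
  ring

/-- Plancherel's identity in the radial variable, for one fixed direction. -/
lemma averagedDistribution_conj_fourierLineCLM (s : ℤˣ) {f : ℂ → ℂ} (hf : Integrable f) (e : Circle)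
    (ψ : 𝓢(ℂ, ℂ)) :
    averagedDistribution s hf e (conjSchwartz (fourierLineCLM (symbolSchwartz s ψ e))) =
      2 * Real.pi * ∫ τ : ℝ, symbol s f (τ * e) * conj (symbol s ψ (τ * e)) := by
  rw [averagedDistribution_apply, ← integral_const_mul]
  refine integral_congr_ae (ae_of_all _ fun τ => ?_)
  simp only [fourierLineCLM_conj_fourierLineCLM, symbolSchwartz_apply]
  ring

/-! ### The planar distributions -/

/-- The symbol `2π‖ξ‖` is not smooth at the origin and cannot serve as the factor of temperate
growth. It is split as `1 + ‖ξ‖²` times a quotient, and the quotient is at most `π` since `2‖ξ‖ ≤ 1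
+ ‖ξ‖²`. -/
lemma memLp_top_fourier_weight {f : ℂ → ℂ} (hf : Integrable f) :
    MemLp (fun ξ : ℂ => ((2 * Real.pi * ‖ξ‖ / (1 + ‖ξ‖ ^ 2) : ℝ) : ℂ) * 𝓕 f ξ) ⊤ volume := by
  have hne : ∀ ξ : ℂ, 1 + ‖ξ‖ ^ 2 ≠ 0 := fun ξ => by positivity
  refine memLp_top_of_continuous_of_bound (Continuous.mul ?_ (continuous_fourier hf))
    (Real.pi * ∫ w, ‖f w‖) fun ξ => ?_
  · exact Complex.continuous_ofReal.comp (Continuous.div (by fun_prop) (by fun_prop) hne)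
  · rw [norm_mul, Complex.norm_real, Real.norm_of_nonneg (by positivity)]
    refine mul_le_mul ?_ (norm_fourier_le ξ) (norm_nonneg _) Real.pi_pos.le
    rw [div_le_iff₀ (by positivity)]
    nlinarith [Real.pi_pos, mul_nonneg Real.pi_pos.le (sq_nonneg (‖ξ‖ - 1))]

/-- The distribution with Fourier transform `2π|ξ| 𝓕 f`. -/
def sqrtLaplacianDistribution {f : ℂ → ℂ} (hf : Integrable f) : 𝓢'(ℂ, ℂ) :=
  𝓕⁻ (growthDistribution (fun ξ : ℂ => ((1 + ‖ξ‖ ^ 2 : ℝ) : ℂ)) (memLp_top_fourier_weight hf))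

lemma hasTemperateGrowth_one_add_norm_sq :
    (fun ξ : ℂ => ((1 + ‖ξ‖ ^ 2 : ℝ) : ℂ)).HasTemperateGrowth := by
  have h : (fun ξ : ℂ => 1 + ‖ξ‖ ^ 2).HasTemperateGrowth :=
    (Function.HasTemperateGrowth.const 1).add (Function.hasTemperateGrowth_norm_sq ℂ)
  exact Complex.ofRealCLM.hasTemperateGrowth.comp h

lemma isGivenBy_fourier_sqrtLaplacianDistribution {f : ℂ → ℂ} (hf : Integrable f) :
    IsGivenBy (𝓕 (sqrtLaplacianDistribution hf))
      fun ξ => ((2 * Real.pi * ‖ξ‖ : ℝ) : ℂ) * 𝓕 f ξ := by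
  rw [sqrtLaplacianDistribution, FourierTransform.fourier_fourierInv_eq]
  convert isGivenBy_growthDistribution hasTemperateGrowth_one_add_norm_sq
    (memLp_top_fourier_weight hf) using 2 with ξ
  have hne : 1 + ‖ξ‖ ^ 2 ≠ 0 := by positivity
  rw [mul_right_comm _ (𝓕 f ξ) (_ : ℂ), ← Complex.ofReal_mul, div_mul_cancel₀ _ hne]

lemma sqrtLaplacianDistribution_apply {f : ℂ → ℂ} (hf : Integrable f) (g : 𝓢(ℂ, ℂ)) :
    sqrtLaplacianDistribution hf g = ∫ ξ, ((2 * Real.pi * ‖ξ‖ : ℝ) : ℂ) * 𝓕 f ξ * 𝓕⁻ g ξ := by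
  rw [← (isGivenBy_fourier_sqrtLaplacianDistribution hf (𝓕⁻ g)).2, TemperedDistribution.fourier_apply,
    FourierTransform.fourier_fourierInv_eq]

lemma integral_fourier_mul_eq_flip {f g : ℂ → ℂ} (hf : Integrable f) (hg : Integrable g) :
    ∫ ξ, 𝓕 f ξ * g ξ = ∫ x, f x * 𝓕 g x := by
  have := VectorFourier.integral_fourierIntegral_smul_eq_flip (L := innerₗ ℂ)
    Real.continuous_fourierChar continuous_inner hf hg
  simp only [flip_innerₗ, smul_eq_mul] at this
  exact this

/-- The division by `2π‖ξ‖` undoes the multiplication except at the origin, which is a null set. -/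
lemma isInvSqrtNegLaplacian_of_integrable {f : ℂ → ℂ} (hf : Integrable f) (v : 𝓢'(ℂ, ℂ))
    (hv : IsGivenBy v f) : IsInvSqrtNegLaplacian (sqrtLaplacianDistribution hf) v := by
  refine ⟨_, isGivenBy_fourier_sqrtLaplacianDistribution hf, fun g => ?_⟩
  have hae : (fun ξ : ℂ => 𝓕 f ξ * g ξ) =ᵐ[volume] fun ξ => ((2 * Real.pi * ‖ξ‖ : ℝ) : ℂ) * 𝓕 f ξ /
      ((2 * Real.pi * ‖ξ‖ : ℝ) : ℂ) * g ξ := by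
    filter_upwards [Measure.ae_ne volume (0 : ℂ)] with ξ hξ
    have hne : ((2 * Real.pi * ‖ξ‖ : ℝ) : ℂ) ≠ 0 := by
      have := norm_pos_iff.2 hξ
      exact_mod_cast (by positivity : (2 * Real.pi * ‖ξ‖ : ℝ) ≠ 0)
    rw [mul_div_cancel_left₀ _ hne]
  have hmem : MemLp (𝓕 f) ⊤ (volume : Measure ℂ) :=
    memLp_top_of_continuous_of_bound (continuous_fourier hf) _ norm_fourier_le
  refine ⟨(integrable_bounded_mul hmem g).congr hae, ?_⟩
  rw [← integral_congr_ae hae, TemperedDistribution.fourier_apply, (hv _).2,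
    integral_fourier_mul_eq_flip hf g.integrable]
  simp_rw [SchwartzMap.fourier_coe]

end

noncomputable section

open scoped FourierTransform

/-! ### Integration over all lines through the origin -/

/-- The integral over the open ray of angle `φ`. -/
def rayIntegral (H : ℂ → ℂ) (φ : ℝ) : ℂ :=
  ∫ τ in Ioi (0 : ℝ), H (τ * Complex.exp (φ * Complex.I))

lemma norm_le_on_line {H : ℂ → ℂ} {C : ℝ} (hC : ∀ k, ‖H k‖ ≤ C * (1 + ‖k‖ ^ 2)⁻¹) (τ φ : ℝ) :
    ‖H (τ * Complex.exp (φ * Complex.I))‖ ≤ C * (1 + τ ^ 2)⁻¹ := by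
  refine (hC _).trans_eq ?_
  rw [norm_mul, Complex.norm_exp_ofReal_mul_I, mul_one, Complex.norm_real, Real.norm_eq_abs, sq_abs]

lemma continuous_line {H : ℂ → ℂ} (hH : Continuous H) (φ : ℝ) :
    Continuous fun τ : ℝ => H (τ * Complex.exp (φ * Complex.I)) :=
  hH.comp (by fun_prop)

lemma integrable_line {H : ℂ → ℂ} (hH : Continuous H) {C : ℝ}
    (hC : ∀ k, ‖H k‖ ≤ C * (1 + ‖k‖ ^ 2)⁻¹) (φ : ℝ) :
    Integrable fun τ : ℝ => H (τ * Complex.exp (φ * Complex.I)) :=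
  (integrable_inv_one_add_sq.const_mul C).mono' (continuous_line hH φ).aestronglyMeasurable
    (ae_of_all _ fun τ => norm_le_on_line hC τ φ)

lemma continuous_rayIntegral {H : ℂ → ℂ} (hH : Continuous H) {C : ℝ}
    (hC : ∀ k, ‖H k‖ ≤ C * (1 + ‖k‖ ^ 2)⁻¹) : Continuous (rayIntegral H) := by
  refine continuous_of_dominated (bound := fun τ => C * (1 + τ ^ 2)⁻¹)
    (fun φ => (continuous_line hH φ).aestronglyMeasurable)
    (fun φ => ae_of_all _ fun τ => norm_le_on_line hC τ φ)
    (integrable_inv_one_add_sq.const_mul C).integrableOn (ae_of_all _ fun τ => ?_)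
  exact hH.comp (by fun_prop)

lemma periodic_rayIntegral (H : ℂ → ℂ) : Function.Periodic (rayIntegral H) (2 * Real.pi) := by
  intro φ
  simp only [rayIntegral]
  push_cast
  simp_rw [add_mul, Complex.exp_add, Complex.exp_two_pi_mul_I, mul_one]

/-- The negative half of the line of angle `φ` is the ray of angle `φ + π`. -/
lemma integral_line_eq_rayIntegral_add {H : ℂ → ℂ} (hH : Continuous H) {C : ℝ}
    (hC : ∀ k, ‖H k‖ ≤ C * (1 + ‖k‖ ^ 2)⁻¹) (φ : ℝ) :
    ∫ τ : ℝ, H (τ * Complex.exp (φ * Complex.I)) = rayIntegral H φ + rayIntegral H (φ + Real.pi) := by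
  have hint := integrable_line hH hC φ
  rw [← intervalIntegral.integral_Iic_add_Ioi (b := 0) hint.integrableOn hint.integrableOn, add_comm]
  congr 1
  have := integral_comp_neg_Ioi (0 : ℝ) fun τ : ℝ => H (τ * Complex.exp (φ * Complex.I))
  rw [neg_zero] at this
  rw [← this, rayIntegral]
  push_cast
  simp_rw [add_mul, Complex.exp_add, Complex.exp_pi_mul_I, mul_neg_one, mul_neg, neg_mul]

lemma continuous_integral_line {H : ℂ → ℂ} (hH : Continuous H) {C : ℝ}
    (hC : ∀ k, ‖H k‖ ≤ C * (1 + ‖k‖ ^ 2)⁻¹) :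
    Continuous fun φ : ℝ => ∫ τ : ℝ, H (τ * Complex.exp (φ * Complex.I)) := by
  simp_rw [integral_line_eq_rayIntegral_add hH hC]
  have := continuous_rayIntegral hH hC
  fun_prop

/-- The weight `‖k‖⁻¹` cancels the Jacobian of polar coordinates. -/
lemma integral_norm_inv_smul_eq_intervalIntegral {H : ℂ → ℂ} (hH : Continuous H) {C : ℝ}
    (hC : ∀ k, ‖H k‖ ≤ C * (1 + ‖k‖ ^ 2)⁻¹) :
    ∫ k : ℂ, ‖k‖⁻¹ • H k = ∫ φ in (-Real.pi)..Real.pi, rayIntegral H φ := by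
  have hcont : Continuous fun p : ℝ × ℝ => H (p.1 * Complex.exp (p.2 * Complex.I)) :=
    hH.comp (by fun_prop)
  have hint : Integrable (fun p : ℝ × ℝ => H (p.1 * Complex.exp (p.2 * Complex.I)))
      ((volume.restrict (Ioi (0 : ℝ))).prod (volume.restrict (Ioo (-Real.pi) Real.pi))) := by
    have h1 : Integrable (fun τ : ℝ => C * (1 + τ ^ 2)⁻¹) (volume.restrict (Ioi (0 : ℝ))) :=
      (integrable_inv_one_add_sq.const_mul C).integrableOn
    exact (h1.comp_fst _).mono' hcont.aestronglyMeasurable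
      (ae_of_all _ fun p => norm_le_on_line hC p.1 p.2)
  rw [← Complex.integral_comp_polarCoord_symm]
  calc ∫ p in polarCoord.target, p.1 • (‖Complex.polarCoord.symm p‖⁻¹ •
        H (Complex.polarCoord.symm p))
      = ∫ p in polarCoord.target, H (p.1 * Complex.exp (p.2 * Complex.I)) := by
        refine setIntegral_congr_fun polarCoord.open_target.measurableSet fun p hp => ?_
        have hp1 : 0 < p.1 := by
          rw [polarCoord_target] at hp
          exact hp.1
        rw [Complex.norm_polarCoord_symm, abs_of_pos hp1, smul_smul, mul_inv_cancel₀ hp1.ne',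
          one_smul, Complex.polarCoord_symm_apply, Complex.exp_mul_I]
        push_cast
        rfl
    _ = ∫ φ in Ioo (-Real.pi) Real.pi, rayIntegral H φ := by
        rw [polarCoord_target, Measure.volume_eq_prod, ← Measure.prod_restrict,
          integral_prod_symm _ hint]
        rfl
    _ = _ := by
        rw [intervalIntegral.integral_of_le (by linarith [Real.pi_pos]),
          integral_Ioc_eq_integral_Ioo]

/-- Every nonzero `k` lies on two oriented lines, those of directions `k/‖k‖` and `-k/‖k‖`; hence
the factor two. -/
lemma intervalIntegral_integral_line {H : ℂ → ℂ} (hH : Continuous H) {C : ℝ}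
    (hC : ∀ k, ‖H k‖ ≤ C * (1 + ‖k‖ ^ 2)⁻¹) :
    ∫ φ in (0 : ℝ)..(2 * Real.pi), ∫ τ : ℝ, H (τ * Complex.exp (φ * Complex.I)) =
      2 * ∫ k : ℂ, ‖k‖⁻¹ • H k := by
  have hc := continuous_rayIntegral hH hC
  have hper := periodic_rayIntegral H
  simp_rw [integral_line_eq_rayIntegral_add hH hC]
  have hc' : Continuous fun φ => rayIntegral H (φ + Real.pi) := by fun_prop
  rw [intervalIntegral.integral_add (hc.intervalIntegrable _ _) (hc'.intervalIntegrable _ _),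
    intervalIntegral.integral_comp_add_right, integral_norm_inv_smul_eq_intervalIntegral hH hC]
  have h1 := hper.intervalIntegral_add_eq 0 (-Real.pi)
  have h2 := hper.intervalIntegral_add_eq (0 + Real.pi) (-Real.pi)
  rw [zero_add] at h1
  rw [show 0 + Real.pi + 2 * Real.pi = 2 * Real.pi + Real.pi by ring] at h2
  rw [show -Real.pi + 2 * Real.pi = Real.pi by ring] at h1 h2
  rw [h1, h2, two_mul]

/-! ### The adjoint -/

lemma integral_comp_conj_div_pi (Ψ : ℂ → ℂ) :
    ∫ k : ℂ, Ψ (conj k / Real.pi) = (Real.pi : ℂ) ^ 2 * ∫ ξ, Ψ ξ := by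
  have h1 : ∫ k : ℂ, Ψ (conj k / Real.pi) = ∫ k : ℂ, Ψ (k / Real.pi) :=
    Complex.conjLIE.measurePreserving.integral_comp
      Complex.conjLIE.toHomeomorph.measurableEmbedding fun k => Ψ (k / Real.pi)
  have h2 : ∀ k : ℂ, k / Real.pi = Real.pi⁻¹ • k := fun k => by
    rw [Complex.real_smul, Complex.ofReal_inv, div_eq_inv_mul]
  rw [h1]
  simp_rw [h2]
  rw [Measure.integral_comp_smul, Complex.finrank_real_complex, inv_pow, inv_inv,
    abs_of_nonneg (by positivity), Complex.real_smul, Complex.ofReal_pow]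

lemma fourierInv_conjSchwartz (ψ : 𝓢(ℂ, ℂ)) (ξ : ℂ) :
    𝓕⁻ (conjSchwartz ψ) ξ = conj (𝓕 (ψ : ℂ → ℂ) ξ) := by
  rw [SchwartzMap.fourierInv_coe, Real.fourierInv_eq', Real.fourier_eq', ← integral_conj]
  refine integral_congr_ae (ae_of_all _ fun w => ?_)
  have h : conjSchwartz ψ w = conj (ψ w) := rfl
  simp only [smul_eq_mul, map_mul, ← Complex.exp_conj, Complex.conj_ofReal, Complex.conj_I, h]
  congr 2
  push_cast
  ring

lemma continuous_symbol (s : ℤˣ) {f : ℂ → ℂ} (hf : Integrable f) : Continuous (symbol s f) := by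
  have := continuous_phaseTransform hf
  unfold symbol
  have := Complex.continuous_conj
  fun_prop

lemma units_int_sq (s : ℤˣ) : ((s : ℤ) : ℂ) * ((s : ℤ) : ℂ) = 1 := by
  rw [← Int.cast_mul, ← Units.val_mul, Int.units_mul_self]
  simp

/-- The sign enters squared and disappears, so both signs give the same normal operator. The factors
`conj(ik)` combine to `‖k‖²`. -/
lemma symbol_mul_conj_symbol (s : ℤˣ) (f g : ℂ → ℂ) (k : ℂ) :
    symbol s f k * conj (symbol s g k) = ((‖k‖ ^ 2 : ℝ) : ℂ) / (Real.pi : ℂ) ^ 2 *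
      (𝓕 f (conj k / Real.pi) * conj (𝓕 g (conj k / Real.pi))) := by
  have hk : conj k * k = ((‖k‖ ^ 2 : ℝ) : ℂ) := by
    rw [mul_comm, Complex.mul_conj, Complex.normSq_eq_norm_sq]
  rw [symbol, symbol, phaseTransform_eq_fourier, phaseTransform_eq_fourier, ← hk]
  simp only [map_mul, map_div₀, Complex.conj_conj, Complex.conj_ofReal, Complex.conj_I, map_intCast,
    map_neg]
  linear_combination (conj k * k / (Real.pi : ℂ) ^ 2 *
      (𝓕 f (conj k / Real.pi) * conj (𝓕 g (conj k / Real.pi)))) *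
    (-(Complex.I ^ 2) * units_int_sq s - Complex.I_sq)

lemma exists_norm_symbol_mul_conj_symbol_le (s : ℤˣ) (f : ℂ → ℂ) (ψ : 𝓢(ℂ, ℂ)) :
    ∃ C : ℝ, ∀ k, ‖symbol s f k * conj (symbol s ψ k)‖ ≤ C * (1 + ‖k‖ ^ 2)⁻¹ := by
  -- The product already grows like `‖k‖²`, and the bound asks for one more factor `1 + ‖k‖²`: hence
  -- decay of orders two and four.
  obtain ⟨C₂, -, h₂⟩ := (𝓕 ψ).decay 2 0
  obtain ⟨C₄, -, h₄⟩ := (𝓕 ψ).decay 4 0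
  simp only [norm_iteratedFDeriv_zero] at h₂ h₄
  refine ⟨(∫ w, ‖f w‖) * (C₂ + Real.pi ^ 2 * C₄), fun k => ?_⟩
  set ξ : ℂ := conj k / Real.pi with hξ
  have hk : ‖k‖ = Real.pi * ‖ξ‖ := by
    rw [hξ, norm_div, RCLike.norm_conj, Complex.norm_real, Real.norm_of_nonneg Real.pi_pos.le]
    field_simp
  have hf := norm_fourier_le (f := f) ξ
  have hψ : 𝓕 (ψ : ℂ → ℂ) ξ = (𝓕 ψ) ξ := by rw [SchwartzMap.fourier_coe]
  rw [symbol_mul_conj_symbol, ← hξ, norm_mul, norm_mul, norm_div, norm_pow, Complex.norm_real,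
    Complex.norm_real, RCLike.norm_conj, hψ, Real.norm_of_nonneg (by positivity),
    Real.norm_of_nonneg Real.pi_pos.le, hk, le_mul_inv_iff₀ (by positivity)]
  have hpi := Real.pi_pos
  calc (Real.pi * ‖ξ‖) ^ 2 / Real.pi ^ 2 * (‖𝓕 f ξ‖ * ‖(𝓕 ψ) ξ‖) * (1 + (Real.pi * ‖ξ‖) ^ 2)
      = ‖𝓕 f ξ‖ * (‖ξ‖ ^ 2 * ‖(𝓕 ψ) ξ‖ + Real.pi ^ 2 * (‖ξ‖ ^ 4 * ‖(𝓕 ψ) ξ‖)) := by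
        field_simp
    _ ≤ _ := by
        gcongr
        · exact h₂ ξ
        · exact h₄ ξ

/-- The constants cancel: `(2π)⁻¹` from the angular measure, `2π` from Plancherel, `2` from the
double cover by lines, `(2π²)⁻¹` from rewriting `‖k‖/π²` through `2π‖ξ‖`, and `π²` from `k = π conj
ξ`. -/
lemma isAdjointImage_averagedDistribution (s : ℤˣ) {f : ℂ → ℂ} (hf : Integrable f) :
    IsAdjointImage s (averagedDistribution s hf) (sqrtLaplacianDistribution hf) := by
  intro ψ _
  obtain ⟨C, hC⟩ := exists_norm_symbol_mul_conj_symbol_le s f ψ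
  have hH : Continuous fun k => symbol s f k * conj (symbol s ψ k) :=
    (continuous_symbol s hf).mul (Complex.continuous_conj.comp (continuous_symbol s ψ.integrable))
  refine ⟨_, isAveragedTest_fourierLineCLM s ψ, ?_, ?_⟩ <;>
    simp_rw [averagedDistribution_conj_fourierLineCLM, Circle.coe_exp]
  · exact (continuous_const.mul (continuous_integral_line hH hC)).intervalIntegrable _ _
  · have hpi : (Real.pi : ℂ) ≠ 0 := by exact_mod_cast Real.pi_ne_zero
    rw [intervalIntegral.integral_const_mul, intervalIntegral_integral_line hH hC,
      sqrtLaplacianDistribution_apply]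
    simp_rw [fourierInv_conjSchwartz]
    have hpt : ∀ k : ℂ, ‖k‖⁻¹ • (symbol s f k * conj (symbol s ψ k)) =
        (2 * (Real.pi : ℂ) ^ 2)⁻¹ * (fun ξ : ℂ => ((2 * Real.pi * ‖ξ‖ : ℝ) : ℂ) * 𝓕 f ξ *
          conj (𝓕 (ψ : ℂ → ℂ) ξ)) (conj k / Real.pi) := fun k => by
      rw [symbol_mul_conj_symbol, Complex.real_smul]
      simp only [norm_div, RCLike.norm_conj, Complex.norm_real, Real.norm_of_nonneg Real.pi_pos.le]
      rcases eq_or_ne k 0 with rfl | hk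
      · simp
      · have hk' : (‖k‖ : ℂ) ≠ 0 := by exact_mod_cast norm_ne_zero_iff.2 hk
        push_cast
        field_simp
    rw [integral_congr_ae (ae_of_all _ hpt), integral_const_mul,
      integral_comp_conj_div_pi fun ξ : ℂ => ((2 * Real.pi * ‖ξ‖ : ℝ) : ℂ) * 𝓕 f ξ *
        conj (𝓕 (ψ : ℂ → ℂ) ξ)]
    field_simp

end

/-! ### The inversion formula -/

theorem theorem1p2 (D : SmoothJordanDomain) (Ω₀ : Set ℂ) (hΩ₀ : MeasurableSet Ω₀)
    (hΩ₀D : closure Ω₀ ⊆ D.carrier) (s : ℤˣ) :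
    (∀ k : ℂ, (∀ᶠ μ : CoeffSpace Ω₀ in 𝓝 0, ∃! y, IsCGOTrace D Ω₀ s k μ y) ∧
      DifferentiableAt ℝ (cgoMap D Ω₀ s k) 0) ∧
    ∀ μ : CoeffSpace Ω₀, ∃ G : Circle → 𝓢'(ℝ, ℂ), IsAveragedFirstTerm D Ω₀ s μ G ∧
      ∃ w : 𝓢'(ℂ, ℂ), IsAdjointImage s G w ∧
        ∃ v : 𝓢'(ℂ, ℂ), IsGivenBy v (Ω₀.indicator μ) ∧ IsInvSqrtNegLaplacian w v := by
  obtain ⟨R, δ, hδ, hR, hD, hT⟩ := D.exists_geometry hΩ₀D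
  refine ⟨fun k => ⟨eventually_existsUnique_isCGOTrace D hΩ₀ hR hD hδ hT s k,
    (hasFDerivAt_cgoMap D hΩ₀ hR hD hδ hT s k).differentiableAt⟩, fun μ => ?_⟩
  have hμ := integrable_indicator_coeff hΩ₀ hR μ
  have hmem : MemLp (Ω₀.indicator μ) ⊤ volume :=
    (memLp_indicator_iff_restrict hΩ₀).2 (Lp.memLp μ)
  -- The coefficient itself, viewed as a distribution: it is bounded, so the growth factor is
  -- trivial.
  have hv : IsGivenBy (growthDistribution (fun _ => 1) hmem) (Ω₀.indicator μ) := by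
    simpa using isGivenBy_growthDistribution (p := fun _ => 1)
      (Function.HasTemperateGrowth.const 1) hmem
  exact ⟨averagedDistribution s hμ, isAveragedFirstTerm_of_symbol D hΩ₀ hΩ₀D s μ _
    fun e g => averagedDistribution_apply s hμ e g, sqrtLaplacianDistribution hμ,
    isAdjointImage_averagedDistribution s hμ, _, hv, isInvSqrtNegLaplacian_of_integrable hμ _ hv⟩
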